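/- Let $l,m>0$, $\Omega=[-l,l]\times\mathbb R$. For $\hbar,\alpha>0$ put $\eta_{qp}(x)=(2\pi\alpha^2)^{-1/4}\exp\{-\frac{(x-q)^2}{4\alpha^2}+\frac{ip(x-q)}{\hbar}\}$ and let $\omega_{qp}(x)=\sum_{n\in\mathbb Z}(-1)^n\eta_{qp}[(-1)^n(x-2nl)]$, $(q,p)\in\Omega$, be the coherent states in $L_2(-l,l)$; let $\omega_{qp,t}=e^{-itH/\hbar}\omega_{qp}$, where $H=-\frac{\hbar^2}{2m}\frac{d^2}{dx^2}$ is the Hamiltonian of the infinite square well on $[-l,l]$ (Dirichlet conditions at $\pm l$), and let $T_{rev}=\frac{16ml^2}{\pi\hbar}$. Let $\mathscr S(\Omega)$ be the space of $C^\infty$ functions $\sigma:\mathbb R^2\to\mathbb R$ with $\sigma[(-1)^n(q+2nl),(-1)^np]=\sigma(q,p)$ for all $n\in\mathbb Z$ for which all the seminorms $P_N(\sigma)=\max_{s_1+s_2\le N}\sup_{\mathbb R^2}(1+p^2)^{N/2}\left|\frac{\partial^{s_1+s_2}\sigma}{\partial q^{s_1}\partial p^{s_2}}\right|$, $N=0,1,2,\ldots$,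 are finite, with the topology given by these seminorms, and let $\mathscr S'(\Omega)$ be the space of continuous linear functionals on it, with convergence tested on each $\sigma$. For $b,p\in\mathbb R$ define the distribution $\Phi_D(b,p)=\varphi_D(q'-b)\,\delta(p'-p)$ by $(\Phi_D(b,p),\sigma)=\int_{-\infty}^{\infty}\frac{1}{\sqrt{2\pi D^2}}e^{-\frac{(q'-b)^2}{2D^2}}\sigma(q',p)\,dq'$ for $0<D<\infty$, $(\Phi_0(b,p),\sigma)=\sigma(b,p)$, and $(\Phi_\infty(b,p),\sigma)=\frac1{4l}\int_{-l}^{l}[\sigma(q',p)+\sigma(q',-p)]\,dq'$, that is, $\Phi_\infty(b,p)=\frac1{4l}[\delta(p'-p)+\delta(p'+p)]$. Let $c\in\mathbb R$, $D\in[0,\infty]$, and let $\hbar\to0$, $\alpha\to0$ ($\hbar,\alpha>0$), $\frac\hbar\alpha\to0$, and let $t$ vary so that $\frac\hbar\alpha(t-cT_{rev})\to2mD$ and $\hbar(t-cT_{rev})\to0$. If $c$ is rational, $c=\frac MN$ in lowest terms with $N\ge1$, let $N'=N$ for odd $N$ and $N'=\frac N2$ for even $N$, let $a=\frac{4l}N$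 if $N\equiv2\pmod 4$ and $a=0$ otherwise, and put $$L_{qp}=\frac1{N'}\sum_{k=0}^{N'-1}\Phi_D\Big(q+\frac{4kl}{N'}+a-\frac pm(t-cT_{rev}),\,p\Big).$$ If $c$ is irrational, put $L_{qp}=\frac1{4l}[\delta(p'-p)+\delta(p'+p)]$ (whatever $D$ is). Then, $(q',p')$ being the variables of integration with the test functions, $$\frac{1}{2\pi\hbar}\left|(\omega_{qp},\omega_{q'p',t})\right|^2-L_{qp}\to0\quad\text{in }\mathscr S'(\Omega)$$ for every fixed $(q,p)\in\Omega$ with $p\neq0$ and, if $c$ is an integer or half-integer, for every fixed $(q,p)\in\Omega$ other than $(\pm l,0)$. For each test function the convergence is uniform with respect to $(q,p)$ on every subset of $\Omega$ disjoint from some neighbourhood of the segment $\{p=0\}\subset\Omega$. If $c$ is an integer or half-integer, the convergence is uniform on every subset of $\Omega$ disjoint from some neighbourhoods of the points $(\pm l,0)$. -/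

import Mathlib

open MeasureTheory Set Filter Topology
open scoped ENNReal ContDiff

noncomputable section

/-! ### Test functions and distributions on the strip `[-l, l] × ℝ` -/

/-- The partial derivative with respect to the position variable. -/
def derivQ (f : ℝ × ℝ → ℝ) : ℝ × ℝ → ℝ := fun z => fderiv ℝ f z (1, 0)

/-- The partial derivative with respect to the momentum variable. -/
def derivP (f : ℝ × ℝ → ℝ) : ℝ × ℝ → ℝ := fun z => fderiv ℝ f z (0, 1)

/-- The mixed partial derivative `∂^(s₁+s₂) f / ∂q^s₁ ∂p^s₂`. -/
def mixedDeriv (s₁ s₂ : ℕ) (f : ℝ × ℝ → ℝ) : ℝ × ℝ → ℝ := derivQ^[s₁] (derivP^[s₂] f)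

theorem ContDiff.derivQ_smooth {f : ℝ × ℝ → ℝ} (hf : ContDiff ℝ ∞ f) :
    ContDiff ℝ ∞ (derivQ f) :=
  (hf.fderiv_right (m := ∞) (by simp)).clm_apply contDiff_const

theorem ContDiff.derivP_smooth {f : ℝ × ℝ → ℝ} (hf : ContDiff ℝ ∞ f) :
    ContDiff ℝ ∞ (derivP f) :=
  (hf.fderiv_right (m := ∞) (by simp)).clm_apply contDiff_const

theorem iterate_derivQ_smooth (s : ℕ) {f : ℝ × ℝ → ℝ} (hf : ContDiff ℝ ∞ f) :
    ContDiff ℝ ∞ (derivQ^[s] f) := by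
  induction s generalizing f with
  | zero => exact hf
  | succ s ih => exact ih hf.derivQ_smooth

theorem iterate_derivP_smooth (s : ℕ) {f : ℝ × ℝ → ℝ} (hf : ContDiff ℝ ∞ f) :
    ContDiff ℝ ∞ (derivP^[s] f) := by
  induction s generalizing f with
  | zero => exact hf
  | succ s ih => exact ih hf.derivP_smooth

theorem derivQ_add {f g : ℝ × ℝ → ℝ} (hf : ContDiff ℝ ∞ f) (hg : ContDiff ℝ ∞ g) :
    derivQ (f + g) = derivQ f + derivQ g := by
  funext z
  have h := fderiv_add (hf.differentiable (by simp) z) (hg.differentiable (by simp) z)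
  simp [derivQ, h]

theorem derivP_add {f g : ℝ × ℝ → ℝ} (hf : ContDiff ℝ ∞ f) (hg : ContDiff ℝ ∞ g) :
    derivP (f + g) = derivP f + derivP g := by
  funext z
  have h := fderiv_add (hf.differentiable (by simp) z) (hg.differentiable (by simp) z)
  simp [derivP, h]

theorem derivQ_smul (a : ℝ) {f : ℝ × ℝ → ℝ} (hf : ContDiff ℝ ∞ f) :
    derivQ (a • f) = a • derivQ f := by
  funext z
  have h := fderiv_const_smul (hf.differentiable (by simp) z) a
  simp [derivQ, h]

theorem derivP_smul (a : ℝ) {f : ℝ × ℝ → ℝ} (hf : ContDiff ℝ ∞ f) :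
    derivP (a • f) = a • derivP f := by
  funext z
  have h := fderiv_const_smul (hf.differentiable (by simp) z) a
  simp [derivP, h]

theorem mixedDeriv_add (s₁ s₂ : ℕ) {f g : ℝ × ℝ → ℝ} (hf : ContDiff ℝ ∞ f)
    (hg : ContDiff ℝ ∞ g) :
    mixedDeriv s₁ s₂ (f + g) = mixedDeriv s₁ s₂ f + mixedDeriv s₁ s₂ g := by
  have hP : derivP^[s₂] (f + g) = derivP^[s₂] f + derivP^[s₂] g := by
    clear s₁
    induction s₂ generalizing f g with
    | zero => rfl
    | succ s ih =>
      simp only [Function.iterate_succ_apply]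
      rw [derivP_add hf hg, ih hf.derivP_smooth hg.derivP_smooth]
  have hQ : ∀ (s : ℕ) {u v : ℝ × ℝ → ℝ}, ContDiff ℝ ∞ u → ContDiff ℝ ∞ v →
      derivQ^[s] (u + v) = derivQ^[s] u + derivQ^[s] v := by
    intro s
    induction s with
    | zero => intro u v _ _; rfl
    | succ s ih =>
      intro u v hu hv
      simp only [Function.iterate_succ_apply]
      rw [derivQ_add hu hv, ih hu.derivQ_smooth hv.derivQ_smooth]
  unfold mixedDeriv
  rw [hP, hQ s₁ (iterate_derivP_smooth s₂ hf) (iterate_derivP_smooth s₂ hg)]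

theorem mixedDeriv_smul (s₁ s₂ : ℕ) (a : ℝ) {f : ℝ × ℝ → ℝ} (hf : ContDiff ℝ ∞ f) :
    mixedDeriv s₁ s₂ (a • f) = a • mixedDeriv s₁ s₂ f := by
  have hP : derivP^[s₂] (a • f) = a • derivP^[s₂] f := by
    clear s₁
    induction s₂ generalizing f with
    | zero => rfl
    | succ s ih =>
      simp only [Function.iterate_succ_apply]
      rw [derivP_smul a hf, ih hf.derivP_smooth]
  have hQ : ∀ (s : ℕ) {u : ℝ × ℝ → ℝ}, ContDiff ℝ ∞ u →
      derivQ^[s] (a • u) = a • derivQ^[s] u := by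
    intro s
    induction s with
    | zero => intro u _; rfl
    | succ s ih =>
      intro u hu
      simp only [Function.iterate_succ_apply]
      rw [derivQ_smul a hu, ih hu.derivQ_smooth]
  unfold mixedDeriv
  rw [hP, hQ s₁ (iterate_derivP_smooth s₂ hf)]

/-- The vector space `𝒮(Ω)`: smooth functions on `ℝ²` with
`σ((-1)ⁿ(q + 2nl), (-1)ⁿ p) = σ(q, p)` all of whose partial derivatives decay rapidly in `p`,
uniformly in `q` (that is, all the seminorms below are finite). -/
def boxTestSubmodule (l : ℝ) : Submodule ℝ (ℝ × ℝ → ℝ) where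
  carrier := {σ |
    (∀ (n : ℤ) (q p : ℝ), σ ((-1) ^ n * (q + 2 * n * l), (-1) ^ n * p) = σ (q, p)) ∧
    ContDiff ℝ ∞ σ ∧
    ∀ N s₁ s₂ : ℕ, ∃ C : ℝ, ∀ z : ℝ × ℝ,
      (1 + z.2 ^ 2) ^ ((N : ℝ) / 2) * |mixedDeriv s₁ s₂ σ z| ≤ C}
  add_mem' := by
    rintro f g ⟨hf1, hf2, hf3⟩ ⟨hg1, hg2, hg3⟩
    refine ⟨fun n q p => ?_, hf2.add hg2, fun N s₁ s₂ => ?_⟩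
    · simp only [Pi.add_apply, hf1, hg1]
    · obtain ⟨A, hA⟩ := hf3 N s₁ s₂
      obtain ⟨B, hB⟩ := hg3 N s₁ s₂
      refine ⟨A + B, fun z => ?_⟩
      rw [mixedDeriv_add s₁ s₂ hf2 hg2, Pi.add_apply]
      have hw : 0 ≤ (1 + z.2 ^ 2) ^ ((N : ℝ) / 2) := by positivity
      have h := mul_le_mul_of_nonneg_left
        (abs_add_le (mixedDeriv s₁ s₂ f z) (mixedDeriv s₁ s₂ g z)) hw
      linarith [hA z, hB z]
  zero_mem' := by
    refine ⟨fun n q p => rfl, contDiff_const, fun N s₁ s₂ => ⟨0, fun z => ?_⟩⟩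
    have h := mixedDeriv_smul s₁ s₂ 0 (f := (0 : ℝ × ℝ → ℝ)) contDiff_const
    rw [zero_smul, zero_smul] at h
    simp [h]
  smul_mem' := by
    rintro a f ⟨hf1, hf2, hf3⟩
    refine ⟨fun n q p => ?_, contDiff_const.smul hf2, fun N s₁ s₂ => ?_⟩
    · simp only [Pi.smul_apply, hf1]
    · obtain ⟨A, hA⟩ := hf3 N s₁ s₂
      refine ⟨|a| * A, fun z => ?_⟩
      rw [mixedDeriv_smul s₁ s₂ a hf2, Pi.smul_apply, smul_eq_mul, abs_mul]
      have h := mul_le_mul_of_nonneg_left (hA z) (abs_nonneg a)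
      linarith

/-- The space of test functions `𝒮(Ω)`. -/
def BoxTest (l : ℝ) : Type := ↥(boxTestSubmodule l)

instance (l : ℝ) : AddCommGroup (BoxTest l) := inferInstanceAs (AddCommGroup ↥(boxTestSubmodule l))

instance (l : ℝ) : Module ℝ (BoxTest l) := inferInstanceAs (Module ℝ ↥(boxTestSubmodule l))

/-- Test functions are functions on `ℝ²`. -/
instance (l : ℝ) : FunLike (BoxTest l) (ℝ × ℝ) ℝ where
  coe σ := Subtype.val (p := fun f => f ∈ boxTestSubmodule l) σ
  coe_injective := Subtype.val_injective

theorem BoxTest.mem {l : ℝ} (σ : BoxTest l) : (σ : ℝ × ℝ → ℝ) ∈ boxTestSubmodule l :=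
  Subtype.property (p := fun f => f ∈ boxTestSubmodule l) σ

theorem BoxTest.coe_add {l : ℝ} (f g : BoxTest l) :
    ((f + g : BoxTest l) : ℝ × ℝ → ℝ) = (f : ℝ × ℝ → ℝ) + g := rfl

theorem BoxTest.coe_smul {l : ℝ} (a : ℝ) (f : BoxTest l) :
    ((a • f : BoxTest l) : ℝ × ℝ → ℝ) = a • (f : ℝ × ℝ → ℝ) := rfl

theorem bddAbove_boxTest {l : ℝ} (N s₁ s₂ : ℕ) (σ : BoxTest l) :
    BddAbove (range fun z : ℝ × ℝ => (1 + z.2 ^ 2) ^ ((N : ℝ) / 2) * |mixedDeriv s₁ s₂ σ z|) := by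
  obtain ⟨C, hC⟩ := σ.mem.2.2 N s₁ s₂
  exact ⟨C, by rintro _ ⟨z, rfl⟩; exact hC z⟩

/-- `σ ↦ sup (1 + p²)^(N/2) |∂^(s₁+s₂) σ / ∂q^s₁ ∂p^s₂|`. -/
def boxSeminormAux (l : ℝ) (N s₁ s₂ : ℕ) : Seminorm ℝ (BoxTest l) :=
  Seminorm.of
    (fun σ => ⨆ z : ℝ × ℝ, (1 + z.2 ^ 2) ^ ((N : ℝ) / 2) * |mixedDeriv s₁ s₂ σ z|)
    (by
      intro f g
      refine ciSup_le fun z => ?_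
      rw [BoxTest.coe_add, mixedDeriv_add s₁ s₂ f.mem.2.1 g.mem.2.1, Pi.add_apply]
      have hw : 0 ≤ (1 + z.2 ^ 2) ^ ((N : ℝ) / 2) := by positivity
      have h1 := mul_le_mul_of_nonneg_left
        (abs_add_le (mixedDeriv s₁ s₂ f z) (mixedDeriv s₁ s₂ g z)) hw
      have h2 := le_ciSup (bddAbove_boxTest N s₁ s₂ f) z
      have h3 := le_ciSup (bddAbove_boxTest N s₁ s₂ g) z
      beta_reduce at h2 h3
      linarith)
    (by
      intro a f
      rw [BoxTest.coe_smul, mixedDeriv_smul s₁ s₂ a f.mem.2.1, Real.norm_eq_abs,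
        Real.mul_iSup_of_nonneg (abs_nonneg a)]
      congr 1
      funext z
      rw [Pi.smul_apply, smul_eq_mul, abs_mul]
      ring)

/-- The seminorms `P_N(σ) = max_{s₁+s₂ ≤ N} sup (1 + p²)^(N/2) |∂^(s₁+s₂) σ / ∂q^s₁ ∂p^s₂|`. -/
def boxSeminorm (l : ℝ) : SeminormFamily ℝ (BoxTest l) ℕ := fun N =>
  (((Finset.range (N + 1)) ×ˢ (Finset.range (N + 1))).filter fun s => s.1 + s.2 ≤ N).sup
    fun s => boxSeminormAux l N s.1 s.2

/-- The topology of `𝒮(Ω)` is the locally convex one given by the seminorms `P_N`. -/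
instance (l : ℝ) : TopologicalSpace (BoxTest l) := (boxSeminorm l).moduleFilterBasis.topology

/-- `𝒮'(Ω)`: continuous linear functionals on `𝒮(Ω)`, with convergence tested against each
`σ ∈ 𝒮(Ω)`. -/
abbrev BoxDistribution (l : ℝ) : Type := WeakDual ℝ (BoxTest l)

/-- The phase space `Ω = [-l, l] × ℝ`. -/
def phaseStrip (l : ℝ) : Set (ℝ × ℝ) := Icc (-l) l ×ˢ univ

/-! ### The Hamiltonian of the box and its evolution operator -/

/-- The Hilbert space `L₂(-l, l)`. -/
abbrev BoxL2 (l : ℝ) : Type := Lp ℂ 2 (volume.restrict (Icc (-l) l))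

/-- The graph of the Hamiltonian `H = -(h²/2m) d²/dx²` of the infinite well: `φ` lies in the
domain and `H φ = χ`. The function `u` represents `φ`, `v = u'` is absolutely continuous,
`w = u''` is square integrable, and `u (± l) = 0`. -/
def BoxHamiltonian (h m l : ℝ) (φ χ : BoxL2 l) : Prop :=
  ∃ u v w : ℝ → ℂ,
    MemLp w 2 (volume.restrict (Icc (-l) l)) ∧
    (∀ x ∈ Icc (-l) l, v x = v (-l) + ∫ y in (-l)..x, w y) ∧
    (∀ x ∈ Icc (-l) l, u x = u (-l) + ∫ y in (-l)..x, v y) ∧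
    u (-l) = 0 ∧ u l = 0 ∧
    (φ : ℝ → ℂ) =ᵐ[volume.restrict (Icc (-l) l)] u ∧
    (χ : ℝ → ℂ) =ᵐ[volume.restrict (Icc (-l) l)] fun x => -((h ^ 2 / (2 * m) : ℝ) : ℂ) * w x

/-- The (closed) eigenspace of the Hamiltonian for the energy `E`. -/
def boxEigenspace (h m l E : ℝ) : Submodule ℂ (BoxL2 l) :=
  (Submodule.span ℂ {φ : BoxL2 l | BoxHamiltonian h m l φ ((E : ℂ) • φ)}).topologicalClosure

instance (h m l E : ℝ) : CompleteSpace (boxEigenspace h m l E) :=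
  inferInstanceAs (CompleteSpace
    (Submodule.span ℂ {φ : BoxL2 l | BoxHamiltonian h m l φ ((E : ℂ) • φ)}).topologicalClosure)

/-- The evolution operator `U_t = exp(-i t H / h)`, by the spectral calculus: `H` is
self-adjoint with pure point spectrum, so `U_t = ∑_E exp(-i t E / h) P_E`, where `P_E` is the
orthogonal projection onto the eigenspace of the energy `E` (zero if `E` is not an eigenvalue)
and the series converges in `L₂(-l, l)`. -/
def boxEvolution (h m l t : ℝ) (φ : BoxL2 l) : BoxL2 l :=
  ∑' E : ℝ, Complex.exp (-Complex.I * t * E / h) • (boxEigenspace h m l E).starProjection φ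

/-! ### Coherent states -/

/-- The coherent state `η_{qp}` on the line. -/
def lineCoherent (h α q p x : ℝ) : ℂ :=
  (((2 * Real.pi * α ^ 2) ^ (1 / 4 : ℝ) : ℝ) : ℂ)⁻¹ *
    Complex.exp (-(x - q) ^ 2 / (4 * α ^ 2) + Complex.I * p * (x - q) / h)

/-- The coherent state `ω_{qp}` in the box, as a function. -/
def boxCoherent (h α l q p x : ℝ) : ℂ :=
  ∑' n : ℤ, (-1 : ℂ) ^ n * lineCoherent h α q p ((-1) ^ n * (x - 2 * n * l))

theorem norm_lineCoherent (h α q p x : ℝ) :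
    ‖lineCoherent h α q p x‖ =
      |((2 * Real.pi * α ^ 2) ^ (1 / 4 : ℝ))⁻¹| * Real.exp (-(x - q) ^ 2 / (4 * α ^ 2)) := by
  have e : (-((x : ℂ) - q) ^ 2 / (4 * α ^ 2) + Complex.I * p * (x - q) / h) =
      ((-(x - q) ^ 2 / (4 * α ^ 2) : ℝ) : ℂ) + ((p * (x - q) / h : ℝ) : ℂ) * Complex.I := by
    push_cast; ring
  unfold lineCoherent
  rw [norm_mul, e, Complex.exp_add, norm_mul, Complex.norm_exp_ofReal_mul_I, mul_one,
    ← Complex.ofReal_exp, Complex.norm_real, norm_inv, Complex.norm_real, abs_inv,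
    Real.norm_eq_abs, Real.norm_eq_abs, Real.abs_exp]

theorem summable_gauss_int {b : ℝ} (hb : 0 < b) :
    Summable fun n : ℤ => Real.exp (-b * (n : ℝ) ^ 2) := by
  have h := (summable_pow_mul_jacobiTheta₂_term_bound 0 (T := b / Real.pi)
    (div_pos hb Real.pi_pos) 0)
  refine h.congr fun n => ?_
  simp only [pow_zero, one_mul]
  congr 1
  have := Real.pi_ne_zero
  field_simp
  ring

theorem continuousOn_boxCoherent {α l : ℝ} (hα : 0 < α) (hl : 0 < l) (h q p : ℝ) :
    ContinuousOn (boxCoherent h α l q p) (Icc (-l) l) := by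
  set A : ℝ := |((2 * Real.pi * α ^ 2) ^ (1 / 4 : ℝ))⁻¹| with hA
  set B : ℝ := Real.exp ((l + |q|) ^ 2 / (4 * α ^ 2)) with hB
  have hs : Summable fun n : ℤ => A * B * Real.exp (-(l ^ 2 / (2 * α ^ 2)) * (n : ℝ) ^ 2) :=
    (summable_gauss_int (by positivity)).mul_left _
  refine continuousOn_tsum (fun n => ?_) hs fun n x hx => ?_
  · apply Continuous.continuousOn
    unfold lineCoherent
    fun_prop
  · have hsgn : ((-1 : ℝ) ^ n = 1) ∨ ((-1 : ℝ) ^ n = -1) := by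
      rcases Int.even_or_odd n with he | ho
      · exact Or.inl he.neg_one_zpow
      · exact Or.inr ho.neg_one_zpow
    have hn1 : ‖(-1 : ℂ) ^ n‖ = 1 := by simp
    rw [norm_mul, hn1, one_mul, norm_lineCoherent, mul_assoc A B, hB, ← Real.exp_add]
    refine mul_le_mul_of_nonneg_left (Real.exp_le_exp.2 ?_) (abs_nonneg _)
    have key : 2 * (n * l) ^ 2 ≤ (l + |q|) ^ 2 + ((-1) ^ n * (x - 2 * n * l) - q) ^ 2 := by
      have gen : ∀ d : ℝ, |d| ≤ l + |q| →
          2 * (n * l) ^ 2 ≤ (l + |q|) ^ 2 + (d - 2 * n * l) ^ 2 := by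
        intro d hd
        have h1 : d ^ 2 ≤ (l + |q|) ^ 2 := by
          rw [← sq_abs d]; exact pow_le_pow_left₀ (abs_nonneg d) hd 2
        nlinarith [sq_nonneg (d - n * l)]
      have hx' : |x| ≤ l := abs_le.2 ⟨hx.1, hx.2⟩
      rcases hsgn with hh | hh
      · have := gen (x - q) ((abs_sub x q).trans (by linarith))
        rw [hh]; convert this using 2; ring
      · have := gen (x + q) ((abs_add_le x q).trans (by linarith))
        rw [hh]; convert this using 2; ring
    rw [← sub_nonneg]
    have e : (l + |q|) ^ 2 / (4 * α ^ 2) + -(l ^ 2 / (2 * α ^ 2)) * (n : ℝ) ^ 2 -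
        -((-1) ^ n * (x - 2 * n * l) - q) ^ 2 / (4 * α ^ 2) =
        ((l + |q|) ^ 2 + ((-1) ^ n * (x - 2 * n * l) - q) ^ 2 - 2 * (n * l) ^ 2) /
          (4 * α ^ 2) := by
      field_simp
      ring
    rw [e]
    exact div_nonneg (by linarith) (by positivity)

theorem memLp_boxCoherent {α l : ℝ} (hα : 0 < α) (hl : 0 < l) (h q p : ℝ) :
    MemLp (boxCoherent h α l q p) 2 (volume.restrict (Icc (-l) l)) := by
  have hc := continuousOn_boxCoherent hα hl h q p
  obtain ⟨C, hC⟩ := isCompact_Icc.exists_bound_of_continuousOn hc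
  refine MemLp.of_bound (hc.aestronglyMeasurable measurableSet_Icc) C ?_
  exact (ae_restrict_iff' measurableSet_Icc).2 (Eventually.of_forall hC)

open Classical in
/-- The class in `L₂(-l, l)` of a square integrable function. -/
def toBoxL2 (l : ℝ) (f : ℝ → ℂ) : BoxL2 l :=
  if hf : MemLp f 2 (volume.restrict (Icc (-l) l)) then hf.toLp f else 0

/-- The coherent state `ω_z`, `z = (q, p)`, as an element of `L₂(-l, l)`
(square integrable by `memLp_boxCoherent`). -/
def boxState (h α l : ℝ) (z : ℝ × ℝ) : BoxL2 l := toBoxL2 l (boxCoherent h α l z.1 z.2)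

/-- The density `(1 / 2πh) |(ω_z, ω_{z',t})|²`, where `ω_{z',t} = U_t ω_{z'}`. -/
def transitionDensity (h α m l t : ℝ) (z z' : ℝ × ℝ) : ℝ :=
  1 / (2 * Real.pi * h) *
    ‖inner ℂ (boxState h α l z) (boxEvolution h m l t (boxState h α l z'))‖ ^ 2

/-! ### The limiting distributions -/

/-- The Gaussian `φ_D`. -/
def spreadGaussian (D x : ℝ) : ℝ :=
  1 / Real.sqrt (2 * Real.pi * D ^ 2) * Real.exp (-x ^ 2 / (2 * D ^ 2))

/-- The value on `σ` of `φ_D(q' - b) δ(p' - p)`: for `0 < D < ∞` the integral over the whole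
line, for `D = 0` the distribution `δ(q' - b, p' - p)`, and for `D = ∞` the distribution
`(1/4l) [δ(p' - p) + δ(p' + p)]`. -/
def spreadPacket (l : ℝ) (D : ℝ≥0∞) (b p : ℝ) (σ : BoxTest l) : ℝ :=
  if D = 0 then σ (b, p)
  else if D = ⊤ then
    1 / (4 * l) * (∫ x in (-l)..l, σ (x, p)) + 1 / (4 * l) * ∫ x in (-l)..l, σ (x, -p)
  else ∫ x : ℝ, spreadGaussian D.toReal (x - b) * σ (x, p)

/-- The number `N'` of packets: `N` for odd `N` and `N / 2` for even `N`. -/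
def packetCount (N : ℕ) : ℕ := if Even N then N / 2 else N

/-- The shift `a`: `4l / N` if `N ≡ 2 (mod 4)` and `0` otherwise. -/
def packetShift (l : ℝ) (N : ℕ) : ℝ := if N % 4 = 2 then 4 * l / N else 0

open Classical in
/-- The value on `σ` of the limiting distribution at `z = (q, p)`; here `s = t - c T_rev`. For
rational `c` with reduced denominator `N` it is the average of `N'` shifted packets, for
irrational `c` it is `(1/4l) [δ(p' - p) + δ(p' + p)]`. -/
def limitPairing (l m c : ℝ) (D : ℝ≥0∞) (s : ℝ) (z : ℝ × ℝ) (σ : BoxTest l) : ℝ :=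
  if hc : ∃ r : ℚ, (r : ℝ) = c then
    1 / (packetCount hc.choose.den : ℝ) * ∑ k ∈ Finset.range (packetCount hc.choose.den),
      spreadPacket l D
        (z.1 + 4 * k * l / packetCount hc.choose.den + packetShift l hc.choose.den - z.2 / m * s)
        z.2 σ
  else spreadPacket l ⊤ 0 z.2 σ

/-- The revival time `T_rev = 16 m l² / (π h)` of the box. -/
def boxRevivalTime (h m l : ℝ) : ℝ := 16 * m * l ^ 2 / (Real.pi * h)

end

/-!
# Revivals of wave packets in the infinite square well

The sine functions `sineMode l k`, `k ≥ 1`, are a complete set of eigenfunctions of the Hamiltonian,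
so that `boxEvolution` multiplies the `k`-th sine coefficient by a phase (`boxEvolution_eq_tsum`). A
box coherent state is a sum over mirror images of a Gaussian; unfolding this sum turns its sine
coefficients into Fourier transforms of one Gaussian on the line (`inner_sineVec_boxState`). The
transition amplitude is therefore a series of plane waves with Gaussian coefficients concentrated
near `κ_k = ± p / h`, where `κ_k = π k / 2l`.

Pairing the squared amplitude with a test function `σ` gives a double series
(`integral_transitionDensity_mul`). Its terms couple the plane waves `k` and `k - j` through the
`j`-th Fourier coefficient of `σ` in the position variable, averaged over a momentum window of
width of order `h / α → 0`. The relative phase at time `c T_rev + s` is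
`exp (-2πi c (2kj - j²))` times the phase of the classical motion during the time `s`
(`conj_boxPhase_mul_boxPhase`). For fixed `j` the sum over `k` splits into a direct term, a wide
Gaussian centred at the momentum of the packet, and an interference term between the packet and its
mirror image, a Gaussian centred at zero momentum (`pairTerm_eq`).

Poisson summation in `k` (`thetaSum_eq`) gives the limits. The direct term survives only if the
phases `exp (-4πi c j k)` are trivial, that is, if `2cj` is an integer; then a phase
`exp (2πi c j²)` remains together with the damping `exp (-κ_j² D² / 2)`, which comes from the
spreading of the packet during the time `s` (`tendsto_direct`, `tendsto_damping`). The interference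
term is exponentially small if `|p|` is bounded below (`tendsto_cross_of_momentum`). If `2c` is an
integer, it also vanishes for positions bounded away from the walls, because it oscillates in `k`
with the phase `π (q + l) / l`, which is then bounded away from `2πℤ` (`tendsto_cross_of_position`).
The Fourier coefficients of `σ` are summable in `j` uniformly in the momentum, so the sum over `j`
may be taken in the limit. All this holds along any filter on which the phase point may vary
(`tendsto_integral_sub_limitTerm`), which yields uniform convergence at no extra cost.

The limiting series is the Fourier series of the limiting distribution (`hasSum_limitTerm`). For
`c = M / N` the resonance condition says that `N'` divides `j`, which is what the average over `N'`
equidistant translates selects, and on these `j` the phase `exp (2πi c j²)` is that of the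
translation by `a`. For irrational `c` only `j = 0` is resonant.
-/

/-! ### Integration by parts against an absolutely continuous function -/

/-- Integration by parts for the primitive of an integrable function, which need not be
differentiable everywhere. -/
theorem integral_mul_eq_sub_of_primitive_real {a b : ℝ} {g g' w : ℝ → ℝ}
    (hg : ∀ x, HasDerivAt g (g' x) x) (hg' : Continuous g')
    (hw : IntervalIntegrable w volume a b) :
    ∫ x in a..b, g x * w x =
      g b * (∫ y in a..b, w y) - ∫ x in a..b, g' x * ∫ y in a..x, w y := by
  have hG : AbsolutelyContinuousOnInterval (fun x => ∫ y in a..x, w y) a b :=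
    hw.absolutelyContinuousOnInterval_intervalIntegral left_mem_uIcc
  have hd : deriv g = g' := funext fun x => (hg x).deriv
  have hgAC : AbsolutelyContinuousOnInterval g a b := by
    apply ContDiffOn.absolutelyContinuousOnInterval
    apply ContDiff.contDiffOn
    exact contDiff_one_iff_deriv.2 ⟨fun x => (hg x).differentiableAt, by rw [hd]; exact hg'⟩
  have h := hgAC.integral_mul_deriv_eq_deriv_mul hG
  rw [hd] at h
  simp only [intervalIntegral.integral_same, mul_zero, sub_zero] at h
  rw [← h]
  apply intervalIntegral.integral_congr_ae
  filter_upwards [hw.ae_hasDerivAt_integral] with x hx hxm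
  rw [(hx (uIoc_subset_uIcc hxm) a left_mem_uIcc).deriv]

/-- Integration by parts when `v` is merely a primitive of an integrable function `w`. -/
theorem integral_mul_eq_sub_of_primitive {a b : ℝ} (hab : a ≤ b) {g g' : ℝ → ℝ} {v w : ℝ → ℂ}
    (hg : ∀ x, HasDerivAt g (g' x) x) (hg' : Continuous g')
    (hw : IntervalIntegrable w volume a b)
    (hv : ∀ x ∈ Icc a b, v x = v a + ∫ y in a..x, w y) :
    ∫ x in a..b, (g x : ℂ) * w x =
      g b * v b - g a * v a - ∫ x in a..b, (g' x : ℂ) * v x := by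
  have hgc : Continuous g := continuous_iff_continuousAt.2 fun x => (hg x).continuousAt
  have hwr : IntervalIntegrable (fun x => (w x).re) volume a b :=
    ⟨hw.1.re, hw.2.re⟩
  have hwi : IntervalIntegrable (fun x => (w x).im) volume a b :=
    ⟨hw.1.im, hw.2.im⟩
  have hsub : ∀ x ∈ Icc a b, IntervalIntegrable w volume a x := fun x hx =>
    hw.mono_set (by rw [uIcc_of_le hab, uIcc_of_le hx.1]; exact Icc_subset_Icc le_rfl hx.2)
  have hre : ∀ {f : ℝ → ℂ} {c d : ℝ}, IntervalIntegrable f volume c d →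
      (∫ x in c..d, f x).re = ∫ x in c..d, (f x).re := fun hf =>
    (Complex.reCLM.intervalIntegral_comp_comm hf).symm
  have him : ∀ {f : ℝ → ℂ} {c d : ℝ}, IntervalIntegrable f volume c d →
      (∫ x in c..d, f x).im = ∫ x in c..d, (f x).im := fun hf =>
    (Complex.imCLM.intervalIntegral_comp_comm hf).symm
  have hW : ContinuousOn (fun x => ∫ y in a..x, w y) (Icc a b) := by
    have := intervalIntegral.continuousOn_primitive_interval' hw left_mem_uIcc
    rwa [uIcc_of_le hab] at this
  have hgw : IntervalIntegrable (fun x => (g x : ℂ) * w x) volume a b :=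
    hw.continuousOn_mul (Complex.continuous_ofReal.comp hgc).continuousOn
  have hg'W : IntervalIntegrable (fun x => (g' x : ℂ) * ∫ y in a..x, w y) volume a b := by
    apply ContinuousOn.intervalIntegrable
    rw [uIcc_of_le hab]
    exact (Complex.continuous_ofReal.comp hg').continuousOn.mul hW
  have key : ∫ x in a..b, (g x : ℂ) * w x =
      g b * (∫ y in a..b, w y) - ∫ x in a..b, (g' x : ℂ) * ∫ y in a..x, w y := by
    apply Complex.ext
    · rw [hre hgw, Complex.sub_re, hre hg'W, Complex.re_ofReal_mul, hre hw]
      simp only [Complex.re_ofReal_mul]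
      rw [integral_mul_eq_sub_of_primitive_real hg hg' hwr]
      congr 1
      apply intervalIntegral.integral_congr
      intro x hx
      rw [uIcc_of_le hab] at hx
      simp only [hre (hsub x hx)]
    · rw [him hgw, Complex.sub_im, him hg'W, Complex.im_ofReal_mul, him hw]
      simp only [Complex.im_ofReal_mul]
      rw [integral_mul_eq_sub_of_primitive_real hg hg' hwi]
      congr 1
      apply intervalIntegral.integral_congr
      intro x hx
      rw [uIcc_of_le hab] at hx
      simp only [him (hsub x hx)]
  have hfund : ∫ x in a..b, (g' x : ℂ) = g b - g a := by
    rw [intervalIntegral.integral_ofReal,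
      intervalIntegral.integral_eq_sub_of_hasDerivAt (fun x _ => hg x) (hg'.intervalIntegrable _ _)]
    push_cast; rfl
  have hvI : ∫ x in a..b, (g' x : ℂ) * v x =
      (g b - g a) * v a + ∫ x in a..b, (g' x : ℂ) * ∫ y in a..x, w y := by
    rw [← hfund, ← intervalIntegral.integral_mul_const, ← intervalIntegral.integral_add _ hg'W]
    · apply intervalIntegral.integral_congr
      intro x hx
      rw [uIcc_of_le hab] at hx
      simp only
      rw [hv x hx]; ring
    · exact ((Complex.continuous_ofReal.comp hg').mul continuous_const).intervalIntegrable _ _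
  rw [key, hvI, hv b (right_mem_Icc.2 hab)]
  ring

/-! ### The sine basis of `L₂(-l, l)` -/

/-- The wave number `π k / 2l`. -/
noncomputable def boxWave (l : ℝ) (k : ℤ) : ℝ := Real.pi * k / (2 * l)

/-- The `k`-th normalized eigenfunction of the box. It is odd in `k`, and for `k ≥ 1` these
functions form an orthonormal basis of `L₂(-l, l)`. As a function on the whole line it is
`4l`-periodic and odd about the points `±l`. -/
noncomputable def sineMode (l : ℝ) (k : ℤ) (x : ℝ) : ℝ :=
  Real.sin (boxWave l k * (x + l)) / Real.sqrt l

/-- The energy `h² κ² / 2m` of the `k`-th eigenfunction. -/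
noncomputable def boxEnergy (h m l : ℝ) (k : ℤ) : ℝ := h ^ 2 / (2 * m) * boxWave l k ^ 2

/-- The class of `sineMode l k` in `L₂(-l, l)`. -/
noncomputable def sineVec (l : ℝ) (k : ℤ) : BoxL2 l := toBoxL2 l fun x => (sineMode l k x : ℂ)

theorem continuous_sineMode (l : ℝ) (k : ℤ) : Continuous (sineMode l k) := by
  unfold sineMode; fun_prop

theorem abs_sineMode_le (l : ℝ) (k : ℤ) (x : ℝ) : |sineMode l k x| ≤ (Real.sqrt l)⁻¹ := by
  rw [sineMode, abs_div, abs_of_nonneg (Real.sqrt_nonneg l), div_eq_mul_inv]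
  exact mul_le_of_le_one_left (inv_nonneg.2 (Real.sqrt_nonneg l)) (Real.abs_sin_le_one _)

theorem memLp_sineMode (l : ℝ) (k : ℤ) :
    MemLp (fun x => (sineMode l k x : ℂ)) 2 (volume.restrict (Icc (-l) l)) := by
  refine MemLp.of_bound (by have := continuous_sineMode l k; fun_prop) (Real.sqrt l)⁻¹ ?_
  refine Eventually.of_forall fun x => ?_
  rw [Complex.norm_real, Real.norm_eq_abs]
  exact abs_sineMode_le l k x

theorem coeFn_toBoxL2 {l : ℝ} {f : ℝ → ℂ} (hf : MemLp f 2 (volume.restrict (Icc (-l) l))) :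
    (toBoxL2 l f : ℝ → ℂ) =ᵐ[volume.restrict (Icc (-l) l)] f := by
  rw [toBoxL2, dif_pos hf]
  exact hf.coeFn_toLp

theorem integral_Icc_eq_intervalIntegral {l : ℝ} (hl : 0 ≤ l) (f : ℝ → ℂ) :
    ∫ x in Icc (-l) l, f x = ∫ x in (-l)..l, f x := by
  rw [intervalIntegral.integral_of_le (by linarith), integral_Icc_eq_integral_Ioc]

theorem inner_sineVec {l : ℝ} (hl : 0 ≤ l) (k : ℤ) (φ : BoxL2 l) :
    inner ℂ (sineVec l k) φ = ∫ x in (-l)..l, (sineMode l k x : ℂ) * φ x := by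
  rw [L2.inner_def, ← integral_Icc_eq_intervalIntegral hl]
  apply integral_congr_ae
  filter_upwards [coeFn_toBoxL2 (memLp_sineMode l k)] with x hx
  rw [sineVec, hx]
  simp [mul_comm]

theorem boxWave_mul_two_l {l : ℝ} (hl : 0 < l) (k : ℤ) :
    boxWave l k * (l + l) = k * Real.pi := by
  rw [boxWave]; field_simp; ring

theorem sineMode_left (l : ℝ) (k : ℤ) : sineMode l k (-l) = 0 := by
  simp [sineMode]

theorem sineMode_right {l : ℝ} (hl : 0 < l) (k : ℤ) : sineMode l k l = 0 := by
  rw [sineMode, boxWave_mul_two_l hl, Real.sin_int_mul_pi, zero_div]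

theorem norm_sineVec {l : ℝ} (hl : 0 < l) {k : ℤ} (hk : k ≠ 0) : ‖sineVec l k‖ = 1 := by
  have hw : boxWave l k ≠ 0 := by
    rw [boxWave]; have := Real.pi_ne_zero; have : (k : ℝ) ≠ 0 := by exact_mod_cast hk
    positivity
  have h1 : inner ℂ (sineVec l k) (sineVec l k) = 1 := by
    rw [inner_sineVec hl.le, ← integral_Icc_eq_intervalIntegral hl.le]
    have : ∫ x in Icc (-l) l, (sineMode l k x : ℂ) * (sineVec l k) x =
        ∫ x in Icc (-l) l, ((sineMode l k x ^ 2 : ℝ) : ℂ) := by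
      apply integral_congr_ae
      filter_upwards [coeFn_toBoxL2 (memLp_sineMode l k)] with x hx
      rw [sineVec, hx]; push_cast; ring
    rw [this, integral_Icc_eq_intervalIntegral hl.le, intervalIntegral.integral_ofReal]
    have h2 : ∫ x in (-l)..l, sineMode l k x ^ 2 = 1 := by
      simp only [sineMode, div_pow, Real.sq_sqrt hl.le]
      rw [intervalIntegral.integral_div]
      have := intervalIntegral.integral_comp_mul_add (a := -l) (b := l)
        (fun y => Real.sin y ^ 2) hw (boxWave l k * l)
      simp only [← mul_add] at this
      rw [this, integral_sin_sq, neg_add_cancel, mul_zero, boxWave_mul_two_l hl,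
        Real.sin_int_mul_pi, Real.sin_zero, boxWave]
      have := Real.pi_ne_zero; have : (k : ℝ) ≠ 0 := by exact_mod_cast hk
      simp; field_simp
    rw [h2]; simp
  have h2 := inner_self_eq_norm_sq_to_K (𝕜 := ℂ) (sineVec l k)
  rw [h1] at h2
  have h3 : ‖sineVec l k‖ ^ 2 = 1 := by
    have : ((‖sineVec l k‖ ^ 2 : ℝ) : ℂ) = 1 := by rw [h2]; simp
    exact_mod_cast this
  exact (pow_eq_one_iff_of_nonneg (norm_nonneg _) two_ne_zero).1 h3

theorem hasDerivAt_sineMode (l : ℝ) (k : ℤ) (x : ℝ) :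
    HasDerivAt (sineMode l k) (boxWave l k * Real.cos (boxWave l k * (x + l)) / Real.sqrt l) x := by
  have h := ((((hasDerivAt_id x).add_const l).const_mul (boxWave l k)).sin).div_const (Real.sqrt l)
  refine h.congr_deriv ?_
  simp; ring

theorem hasDerivAt_cosMode (l : ℝ) (k : ℤ) (x : ℝ) :
    HasDerivAt (fun x => boxWave l k * Real.cos (boxWave l k * (x + l)) / Real.sqrt l)
      (-(boxWave l k ^ 2 * sineMode l k x)) x := by
  have h := (((((hasDerivAt_id x).add_const l).const_mul (boxWave l k)).cos).const_mul
    (boxWave l k)).div_const (Real.sqrt l)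
  refine h.congr_deriv ?_
  simp [sineMode]; ring

/-- The Hamiltonian is symmetric against its eigenfunctions. -/
theorem inner_sineVec_of_boxHamiltonian {h m l : ℝ} (hl : 0 < l) (k : ℤ) {φ χ : BoxL2 l}
    (H : BoxHamiltonian h m l φ χ) :
    inner ℂ (sineVec l k) χ = boxEnergy h m l k * inner ℂ (sineVec l k) φ := by
  obtain ⟨u, v, w, hw, hv, hu, hul, hur, hφ, hχ⟩ := H
  have hab : -l ≤ l := by linarith
  have hwI : IntervalIntegrable w volume (-l) l := by
    rw [intervalIntegrable_iff_integrableOn_Icc_of_le hab]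
    exact hw.integrable (by norm_num)
  have hvI : IntervalIntegrable v volume (-l) l := by
    apply ContinuousOn.intervalIntegrable
    rw [uIcc_of_le hab]
    have := intervalIntegral.continuousOn_primitive_interval' hwI left_mem_uIcc
    rw [uIcc_of_le hab] at this
    exact (continuousOn_const.add this).congr hv
  have e1 := integral_mul_eq_sub_of_primitive hab (hasDerivAt_sineMode l k) (by fun_prop) hwI hv
  have e2 := integral_mul_eq_sub_of_primitive hab (hasDerivAt_cosMode l k)
    (by have := continuous_sineMode l k; fun_prop) hvI hu
  rw [sineMode_left, sineMode_right hl, e2, hul, hur] at e1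
  rw [inner_sineVec hl.le, inner_sineVec hl.le, ← integral_Icc_eq_intervalIntegral hl.le,
    ← integral_Icc_eq_intervalIntegral hl.le]
  have i1 : ∫ x in Icc (-l) l, (sineMode l k x : ℂ) * χ x =
      ∫ x in Icc (-l) l, -((h ^ 2 / (2 * m) : ℝ) : ℂ) * ((sineMode l k x : ℂ) * w x) := by
    apply integral_congr_ae
    filter_upwards [hχ] with x hx
    rw [hx]; ring
  have i2 : ∫ x in Icc (-l) l, (sineMode l k x : ℂ) * φ x =
      ∫ x in Icc (-l) l, ((sineMode l k x : ℂ) * u x) := by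
    apply integral_congr_ae
    filter_upwards [hφ] with x hx
    rw [hx]
  rw [i1, i2, integral_const_mul, integral_Icc_eq_intervalIntegral hl.le,
    integral_Icc_eq_intervalIntegral hl.le, e1]
  have i3 : ∫ x in (-l)..l, ((-(boxWave l k ^ 2 * sineMode l k x) : ℝ) : ℂ) * u x =
      -((boxWave l k ^ 2 : ℝ) : ℂ) * ∫ x in (-l)..l, (sineMode l k x : ℂ) * u x := by
    rw [← intervalIntegral.integral_const_mul]
    congr 1; funext x; push_cast; ring
  rw [i3, boxEnergy]
  push_cast
  ring

/-- The sine functions are complete: the odd extension of `φ` about `l` to `(-l, 3l)` has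
vanishing Fourier coefficients if `φ` is orthogonal to all of them. -/
theorem eq_zero_of_inner_sineVec_eq_zero {l : ℝ} (hl : 0 < l) {φ : BoxL2 l}
    (h : ∀ k : ℤ, inner ℂ (sineVec l k) φ = 0) : φ = 0 := by
  set g : ℝ → ℂ := (Icc (-l) l).indicator φ with hg
  have hgL : MemLp g 2 volume := (memLp_indicator_iff_restrict measurableSet_Icc).2 (Lp.memLp φ)
  have hmp : MeasurePreserving (fun x : ℝ => 2 * l - x) volume volume :=
    Measure.measurePreserving_sub_left volume (2 * l)
  have hgL' : MemLp (fun x => g (2 * l - x)) 2 volume := hgL.comp_measurePreserving hmp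
  set f : ℝ → ℂ := fun x => g x - g (2 * l - x) with hf
  have hfL : MemLp f 2 volume := hgL.sub hgL'
  have hab : -l < 3 * l := by linarith
  have hgi : IntervalIntegrable g volume (-l) (3 * l) :=
    (intervalIntegrable_iff_integrableOn_Ioc_of_le hab.le).2
      ((hgL.restrict _).integrable (by norm_num))
  have hgi' : IntervalIntegrable (fun x => g (2 * l - x)) volume (-l) (3 * l) :=
    (intervalIntegrable_iff_integrableOn_Ioc_of_le hab.le).2
      ((hgL'.restrict _).integrable (by norm_num))
  -- the substitution `x ↦ 2l - x` turns the exponential into the sine on `[-l, l]`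
  have hcoef : ∀ n : ℤ, fourierCoeffOn hab f n = 0 := by
    intro n
    rw [fourierCoeffOn_eq_integral]
    set e : ℝ → ℂ := fun x => Complex.exp (-(boxWave l n * x : ℝ) * Complex.I) with he
    have hec : Continuous e := by rw [he]; fun_prop
    have he' : ∀ x : ℝ, (fourier (-n) (x : AddCircle (3 * l - -l)) : ℂ) = e x := by
      intro x
      rw [fourier_coe_apply, he]
      congr 1
      have : (l : ℂ) ≠ 0 := by exact_mod_cast hl.ne'
      simp only [boxWave]
      push_cast
      have h4 : (3 * (l : ℂ) - -l) = 4 * l := by ring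
      rw [h4]
      field_simp
      ring
    simp only [he', smul_eq_mul, hf, mul_sub]
    rw [intervalIntegral.integral_sub (hgi.continuousOn_mul hec.continuousOn)
      (hgi'.continuousOn_mul hec.continuousOn)]
    have h1 := intervalIntegral.integral_comp_sub_left (a := -l) (b := 3 * l)
      (fun x => e (2 * l - x) * g x) (2 * l)
    simp only [sub_sub_cancel, show 2 * l - 3 * l = -l by ring,
      show 2 * l - -l = 3 * l by ring] at h1
    rw [h1, ← intervalIntegral.integral_sub (hgi.continuousOn_mul hec.continuousOn)
      (hgi.continuousOn_mul (by fun_prop))]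
    have h2 : ∀ x, e x * g x - e (2 * l - x) * g x =
        (Icc (-l) l).indicator (fun x => (-2 * Complex.I * Real.sqrt l * e (-l)) *
          ((sineMode l n x : ℂ) * φ x)) x := by
      intro x
      by_cases hx : x ∈ Icc (-l) l
      · rw [hg, indicator_of_mem hx, indicator_of_mem hx]
        have hs : (sineMode l n x : ℂ) * Real.sqrt l = Complex.sin (boxWave l n * (x + l)) := by
          have : (Real.sqrt l : ℂ) ≠ 0 := by exact_mod_cast (Real.sqrt_pos.2 hl).ne'
          rw [sineMode]; push_cast
          rw [div_mul_cancel₀ _ this]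
        have e1 : e x = e (-l) * Complex.exp (-(boxWave l n * (x + l) : ℂ) * Complex.I) := by
          simp only [he]; rw [← Complex.exp_add]; congr 1; push_cast; ring
        have e2 : e (2 * l - x) = e (-l) * Complex.exp ((boxWave l n * (x + l) : ℂ) * Complex.I) := by
          have h4 : Complex.exp (((-n : ℤ) : ℂ) * (2 * Real.pi * Complex.I)) = 1 :=
            Complex.exp_int_mul_two_pi_mul_I _
          simp only [he]
          rw [← Complex.exp_add, ← mul_one (Complex.exp (_ + _)), ← h4, ← Complex.exp_add]
          congr 1
          have h5 : (boxWave l n : ℂ) * (l + l) = n * Real.pi := by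
            exact_mod_cast boxWave_mul_two_l hl n
          push_cast
          linear_combination (-2 * Complex.I) * h5
        calc e x * φ x - e (2 * l - x) * φ x
            = e (-l) * (Complex.exp (-(boxWave l n * (x + l) : ℂ) * Complex.I) -
              Complex.exp ((boxWave l n * (x + l) : ℂ) * Complex.I)) * φ x := by
                rw [e1, e2]; ring
          _ = e (-l) * (-2 * Complex.I * Complex.sin (boxWave l n * (x + l))) * φ x := by
                rw [Complex.sin]
                linear_combination (e (-l) * φ x * (Complex.exp (-(boxWave l n * (x + l) : ℂ) * Complex.I) -
              Complex.exp ((boxWave l n * (x + l) : ℂ) * Complex.I))) * Complex.I_sq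
          _ = _ := by rw [← hs]; ring
      · rw [hg, indicator_of_notMem hx, indicator_of_notMem hx]; simp
    simp only [h2]
    rw [intervalIntegral.integral_of_le hab.le, ← integral_Icc_eq_integral_Ioc,
      setIntegral_indicator measurableSet_Icc,
      inter_eq_self_of_subset_right (Icc_subset_Icc le_rfl (by linarith)), integral_const_mul,
      integral_Icc_eq_intervalIntegral hl.le, ← inner_sineVec hl.le, h, mul_zero, smul_zero]
  -- by Parseval's identity the extension vanishes almost everywhere
  have hP := hasSum_sq_fourierCoeffOn hab (hfL.restrict _)
  simp only [hcoef, norm_zero, ne_eq, OfNat.ofNat_ne_zero, not_false_eq_true, zero_pow] at hP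
  have h0 := hP.unique hasSum_zero
  have h4 : (3 * l - -l)⁻¹ ≠ 0 := inv_ne_zero (by linarith)
  rw [smul_eq_mul, mul_eq_zero, or_iff_right h4, intervalIntegral.integral_of_le hab.le,
    integral_eq_zero_iff_of_nonneg (fun x => by positivity)
      ((hfL.restrict _).integrable_norm_pow (by norm_num))] at h0
  have hsub : volume.restrict (Ioo (-l) l) ≤ volume.restrict (Ioc (-l) (3 * l)) :=
    Measure.restrict_mono (fun x hx => (⟨hx.1, by linarith [hx.2]⟩ : x ∈ Ioc (-l) (3 * l))) le_rfl
  rw [Lp.eq_zero_iff_ae_eq_zero]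
  suffices hφ : ∀ᵐ x ∂volume.restrict (Ioo (-l) l), (φ : ℝ → ℂ) x = 0 by
    rwa [restrict_Ioo_eq_restrict_Icc] at hφ
  filter_upwards [ae_mono hsub h0, ae_restrict_mem measurableSet_Ioo] with x hx hxm
  have hx1 : f x = φ x := by
    have a1 : x ∈ Icc (-l) l := Ioo_subset_Icc_self hxm
    have a2 : 2 * l - x ∉ Icc (-l) l := fun hh => by linarith [hh.2, hxm.2]
    simp only [hf, hg]
    rw [indicator_of_mem a1, indicator_of_notMem a2, sub_zero]
  simpa [hx1] using hx

/-! ### Spectral decomposition of the evolution -/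

theorem boxWave_injective {l : ℝ} (hl : 0 < l) : Function.Injective (boxWave l) := by
  intro k k' hk
  have := Real.pi_pos
  simp only [boxWave] at hk
  field_simp at hk
  exact_mod_cast hk

theorem boxWave_neg (l : ℝ) (k : ℤ) : boxWave l (-k) = -boxWave l k := by
  simp [boxWave]; ring

theorem sineMode_neg (l : ℝ) (k : ℤ) (x : ℝ) : sineMode l (-k) x = -sineMode l k x := by
  rw [sineMode, boxWave_neg, neg_mul, Real.sin_neg, neg_div, sineMode]

theorem inner_sineVec_neg {l : ℝ} (hl : 0 ≤ l) (k : ℤ) (φ : BoxL2 l) :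
    inner ℂ (sineVec l (-k)) φ = -inner ℂ (sineVec l k) φ := by
  rw [inner_sineVec hl, inner_sineVec hl, ← intervalIntegral.integral_neg]
  simp [sineMode_neg]

theorem boxEnergy_neg (h m l : ℝ) (k : ℤ) : boxEnergy h m l (-k) = boxEnergy h m l k := by
  simp [boxEnergy, boxWave_neg]

theorem boxEnergy_injective {h m l : ℝ} (hh : 0 < h) (hm : 0 < m) (hl : 0 < l) :
    Function.Injective fun n : ℕ => boxEnergy h m l (n + 1 : ℤ) := by
  intro a b hab
  simp only [boxEnergy] at hab
  have h1 : 0 < h ^ 2 / (2 * m) := by positivity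
  have h2 := mul_left_cancel₀ h1.ne' hab
  have hp : ∀ n : ℕ, 0 ≤ boxWave l (n + 1 : ℤ) := by
    intro n; rw [boxWave]; push_cast; have := Real.pi_pos; positivity
  have h3 := (pow_left_inj₀ (hp a) (hp b) two_ne_zero).1 h2
  have h4 := boxWave_injective hl h3
  exact_mod_cast add_right_cancel h4

/-- `sineMode l k` is an eigenfunction of the Hamiltonian. -/
theorem boxHamiltonian_sineVec {h m l : ℝ} (hl : 0 < l) (k : ℤ) :
    BoxHamiltonian h m l (sineVec l k) ((boxEnergy h m l k : ℂ) • sineVec l k) := by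
  have hc1 : Continuous fun x => -(boxWave l k ^ 2 * sineMode l k x) := by
    have := continuous_sineMode l k; fun_prop
  refine ⟨fun x => (sineMode l k x : ℂ),
    fun x => ((boxWave l k * Real.cos (boxWave l k * (x + l)) / Real.sqrt l : ℝ) : ℂ),
    fun x => ((-(boxWave l k ^ 2 * sineMode l k x) : ℝ) : ℂ), ?_, ?_, ?_, ?_, ?_, ?_, ?_⟩
  · have := (memLp_sineMode l k).const_mul (-(boxWave l k ^ 2 : ℝ) : ℂ)
    refine this.congr_norm (Complex.continuous_ofReal.comp hc1).aestronglyMeasurable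
      (Eventually.of_forall fun x => ?_)
    simp
  · intro x _
    rw [intervalIntegral.integral_ofReal, intervalIntegral.integral_eq_sub_of_hasDerivAt
      (fun y _ => hasDerivAt_cosMode l k y) (hc1.intervalIntegrable _ _)]
    push_cast; ring
  · intro x _
    rw [intervalIntegral.integral_ofReal, intervalIntegral.integral_eq_sub_of_hasDerivAt
      (fun y _ => hasDerivAt_sineMode l k y)
      (Continuous.intervalIntegrable (by fun_prop) _ _)]
    push_cast; ring
  · simp [sineMode_left]
  · simp [sineMode_right hl]
  · exact coeFn_toBoxL2 (memLp_sineMode l k)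
  · filter_upwards [coeFn_toBoxL2 (memLp_sineMode l k),
      Lp.coeFn_smul (boxEnergy h m l k : ℂ) (sineVec l k)] with x hx hx2
    rw [hx2, Pi.smul_apply, sineVec, hx, boxEnergy, smul_eq_mul]
    push_cast; ring

/-- Eigenvectors for different energies are orthogonal. -/
theorem inner_sineVec_of_eigen {h m l E : ℝ} (hl : 0 < l) {k : ℤ}
    (hE : E ≠ boxEnergy h m l k) {φ : BoxL2 l} (H : BoxHamiltonian h m l φ ((E : ℂ) • φ)) :
    inner ℂ (sineVec l k) φ = 0 := by
  have h1 := inner_sineVec_of_boxHamiltonian hl k H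
  rw [inner_smul_right] at h1
  have h2 : ((E : ℂ) - boxEnergy h m l k) * inner ℂ (sineVec l k) φ = 0 := by
    rw [sub_mul, h1, sub_self]
  have h3 : (E : ℂ) - boxEnergy h m l k ≠ 0 := by
    rw [sub_ne_zero]; exact_mod_cast hE
  exact (mul_eq_zero.1 h2).resolve_left h3

theorem inner_sineVec_sineVec {l : ℝ} (hl : 0 < l) {a b : ℕ} (hab : a ≠ b) :
    inner ℂ (sineVec l (a + 1 : ℤ)) (sineVec l (b + 1 : ℤ)) = 0 :=
  inner_sineVec_of_eigen hl (h := 1) (m := 1)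
    (fun hh => hab (boxEnergy_injective one_pos one_pos hl hh).symm)
    (boxHamiltonian_sineVec hl _)

/-- By oddness in `k` the sine functions with `k ≥ 1` are already complete. -/
theorem eq_zero_of_inner_sineVec_nat {l : ℝ} (hl : 0 < l) {φ : BoxL2 l}
    (h : ∀ n : ℕ, inner ℂ (sineVec l (n + 1 : ℤ)) φ = 0) : φ = 0 := by
  refine eq_zero_of_inner_sineVec_eq_zero hl fun k => ?_
  have h0 : inner ℂ (sineVec l 0) φ = 0 := by
    have := inner_sineVec_neg hl.le 0 φ
    rw [neg_zero] at this
    exact self_eq_neg.1 this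
  obtain ⟨n, rfl | rfl⟩ := k.eq_nat_or_neg
  · rcases n with _ | n
    · exact h0
    · exact_mod_cast h n
  · rw [inner_sineVec_neg hl.le]
    rcases n with _ | n
    · simpa using h0
    · have := h n; push_cast at this ⊢; rw [this, neg_zero]

/-- The eigenspace of the `n`-th energy level is spanned by the `n`-th sine function. -/
theorem boxEigenspace_energy {h m l : ℝ} (hh : 0 < h) (hm : 0 < m) (hl : 0 < l) (n : ℕ) :
    boxEigenspace h m l (boxEnergy h m l (n + 1 : ℤ)) = ℂ ∙ sineVec l (n + 1 : ℤ) := by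
  have : Submodule.span ℂ {φ : BoxL2 l | BoxHamiltonian h m l φ
      ((boxEnergy h m l (n + 1 : ℤ) : ℂ) • φ)} = ℂ ∙ sineVec l (n + 1 : ℤ) := by
    apply le_antisymm
    · rw [Submodule.span_le]
      intro φ hφ
      have hz : φ - (inner ℂ (sineVec l (n + 1 : ℤ)) φ : ℂ) • sineVec l (n + 1 : ℤ) = 0 := by
        refine eq_zero_of_inner_sineVec_nat hl fun n' => ?_
        rw [inner_sub_right, inner_smul_right]
        by_cases hn : n' = n
        · rw [hn, inner_self_eq_norm_sq_to_K, norm_sineVec hl (by positivity)]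
          simp
        · rw [inner_sineVec_sineVec hl hn, mul_zero, sub_zero]
          exact inner_sineVec_of_eigen hl (fun e => hn (boxEnergy_injective hh hm hl e).symm) hφ
      rw [sub_eq_zero] at hz
      rw [hz]
      exact Submodule.smul_mem _ _ (Submodule.mem_span_singleton_self _)
    · rw [Submodule.span_singleton_le_iff_mem]
      exact Submodule.subset_span (boxHamiltonian_sineVec hl _)
  rw [boxEigenspace, this]
  exact (Submodule.closed_of_finiteDimensional _).submodule_topologicalClosure_eq

/-- There are no other eigenvalues, so the sum over all real `E` in `boxEvolution` runs over the
energies of the sine functions only. -/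
theorem boxEigenspace_eq_bot {h m l E : ℝ} (hl : 0 < l)
    (hE : ∀ n : ℕ, E ≠ boxEnergy h m l (n + 1 : ℤ)) : boxEigenspace h m l E = ⊥ := by
  have : Submodule.span ℂ {φ : BoxL2 l | BoxHamiltonian h m l φ ((E : ℂ) • φ)} = ⊥ := by
    rw [Submodule.span_eq_bot]
    intro φ hφ
    exact eq_zero_of_inner_sineVec_nat hl fun n => inner_sineVec_of_eigen hl (hE n) hφ
  rw [boxEigenspace, this]
  exact (Submodule.closed_of_finiteDimensional _).submodule_topologicalClosure_eq

theorem starProjection_boxEigenspace_energy {h m l : ℝ} (hh : 0 < h) (hm : 0 < m) (hl : 0 < l)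
    (n : ℕ) (φ : BoxL2 l) :
    (boxEigenspace h m l (boxEnergy h m l (n + 1 : ℤ))).starProjection φ =
      (inner ℂ (sineVec l (n + 1 : ℤ)) φ : ℂ) • sineVec l (n + 1 : ℤ) := by
  apply Submodule.eq_starProjection_of_mem_of_inner_eq_zero
  · rw [boxEigenspace_energy hh hm hl]
    exact Submodule.smul_mem _ _ (Submodule.mem_span_singleton_self _)
  · intro w hw
    rw [boxEigenspace_energy hh hm hl, Submodule.mem_span_singleton] at hw
    obtain ⟨a, rfl⟩ := hw
    rw [inner_smul_right, inner_sub_left, inner_smul_left, inner_self_eq_norm_sq_to_K,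
      norm_sineVec hl (by positivity), inner_conj_symm]
    simp

/-- The evolution operator in the basis of sine functions. -/
theorem boxEvolution_eq_tsum {h m l : ℝ} (hh : 0 < h) (hm : 0 < m) (hl : 0 < l) (t : ℝ)
    (φ : BoxL2 l) :
    boxEvolution h m l t φ = ∑' n : ℕ,
      (Complex.exp (-Complex.I * t * boxEnergy h m l (n + 1 : ℤ) / h) *
        inner ℂ (sineVec l (n + 1 : ℤ)) φ) • sineVec l (n + 1 : ℤ) := by
  rw [boxEvolution, ← (boxEnergy_injective hh hm hl).tsum_eq]
  · refine tsum_congr fun n => ?_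
    rw [starProjection_boxEigenspace_energy hh hm hl, smul_smul]
  · intro E hE
    by_contra hcon
    refine hE ?_
    have hbot : boxEigenspace h m l E = ⊥ :=
      boxEigenspace_eq_bot hl fun n e => hcon ⟨n, e.symm⟩
    have : (boxEigenspace h m l E).starProjection φ = 0 := by
      have hmem := Submodule.starProjection_apply_mem (boxEigenspace h m l E) φ
      exact (Submodule.mem_bot ℂ).1 (hbot.le hmem)
    simp only [this, smul_zero]

/-! ### Coherent states in the sine basis -/

/-- The amplitude of the plane wave `exp (i κ_k (x + l))` in the line coherent state `η_z`, up to
a constant factor. -/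
noncomputable def boxAmp (h α l : ℝ) (k : ℤ) (z : ℝ × ℝ) : ℂ :=
  Complex.exp (-(boxWave l k * (z.1 + l) : ℝ) * Complex.I) *
    (Real.exp (-(α ^ 2 * (boxWave l k - z.2 / h) ^ 2)) : ℝ)

/-- The normalization of the Fourier transform of a line coherent state. -/
noncomputable def coherentConst (α : ℝ) : ℝ :=
  ((2 * Real.pi * α ^ 2) ^ (1 / 4 : ℝ))⁻¹ * Real.sqrt (4 * Real.pi * α ^ 2)

theorem coherentConst_sq {α : ℝ} (hα : 0 < α) :
    coherentConst α ^ 2 = 2 * Real.sqrt (2 * Real.pi) * α := by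
  have hp := Real.pi_pos
  have h1 : (((2 * Real.pi * α ^ 2) ^ (1 / 4 : ℝ)) ^ 2 : ℝ) = Real.sqrt (2 * Real.pi) * α := by
    rw [← Real.rpow_natCast, ← Real.rpow_mul (by positivity), show (1 / 4 : ℝ) * (2 : ℕ) = 1 / 2 by
      norm_num, ← Real.sqrt_eq_rpow, Real.sqrt_mul (by positivity), Real.sqrt_sq hα.le]
  have h2 : 0 < Real.sqrt (2 * Real.pi) := Real.sqrt_pos.2 (by positivity)
  rw [coherentConst, mul_pow, inv_pow, h1, Real.sq_sqrt (by positivity)]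
  field_simp
  rw [Real.sq_sqrt (by positivity)]
  ring

theorem integrable_lineCoherent {α : ℝ} (hα : 0 < α) (h q p : ℝ) :
    Integrable (lineCoherent h α q p) := by
  have hb : 0 < ((1 / (4 * α ^ 2) : ℝ) : ℂ).re := by
    rw [Complex.ofReal_re]; positivity
  have h1 := integrable_cexp_quadratic hb (Complex.I * p / h) 0
  have h2 := (h1.comp_sub_right q).const_mul (((2 * Real.pi * α ^ 2) ^ (1 / 4 : ℝ) : ℝ) : ℂ)⁻¹
  refine h2.congr (Eventually.of_forall fun x => ?_)
  simp only [lineCoherent]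
  congr 2
  push_cast; ring

/-- The Fourier transform of a line coherent state is a Gaussian centred at its momentum; with the
sign `+κ` in the exponent the centre appears at `κ = -p / h`. -/
theorem integral_exp_mul_lineCoherent {α : ℝ} (hα : 0 < α) (h l q p κ : ℝ) :
    ∫ x : ℝ, Complex.exp ((κ * (x + l) : ℝ) * Complex.I) * lineCoherent h α q p x =
      coherentConst α * (Complex.exp ((κ * (q + l) : ℝ) * Complex.I) *
        (Real.exp (-(α ^ 2 * (κ + p / h) ^ 2)) : ℝ)) := by
  have hb : 0 < ((1 / (4 * α ^ 2) : ℝ) : ℂ).re := by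
    rw [Complex.ofReal_re]; positivity
  have hα' : (α : ℂ) ≠ 0 := by exact_mod_cast hα.ne'
  have h1 := fourierIntegral_gaussian hb ((κ + p / h : ℝ) : ℂ)
  set F : ℝ → ℂ := fun y => Complex.exp (Complex.I * ((κ + p / h : ℝ) : ℂ) * y) *
    Complex.exp (-((1 / (4 * α ^ 2) : ℝ) : ℂ) * y ^ 2) with hF
  have h2 : ∀ x : ℝ, Complex.exp ((κ * (x + l) : ℝ) * Complex.I) * lineCoherent h α q p x =
      ((((2 * Real.pi * α ^ 2) ^ (1 / 4 : ℝ) : ℝ) : ℂ)⁻¹ *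
        Complex.exp ((κ * (q + l) : ℝ) * Complex.I)) * F (x - q) := by
    intro x
    rw [hF, lineCoherent]
    simp only
    set M : ℂ := ((((2 * Real.pi * α ^ 2) ^ (1 / 4 : ℝ) : ℝ) : ℂ))⁻¹
    rw [← Complex.exp_add, mul_left_comm, ← Complex.exp_add, mul_assoc M, ← Complex.exp_add]
    congr 2
    push_cast; ring
  simp only [h2]
  rw [integral_const_mul, integral_sub_right_eq_self (fun y => F y) q, h1]
  have h3 : ((Real.pi : ℂ) / ((1 / (4 * α ^ 2) : ℝ) : ℂ)) ^ (1 / 2 : ℂ) =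
      (Real.sqrt (4 * Real.pi * α ^ 2) : ℝ) := by
    have : (Real.pi : ℂ) / ((1 / (4 * α ^ 2) : ℝ) : ℂ) = ((4 * Real.pi * α ^ 2 : ℝ) : ℂ) := by
      push_cast; field_simp
    rw [this, Real.sqrt_eq_rpow, Complex.ofReal_cpow (by have := Real.pi_pos; positivity)]
    norm_num
  have h4 : Complex.exp (-((κ + p / h : ℝ) : ℂ) ^ 2 / (4 * ((1 / (4 * α ^ 2) : ℝ) : ℂ))) =
      (Real.exp (-(α ^ 2 * (κ + p / h) ^ 2)) : ℝ) := by
    rw [Complex.ofReal_exp]; congr 1; push_cast; field_simp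
  rw [h3, h4, coherentConst]
  push_cast; ring

theorem boxAmp_neg (h α l : ℝ) (k : ℤ) (q p : ℝ) :
    boxAmp h α l (-k) (q, p) = Complex.exp ((boxWave l k * (q + l) : ℝ) * Complex.I) *
        (Real.exp (-(α ^ 2 * (boxWave l k + p / h) ^ 2)) : ℝ) := by
  rw [boxAmp, boxWave_neg]
  congr 2
  · push_cast; ring_nf
  · congr 1; ring

/-- The sine is a difference of two plane waves, so its coefficient in a line coherent state is a
difference of two amplitudes. -/
theorem integral_sineMode_mul_lineCoherent {α : ℝ} (hα : 0 < α) (h l q p : ℝ) (k : ℤ) :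
    ∫ x : ℝ, (sineMode l k x : ℂ) * lineCoherent h α q p x =
      coherentConst α * Complex.I / (2 * Real.sqrt l) *
        (boxAmp h α l k (q, p) - boxAmp h α l (-k) (q, p)) := by
  have h1 : ∀ k' : ℤ, ∫ x : ℝ, Complex.exp ((boxWave l k' * (x + l) : ℝ) * Complex.I) *
      lineCoherent h α q p x = coherentConst α * boxAmp h α l (-k') (q, p) := fun k' => by
    rw [integral_exp_mul_lineCoherent hα, boxAmp_neg]
  have hI : ∀ k' : ℤ, Integrable fun x : ℝ =>
      Complex.exp ((boxWave l k' * (x + l) : ℝ) * Complex.I) * lineCoherent h α q p x := fun k' => by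
    refine (integrable_lineCoherent hα h q p).bdd_mul (c := 1) (by fun_prop)
      (Eventually.of_forall fun x => ?_)
    rw [Complex.norm_exp_ofReal_mul_I]
  have h2 : ∀ x : ℝ, (sineMode l k x : ℂ) * lineCoherent h α q p x =
      Complex.I / (2 * Real.sqrt l) *
        (Complex.exp ((boxWave l (-k) * (x + l) : ℝ) * Complex.I) * lineCoherent h α q p x -
        Complex.exp ((boxWave l k * (x + l) : ℝ) * Complex.I) * lineCoherent h α q p x) := by
    intro x
    rw [sineMode, boxWave_neg]
    push_cast
    rw [Complex.sin]
    ring_nf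
  simp only [h2]
  rw [integral_const_mul, integral_sub (hI _) (hI _), h1, h1, neg_neg]
  ring

/-- The sine functions have the symmetry of the method of images, under which the terms of the
series defining the box coherent state are permuted. -/
theorem sineMode_two_l_sub {l : ℝ} (hl : 0 < l) (k : ℤ) (n : ℤ) (x : ℝ) :
    sineMode l k ((-1) ^ n * (x - 2 * n * l)) = (-1) ^ n * sineMode l k x := by
  rcases Int.even_or_odd' n with ⟨r, rfl | rfl⟩
  · have he : Even (2 * r) := even_two_mul r
    rw [he.neg_one_zpow, one_mul, one_mul, sineMode, sineMode]
    have : boxWave l k * (x - 2 * ((2 * r : ℤ) : ℝ) * l + l) =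
        boxWave l k * (x + l) - (k * r : ℤ) * (2 * Real.pi) := by
      rw [boxWave]; push_cast; field_simp; ring
    rw [this, Real.sin_sub_int_mul_two_pi]
  · have ho : Odd (2 * r + 1) := odd_two_mul_add_one r
    rw [ho.neg_one_zpow, neg_one_mul, neg_one_mul, sineMode, sineMode]
    have : boxWave l k * (-(x - 2 * ((2 * r + 1 : ℤ) : ℝ) * l) + l) =
        (k * (r + 1) : ℤ) * (2 * Real.pi) - boxWave l k * (x + l) := by
      rw [boxWave]; push_cast; field_simp; ring
    rw [this, sub_eq_neg_add, Real.sin_add_int_mul_two_pi, Real.sin_neg, neg_div]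

/-- The involution of `ℤ` that changes the sign of the even integers. It labels the cells of the
line by the reflections that map them to the box. -/
def negEven : Equiv.Perm ℤ :=
  Function.Involutive.toPerm (fun n => if Even n then -n else n) fun n => by
    by_cases hn : Even n <;> simp [hn]

theorem negEven_apply (n : ℤ) : negEven n = if Even n then -n else n := rfl

/-- The `n`-th image of the box is the cell `negEven n` of the tiling of the line by intervals of
length `2l`. -/
theorem intervalIntegral_comp_reflection (G : ℝ → ℂ) (l : ℝ) (n : ℤ) :
    ∫ x in (-l)..l, G ((-1) ^ n * (x - 2 * n * l)) =
      ∫ x in (-l + negEven n * (2 * l))..(-l + (negEven n + 1) * (2 * l)), G x := by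
  rcases Int.even_or_odd n with he | ho
  · have h1 : negEven n = -n := by rw [negEven_apply, if_pos he]
    simp only [he.neg_one_zpow, one_mul, h1]
    rw [intervalIntegral.integral_comp_sub_right (fun y => G y)]
    congr 1 <;> (push_cast; ring)
  · have h1 : negEven n = n := by rw [negEven_apply, if_neg (Int.not_even_iff_odd.2 ho)]
    simp only [ho.neg_one_zpow, neg_one_mul, h1, neg_sub]
    rw [intervalIntegral.integral_comp_sub_left (fun y => G y)]
    congr 1 <;> ring

/-- An integral over the line is the sum of the integrals over the cells of length `2l`. -/
theorem hasSum_integral_cells {l : ℝ} (hl : 0 < l) {E : Type*} [NormedAddCommGroup E]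
    [NormedSpace ℝ E] {G : ℝ → E} (hG : Integrable G) :
    HasSum (fun n : ℤ => ∫ x in (-l + n * (2 * l))..(-l + (n + 1) * (2 * l)), G x) (∫ x, G x) := by
  have h2l : 0 < 2 * l := by linarith
  have h := hasSum_integral_iUnion (μ := volume) (f := G)
    (s := fun n : ℤ => Ioc (-l + n • (2 * l)) (-l + (n + 1) • (2 * l)))
    (fun n => measurableSet_Ioc) (pairwise_disjoint_Ioc_add_zsmul _ _) hG.integrableOn
  rw [iUnion_Ioc_add_zsmul h2l, setIntegral_univ] at h
  refine h.congr_fun ?_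
  intro n
  rw [intervalIntegral.integral_of_le (by nlinarith)]
  simp

/-- Unfolding: the sine coefficients of the box coherent state are integrals of the line coherent
state over the whole line. -/
theorem inner_sineVec_boxState {h α l : ℝ} (hα : 0 < α) (hl : 0 < l) (k : ℤ) (z : ℝ × ℝ) :
    inner ℂ (sineVec l k) (boxState h α l z) =
      ∫ x : ℝ, (sineMode l k x : ℂ) * lineCoherent h α z.1 z.2 x := by
  have hsc := continuous_sineMode l k
  set G : ℝ → ℂ := fun x => (sineMode l k x : ℂ) * lineCoherent h α z.1 z.2 x with hGdef
  have hGc : Continuous G := by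
    rw [hGdef]; unfold lineCoherent; fun_prop
  have hG : Integrable G := by
    refine (integrable_lineCoherent hα h z.1 z.2).bdd_mul (c := (Real.sqrt l)⁻¹) (by fun_prop)
      (Eventually.of_forall fun x => ?_)
    rw [Complex.norm_real]; exact abs_sineMode_le l k x
  have hs1 := negEven.hasSum_iff.2 (hasSum_integral_cells hl hG)
  have hs2 := negEven.hasSum_iff.2 (hasSum_integral_cells hl (G := fun x => (‖G x‖ : ℂ))
    hG.norm.ofReal)
  have hc1 : ∀ n : ℤ, Continuous fun x : ℝ => G ((-1) ^ n * (x - 2 * n * l)) := fun n => by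
    fun_prop
  have hI : ∀ n : ℤ, Integrable (fun x : ℝ => G ((-1) ^ n * (x - 2 * n * l)))
      (volume.restrict (Icc (-l) l)) := fun n => (hc1 n).continuousOn.integrableOn_Icc
  have hsum := hasSum_integral_of_summable_integral_norm hI (by
    have h3 : Summable fun n : ℤ =>
        ∫ x in (-l)..l, (‖G ((-1) ^ n * (x - 2 * n * l))‖ : ℂ) := by
      refine hs2.summable.congr fun n => ?_
      exact (intervalIntegral_comp_reflection (fun x => (‖G x‖ : ℂ)) l n).symm
    rw [← Complex.summable_ofReal]
    refine h3.congr fun n => ?_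
    rw [← integral_Icc_eq_intervalIntegral hl.le]
    exact integral_ofReal)
  rw [inner_sineVec hl.le, ← integral_Icc_eq_intervalIntegral hl.le]
  have h5 : ∫ x in Icc (-l) l, (sineMode l k x : ℂ) * boxState h α l z x =
      ∫ x in Icc (-l) l, ∑' n : ℤ, G ((-1) ^ n * (x - 2 * n * l)) := by
    apply integral_congr_ae
    filter_upwards [coeFn_toBoxL2 (memLp_boxCoherent hα hl h z.1 z.2)] with x hx
    rw [boxState, hx, boxCoherent, ← tsum_mul_left]
    refine tsum_congr fun n => ?_
    simp only [hGdef]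
    rw [sineMode_two_l_sub hl]
    push_cast; ring
  rw [h5]
  refine hsum.unique (hs1.congr_fun fun n => ?_)
  rw [integral_Icc_eq_intervalIntegral hl.le]
  exact intervalIntegral_comp_reflection G l n

theorem norm_boxAmp (h α l : ℝ) (k : ℤ) (z : ℝ × ℝ) :
    ‖boxAmp h α l k z‖ = Real.exp (-(α ^ 2 * (boxWave l k - z.2 / h) ^ 2)) := by
  rw [boxAmp, norm_mul, ← Complex.ofReal_neg, Complex.norm_exp_ofReal_mul_I, one_mul,
    Complex.norm_real, Real.norm_eq_abs, Real.abs_exp]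

theorem norm_boxAmp_le_one (h α l : ℝ) (k : ℤ) (z : ℝ × ℝ) : ‖boxAmp h α l k z‖ ≤ 1 := by
  rw [norm_boxAmp, Real.exp_le_one_iff]
  have : 0 ≤ α ^ 2 * (boxWave l k - z.2 / h) ^ 2 := by positivity
  linarith

theorem summable_shifted_gauss {b : ℝ} (hb : 0 < b) (x₀ : ℝ) :
    Summable fun k : ℤ => Real.exp (-(b * ((k : ℝ) - x₀) ^ 2)) := by
  refine Summable.of_nonneg_of_le (fun k => (Real.exp_pos _).le) (fun k => ?_)
    ((summable_gauss_int (half_pos hb)).mul_left (Real.exp (b * x₀ ^ 2)))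
  rw [← Real.exp_add]
  apply Real.exp_le_exp.2
  nlinarith [sq_nonneg ((k : ℝ) - 2 * x₀)]

theorem summable_norm_boxAmp {h α l : ℝ} (hα : 0 < α) (hl : 0 < l) (z : ℝ × ℝ) :
    Summable fun k : ℤ => ‖boxAmp h α l k z‖ := by
  have hp := Real.pi_pos
  have hb : 0 < α ^ 2 * (Real.pi / (2 * l)) ^ 2 := by positivity
  refine (summable_shifted_gauss hb (z.2 / h * (2 * l / Real.pi))).congr fun k => ?_
  rw [norm_boxAmp, boxWave]
  congr 2
  field_simp

/-- The phase acquired by the `k`-th eigenfunction in time `t`. -/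
noncomputable def boxPhase (h m l t : ℝ) (k : ℤ) : ℂ :=
  Complex.exp (-Complex.I * t * boxEnergy h m l k / h)

theorem norm_boxPhase (h m l t : ℝ) (k : ℤ) : ‖boxPhase h m l t k‖ = 1 := by
  have : -Complex.I * t * boxEnergy h m l k / h =
      ((-(t * boxEnergy h m l k / h) : ℝ) : ℂ) * Complex.I := by push_cast; ring
  rw [boxPhase, this, Complex.norm_exp_ofReal_mul_I]

theorem boxPhase_neg (h m l t : ℝ) (k : ℤ) : boxPhase h m l t (-k) = boxPhase h m l t k := by
  rw [boxPhase, boxEnergy_neg, boxPhase]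

/-- The transition amplitude between coherent states as a sum over plane waves, up to a constant
factor. -/
noncomputable def boxOverlap (h α m l t : ℝ) (z z' : ℝ × ℝ) : ℂ :=
  ∑' k : ℤ, boxPhase h m l t k *
    (starRingEnd ℂ (boxAmp h α l k z - boxAmp h α l (-k) z) * boxAmp h α l k z')

/-- The sum over the eigenfunctions `k ≥ 1` of products of differences of amplitudes is folded out to
a sum over all `k ∈ ℤ`, which is why `boxAmp` enters the second factor of `boxOverlap` without its
mirror image. -/
theorem inner_boxState_boxEvolution {h α m l : ℝ} (hh : 0 < h) (hα : 0 < α) (hm : 0 < m)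
    (hl : 0 < l) (t : ℝ) (z z' : ℝ × ℝ) :
    inner ℂ (boxState h α l z) (boxEvolution h m l t (boxState h α l z')) =
      (coherentConst α ^ 2 / (4 * l) : ℝ) * boxOverlap h α m l t z z' := by
  set D : ℝ × ℝ → ℤ → ℂ := fun z k => boxAmp h α l k z - boxAmp h α l (-k) z with hD
  have hDs : ∀ z, Summable fun k : ℤ => ‖D z k‖ := fun z => by
    refine Summable.of_nonneg_of_le (fun _ => norm_nonneg _) (fun k => norm_sub_le _ _)
      ((summable_norm_boxAmp hα hl z).add ?_)
    exact (Equiv.neg ℤ).summable_iff.2 (summable_norm_boxAmp hα hl z)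
  have hco : ∀ z k, inner ℂ (sineVec l k) (boxState h α l z) =
      coherentConst α * Complex.I / (2 * Real.sqrt l) * D z k := fun z k => by
    rw [inner_sineVec_boxState hα hl, integral_sineMode_mul_lineCoherent hα]
  have hinj : Function.Injective fun n : ℕ => (n + 1 : ℤ) := fun a b hab => by
    simpa using hab
  set c : ℂ := coherentConst α * Complex.I / (2 * Real.sqrt l) with hc
  rw [boxEvolution_eq_tsum hh hm hl]
  have hsum : Summable fun n : ℕ => (Complex.exp (-Complex.I * t * boxEnergy h m l (n + 1 : ℤ) / h) *
        inner ℂ (sineVec l (n + 1 : ℤ)) (boxState h α l z')) • sineVec l (n + 1 : ℤ) := by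
    apply Summable.of_norm
    refine (((hDs z').comp_injective hinj).mul_left ‖c‖).congr fun n => ?_
    rw [norm_smul, norm_sineVec hl (by positivity), mul_one, norm_mul]
    have := norm_boxPhase h m l t (n + 1)
    rw [boxPhase] at this
    rw [this, one_mul, hco, norm_mul]; rfl
  have hmap := (innerSL ℂ (boxState h α l z)).map_tsum hsum
  simp only [innerSL_apply_apply] at hmap
  rw [hmap]
  have hcc : (starRingEnd ℂ) c * c = (coherentConst α ^ 2 / (4 * l) : ℝ) := by
    have hsl : (Real.sqrt l : ℂ) ^ 2 = l := by exact_mod_cast Real.sq_sqrt hl.le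
    have : (Real.sqrt l : ℂ) ≠ 0 := by exact_mod_cast (Real.sqrt_pos.2 hl).ne'
    rw [hc]
    simp only [map_div₀, map_mul, Complex.conj_ofReal, Complex.conj_I, map_ofNat]
    push_cast
    rw [← hsl]
    field_simp
    rw [Complex.I_sq]; ring
  have hterm : ∀ n : ℕ, inner ℂ (boxState h α l z)
      ((Complex.exp (-Complex.I * t * boxEnergy h m l (n + 1 : ℤ) / h) *
        inner ℂ (sineVec l (n + 1 : ℤ)) (boxState h α l z')) • sineVec l (n + 1 : ℤ)) =
      (coherentConst α ^ 2 / (4 * l) : ℝ) * (boxPhase h m l t (n + 1) *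
        (starRingEnd ℂ (D z (n + 1)) * D z' (n + 1))) := fun n => by
    rw [inner_smul_right, ← inner_conj_symm (boxState h α l z), hco, hco, map_mul, ← hcc, boxPhase]
    ring
  rw [tsum_congr hterm, tsum_mul_left]
  congr 1
  set f : ℤ → ℂ := fun k => boxPhase h m l t k *
    (starRingEnd ℂ (D z k) * boxAmp h α l k z') with hf
  have hfs : Summable f := by
    apply Summable.of_norm
    refine Summable.of_nonneg_of_le (fun _ => norm_nonneg _) (fun k => ?_) (hDs z)
    rw [hf, norm_mul, norm_mul, norm_boxPhase, one_mul, RCLike.norm_conj]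
    exact mul_le_of_le_one_right (norm_nonneg _) (norm_boxAmp_le_one _ _ _ _ _)
  have hf0 : f 0 = 0 := by simp [hf, hD]
  have hneg : ∀ k, f (-k) = -(boxPhase h m l t k *
      (starRingEnd ℂ (D z k) * boxAmp h α l (-k) z')) := fun k => by
    simp only [hf, hD, boxPhase_neg, neg_neg, map_sub]; ring
  have e1 : Summable fun n : ℕ => f (n + 1) := hfs.comp_injective hinj
  have hinj' : Function.Injective fun n : ℕ => (-(n + 1) : ℤ) := fun a b hab => by
    simpa using hab
  have e2 : Summable fun n : ℕ => f (-(n + 1)) := hfs.comp_injective hinj'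
  have htot : ∑' k : ℤ, f k = ∑' n : ℕ, (f (n + 1) + f (-(n + 1))) := by
    have e3 : HasSum (fun n : ℕ => f n) (∑' n : ℕ, f (n + 1)) := by
      rw [← hasSum_nat_add_iff' 1]
      simpa [hf0] using e1.hasSum
    rw [(e3.of_nat_of_neg_add_one e2.hasSum).tsum_eq, e1.tsum_add e2]
  rw [boxOverlap]
  refine Eq.trans (tsum_congr fun n => ?_) htot.symm
  rw [hneg]
  simp only [hf, hD]
  ring

/-! ### Test functions and their Fourier coefficients in the position variable -/

namespace BoxTest

variable {l : ℝ} (σ : BoxTest l)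

theorem contDiff : ContDiff ℝ ∞ (σ : ℝ × ℝ → ℝ) := σ.mem.2.1

theorem continuous : Continuous (σ : ℝ × ℝ → ℝ) := σ.contDiff.continuous

theorem map_reflect (q p : ℝ) : σ (-q - 2 * l, -p) = σ (q, p) := by
  have h := σ.mem.1 1 q p
  rw [zpow_one] at h
  rw [← h]
  congr 2 <;> (push_cast; ring)

theorem map_add_period (q p : ℝ) : σ (q + 4 * l, p) = σ (q, p) := by
  have h := σ.mem.1 2 q p
  rw [Even.neg_one_zpow even_two, one_mul, one_mul] at h
  rw [← h]
  congr 2; push_cast; ring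

theorem exists_weight_bound : ∃ C, 0 ≤ C ∧ ∀ z : ℝ × ℝ, |σ z| ≤ C * (1 + z.2 ^ 2)⁻¹ := by
  obtain ⟨C, hC⟩ := σ.mem.2.2 2 0 0
  refine ⟨C, ?_, fun z => ?_⟩
  · have := hC (0, 0)
    exact le_trans (by positivity) this
  · have h := hC z
    have h1 : (0 : ℝ) < 1 + z.2 ^ 2 := by positivity
    norm_num [mixedDeriv] at h
    rw [← div_eq_mul_inv, le_div_iff₀ h1, mul_comm]
    exact h

theorem exists_mixedDeriv_bound (s₁ s₂ : ℕ) :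
    ∃ C, 0 ≤ C ∧ ∀ z : ℝ × ℝ, |mixedDeriv s₁ s₂ σ z| ≤ C := by
  obtain ⟨C, hC⟩ := σ.mem.2.2 0 s₁ s₂
  have h : ∀ z : ℝ × ℝ, |mixedDeriv s₁ s₂ σ z| ≤ C := fun z => by simpa using hC z
  exact ⟨C, (abs_nonneg _).trans (h 0), h⟩

theorem integrableOn_strip (a b : ℝ) :
    IntegrableOn (σ : ℝ × ℝ → ℝ) (Icc a b ×ˢ (univ : Set ℝ)) := by
  obtain ⟨C, -, hC⟩ := σ.exists_weight_bound
  have h1 : Integrable (fun z : ℝ × ℝ => C * (1 + z.2 ^ 2)⁻¹)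
      ((volume.restrict (Icc a b)).prod (volume.restrict univ)) := by
    rw [Measure.restrict_univ]
    exact Integrable.mul_prod (f := fun _ : ℝ => C) (g := fun p : ℝ => (1 + p ^ 2)⁻¹)
      (integrable_const _) integrable_inv_one_add_sq
  rw [IntegrableOn, Measure.volume_eq_prod, ← Measure.prod_restrict]
  exact h1.mono' σ.continuous.aestronglyMeasurable (Eventually.of_forall hC)

end BoxTest

theorem hasDerivAt_slice_fst {f : ℝ × ℝ → ℝ} (hf : ContDiff ℝ ∞ f) (q p : ℝ) :
    HasDerivAt (fun x => f (x, p)) (derivQ f (q, p)) q := by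
  have h1 : HasFDerivAt f (fderiv ℝ f (q, p)) (q, p) :=
    (hf.differentiable (by simp) (q, p)).hasFDerivAt
  have h2 : HasDerivAt (fun x : ℝ => (x, p)) ((1 : ℝ), (0 : ℝ)) q :=
    (hasDerivAt_id q).prodMk (hasDerivAt_const q p)
  exact h1.comp_hasDerivAt q h2

theorem hasDerivAt_slice_snd {f : ℝ × ℝ → ℝ} (hf : ContDiff ℝ ∞ f) (q p : ℝ) :
    HasDerivAt (fun y => f (q, y)) (derivP f (q, p)) p := by
  have h1 : HasFDerivAt f (fderiv ℝ f (q, p)) (q, p) :=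
    (hf.differentiable (by simp) (q, p)).hasFDerivAt
  have h2 : HasDerivAt (fun y : ℝ => (q, y)) ((0 : ℝ), (1 : ℝ)) p :=
    (hasDerivAt_const p q).prodMk (hasDerivAt_id p)
  exact h1.comp_hasDerivAt p h2

/-- The `j`-th Fourier coefficient, in the position variable over one period `[-3l, l]`, of a
function on phase space. -/
noncomputable def stripCoeff (l : ℝ) (f : ℝ × ℝ → ℝ) (j : ℤ) (p : ℝ) : ℂ :=
  1 / (4 * l) * ∫ x in (-(3 * l))..l,
    Complex.exp (-(boxWave l j * (x + l) : ℝ) * Complex.I) * f (x, p)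

theorem norm_stripCoeff_le {l : ℝ} (hl : 0 < l) {f : ℝ × ℝ → ℝ} {C p : ℝ}
    (hC : ∀ x, |f (x, p)| ≤ C) (j : ℤ) : ‖stripCoeff l f j p‖ ≤ C := by
  have h1 : ‖∫ x in (-(3 * l))..l,
      Complex.exp (-(boxWave l j * (x + l) : ℝ) * Complex.I) * f (x, p)‖ ≤ C * |l - -(3 * l)| := by
    refine intervalIntegral.norm_integral_le_of_norm_le_const fun x _ => ?_
    rw [norm_mul, ← Complex.ofReal_neg, Complex.norm_exp_ofReal_mul_I, one_mul, Complex.norm_real]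
    exact hC x
  have h2 : |l - -(3 * l)| = 4 * l := by rw [abs_of_pos (by linarith)]; ring
  rw [h2] at h1
  have h3 : ‖(1 / (4 * l) : ℂ)‖ = 1 / (4 * l) := by
    rw [norm_div, norm_mul, Complex.norm_real, Real.norm_of_nonneg hl.le]; simp
  rw [stripCoeff, norm_mul, h3]
  calc 1 / (4 * l) * _ ≤ 1 / (4 * l) * (C * (4 * l)) := by gcongr
    _ = C := by field_simp

theorem continuous_stripIntegrand {l : ℝ} {f : ℝ × ℝ → ℝ} (hf : Continuous f) (j : ℤ) (p : ℝ) :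
    Continuous fun x : ℝ =>
      Complex.exp (-(boxWave l j * (x + l) : ℝ) * Complex.I) * (f (x, p) : ℂ) := by
  fun_prop

/-- The Fourier coefficients are Lipschitz in the momentum, uniformly in `j`. -/
theorem stripCoeff_lipschitz {l : ℝ} (hl : 0 < l) {f : ℝ × ℝ → ℝ} (hf : ContDiff ℝ ∞ f) {C : ℝ}
    (hC : ∀ z, |derivP f z| ≤ C) (j : ℤ) (p p' : ℝ) :
    ‖stripCoeff l f j p - stripCoeff l f j p'‖ ≤ C * |p - p'| := by
  have h1 : ∀ x, |f (x, p) - f (x, p')| ≤ C * |p - p'| := fun x => by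
    have := Convex.norm_image_sub_le_of_norm_hasDerivWithin_le (f := fun y => f (x, y))
      (f' := fun y => derivP f (x, y)) (s := univ) (C := C) (x := p') (y := p)
      (fun y _ => (hasDerivAt_slice_snd hf x y).hasDerivWithinAt)
      (fun y _ => hC (x, y)) convex_univ (mem_univ _) (mem_univ _)
    simpa using this
  have h2 : stripCoeff l f j p - stripCoeff l f j p' =
      stripCoeff l (fun z => f (z.1, p) - f (z.1, p')) j 0 := by
    rw [stripCoeff, stripCoeff, stripCoeff, ← mul_sub, ← intervalIntegral.integral_sub
      ((continuous_stripIntegrand hf.continuous j p).intervalIntegrable _ _)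
      ((continuous_stripIntegrand hf.continuous j p').intervalIntegrable _ _)]
    congr 2; funext x; push_cast; ring
  rw [h2]
  exact norm_stripCoeff_le hl (fun x => h1 x) j

theorem exp_boxWave_period {l : ℝ} (hl : 0 < l) (j : ℤ) :
    Complex.exp (-(boxWave l j * (-(3 * l) + l) : ℝ) * Complex.I) =
      Complex.exp (-(boxWave l j * (l + l) : ℝ) * Complex.I) := by
  rw [← mul_one (Complex.exp (-(boxWave l j * (l + l) : ℝ) * Complex.I)),
    ← Complex.exp_int_mul_two_pi_mul_I j, ← Complex.exp_add]
  congr 1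
  have : (l : ℂ) ≠ 0 := by exact_mod_cast hl.ne'
  rw [boxWave]; push_cast; field_simp; ring

/-- Differentiation multiplies the Fourier coefficients by `i κ_j`. -/
theorem stripCoeff_derivQ {l : ℝ} (hl : 0 < l) {f : ℝ × ℝ → ℝ} (hf : ContDiff ℝ ∞ f)
    (hper : ∀ q p, f (q + 4 * l, p) = f (q, p)) (j : ℤ) (p : ℝ) :
    stripCoeff l (derivQ f) j p = Complex.I * boxWave l j * stripCoeff l f j p := by
  have hu : ∀ x : ℝ, HasDerivAt
      (fun x : ℝ => Complex.exp (-(boxWave l j * (x + l) : ℝ) * Complex.I))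
      (Complex.exp (-(boxWave l j * (x + l) : ℝ) * Complex.I) *
        (-(boxWave l j : ℂ) * Complex.I)) x := by
    intro x
    have h1 : HasDerivAt (fun x : ℝ => boxWave l j * (x + l)) (boxWave l j) x := by
      simpa using ((hasDerivAt_id x).add_const l).const_mul (boxWave l j)
    exact (h1.ofReal_comp.neg.mul_const Complex.I).cexp
  have hv : ∀ x : ℝ, HasDerivAt (fun x : ℝ => (f (x, p) : ℂ)) (derivQ f (x, p) : ℂ) x :=
    fun x => (hasDerivAt_slice_fst hf x p).ofReal_comp
  have hdc : Continuous (derivQ f) := hf.derivQ_smooth.continuous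
  have h := intervalIntegral.integral_mul_deriv_eq_deriv_mul (a := -(3 * l)) (b := l)
    (fun x _ => hu x) (fun x _ => hv x) (Continuous.intervalIntegrable (by fun_prop) _ _)
    (Continuous.intervalIntegrable (by fun_prop) _ _)
  have hp : f (-(3 * l), p) = f (l, p) := by
    rw [← hper (-(3 * l)) p]; congr 2; ring
  rw [exp_boxWave_period hl, hp, sub_self, zero_sub] at h
  rw [stripCoeff, h, stripCoeff, ← intervalIntegral.integral_neg,
    mul_left_comm (Complex.I * (boxWave l j : ℂ)),
    ← intervalIntegral.integral_const_mul (Complex.I * (boxWave l j : ℂ))]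
  congr 2; funext x; ring

theorem derivQ_add_period {l : ℝ} {f : ℝ × ℝ → ℝ} (hf : ContDiff ℝ ∞ f)
    (hper : ∀ q p, f (q + 4 * l, p) = f (q, p)) (q p : ℝ) :
    derivQ f (q + 4 * l, p) = derivQ f (q, p) := by
  have h1 := (hasDerivAt_slice_fst hf (q + 4 * l) p).comp_add_const q (4 * l)
  simp only [hper] at h1
  exact h1.unique (hasDerivAt_slice_fst hf q p)

/-- The Fourier coefficients of a test function are summable in `j`, uniformly in the momentum. -/
theorem BoxTest.exists_stripCoeff_bound {l : ℝ} (hl : 0 < l) (σ : BoxTest l) :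
    ∃ b : ℤ → ℝ, Summable b ∧ ∀ j p, ‖stripCoeff l σ j p‖ ≤ b j := by
  obtain ⟨C₀, -, h₀⟩ := σ.exists_mixedDeriv_bound 0 0
  obtain ⟨C, hC0, hC⟩ := σ.exists_mixedDeriv_bound 2 0
  have hσ := σ.contDiff
  have key : ∀ (j : ℤ) (p : ℝ), boxWave l j ^ 2 * ‖stripCoeff l σ j p‖ ≤ C := fun j p => by
    have h1 := stripCoeff_derivQ hl hσ.derivQ_smooth
      (derivQ_add_period hσ σ.map_add_period) j p
    rw [stripCoeff_derivQ hl hσ σ.map_add_period] at h1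
    have h2 := norm_stripCoeff_le hl (f := derivQ (derivQ σ)) (C := C) (p := p)
      (fun x => hC (x, p)) j
    rw [h1] at h2
    simp only [norm_mul, Complex.norm_I, one_mul, Complex.norm_real, Real.norm_eq_abs] at h2
    rwa [← mul_assoc, ← pow_two, sq_abs] at h2
  refine ⟨fun j => if j = 0 then C₀ else C * (Real.pi / (2 * l))⁻¹ ^ 2 * (1 / (j : ℝ) ^ 2), ?_,
    fun j p => ?_⟩
  · have hs : Summable fun j : ℤ => C * (Real.pi / (2 * l))⁻¹ ^ 2 * (1 / (j : ℝ) ^ 2) :=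
      (Real.summable_one_div_int_pow.2 one_lt_two).mul_left _
    refine hs.congr_cofinite ?_
    filter_upwards [(finite_singleton (0 : ℤ)).compl_mem_cofinite] with j hj
    rw [if_neg (by simpa using hj)]
  · by_cases hj : j = 0
    · simp only [hj, if_true]
      exact norm_stripCoeff_le hl (fun x => h₀ (x, p)) 0
    · simp only [hj, if_false]
      have hj' : (j : ℝ) ≠ 0 := by exact_mod_cast hj
      have hp := Real.pi_pos
      have h1 : 0 < boxWave l j ^ 2 := by
        rw [boxWave]; positivity
      rw [← mul_le_mul_iff_right₀ h1]
      refine (key j p).trans_eq ?_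
      rw [boxWave]; field_simp

/-! ### The transition density tested against a function -/

theorem boxWave_sub (l : ℝ) (k k' : ℤ) : boxWave l (k - k') = boxWave l k - boxWave l k' := by
  simp only [boxWave]; push_cast; ring

/-- The reflection of phase space about the point `(-l, 0)`. -/
def boxReflect (l : ℝ) (z : ℝ × ℝ) : ℝ × ℝ := (-2 * l, 0) - z

theorem BoxTest.apply_boxReflect {l : ℝ} (σ : BoxTest l) (z : ℝ × ℝ) :
    σ (boxReflect l z) = σ z := by
  rw [← σ.map_reflect z.1 z.2]
  congr 1
  ext <;> simp [boxReflect]; ring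

theorem boxAmp_boxReflect (h α l : ℝ) (k : ℤ) (z : ℝ × ℝ) :
    boxAmp h α l k (boxReflect l z) = boxAmp h α l (-k) z := by
  simp only [boxAmp, boxReflect, boxWave_neg, Prod.fst_sub, Prod.snd_sub]
  congr 2
  · push_cast; ring_nf
  · congr 1; ring

theorem continuous_boxAmp (h α l : ℝ) (k : ℤ) : Continuous (boxAmp h α l k) := by
  unfold boxAmp; fun_prop

/-- A superposition of plane waves, seen from the coherent state at `z`. -/
noncomputable def ampSeries (h α l : ℝ) (s : ℤ → ℂ) (z : ℝ × ℝ) : ℂ :=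
  ∑' k : ℤ, s k * boxAmp h α l k z

section AmpSeries

variable {h α l : ℝ} {s b : ℤ → ℂ}

theorem norm_mul_boxAmp_le (k : ℤ) (z : ℝ × ℝ) : ‖s k * boxAmp h α l k z‖ ≤ ‖s k‖ := by
  rw [norm_mul]
  exact mul_le_of_le_one_right (norm_nonneg _) (norm_boxAmp_le_one _ _ _ _ _)

theorem summable_norm_mul_boxAmp (hs : Summable fun k => ‖s k‖) (z : ℝ × ℝ) :
    Summable fun k => ‖s k * boxAmp h α l k z‖ :=
  Summable.of_nonneg_of_le (fun _ => norm_nonneg _) (fun k => norm_mul_boxAmp_le k z) hs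

theorem continuous_ampSeries (hs : Summable fun k => ‖s k‖) : Continuous (ampSeries h α l s) :=
  continuous_tsum (fun k => continuous_const.mul (continuous_boxAmp h α l k)) hs
    fun k z => norm_mul_boxAmp_le k z

theorem norm_ampSeries_le (hs : Summable fun k => ‖s k‖) (z : ℝ × ℝ) :
    ‖ampSeries h α l s z‖ ≤ ∑' k, ‖s k‖ :=
  (norm_tsum_le_tsum_norm (summable_norm_mul_boxAmp hs z)).trans
    ((summable_norm_mul_boxAmp hs z).tsum_le_tsum (fun k => norm_mul_boxAmp_le k z) hs)

/-- Pairing two superpositions of plane waves with a test function, term by term. -/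
theorem hasSum_integral_ampSeries (hs : Summable fun k => ‖s k‖) (hb : Summable fun k => ‖b k‖)
    (σ : BoxTest l) (u v : ℝ) :
    HasSum (fun x : ℤ × ℤ => ∫ z in Icc u v ×ˢ (univ : Set ℝ), starRingEnd ℂ (s x.2) * b x.1 *
        (starRingEnd ℂ (boxAmp h α l x.2 z) * boxAmp h α l x.1 z * σ z))
      (∫ z in Icc u v ×ˢ (univ : Set ℝ),
        starRingEnd ℂ (ampSeries h α l s z) * ampSeries h α l b z * σ z) := by
  have hσ := σ.integrableOn_strip u v
  have hc : ∀ x : ℤ × ℤ, Continuous fun z : ℝ × ℝ =>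
      starRingEnd ℂ (boxAmp h α l x.2 z) * boxAmp h α l x.1 z := fun x =>
    (Complex.continuous_conj.comp (continuous_boxAmp h α l x.2)).mul (continuous_boxAmp h α l x.1)
  have hle : ∀ (x : ℤ × ℤ) z, ‖starRingEnd ℂ (boxAmp h α l x.2 z) * boxAmp h α l x.1 z‖ ≤ 1 :=
    fun x z => by
      rw [norm_mul, RCLike.norm_conj]
      exact mul_le_one₀ (norm_boxAmp_le_one _ _ _ _ _) (norm_nonneg _)
        (norm_boxAmp_le_one _ _ _ _ _)
  have hI : ∀ x : ℤ × ℤ, Integrable (fun z => starRingEnd ℂ (s x.2) * b x.1 *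
        (starRingEnd ℂ (boxAmp h α l x.2 z) * boxAmp h α l x.1 z * σ z))
      (volume.restrict (Icc u v ×ˢ (univ : Set ℝ))) := fun x =>
    (hσ.ofReal.bdd_mul (c := 1) (hc x).aestronglyMeasurable
      (Eventually.of_forall (hle x))).const_mul _
  have hsum : Summable fun x : ℤ × ℤ => ‖b x.1‖ * ‖s x.2‖ :=
    hb.mul_of_nonneg hs (fun _ => norm_nonneg _) (fun _ => norm_nonneg _)
  have hS : Summable fun x : ℤ × ℤ => ∫ z in Icc u v ×ˢ (univ : Set ℝ),
      ‖starRingEnd ℂ (s x.2) * b x.1 *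
        (starRingEnd ℂ (boxAmp h α l x.2 z) * boxAmp h α l x.1 z * σ z)‖ := by
    refine Summable.of_nonneg_of_le (fun x => integral_nonneg fun z => norm_nonneg _) (fun x => ?_)
      (hsum.mul_right (∫ z in Icc u v ×ˢ (univ : Set ℝ), |σ z|))
    rw [← integral_const_mul]
    refine integral_mono (hI x).norm (hσ.abs.const_mul _) fun z => ?_
    simp only
    rw [norm_mul, norm_mul, RCLike.norm_conj, mul_comm ‖s x.2‖, norm_mul, Complex.norm_real,
      Real.norm_eq_abs]
    refine mul_le_mul_of_nonneg_left ?_ (by positivity)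
    exact mul_le_of_le_one_left (abs_nonneg _) (hle x z)
  have h1 := hasSum_integral_of_summable_integral_norm hI hS
  suffices hpt : ∀ z, starRingEnd ℂ (ampSeries h α l s z) * ampSeries h α l b z * σ z =
      ∑' x : ℤ × ℤ, starRingEnd ℂ (s x.2) * b x.1 *
        (starRingEnd ℂ (boxAmp h α l x.2 z) * boxAmp h α l x.1 z * σ z) by
    simpa only [hpt] using h1
  intro z
  have h2 : starRingEnd ℂ (ampSeries h α l s z) =
      ∑' k, starRingEnd ℂ (s k) * starRingEnd ℂ (boxAmp h α l k z) := by
    rw [ampSeries, Complex.conj_tsum]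
    simp only [map_mul]
  have h3 : Summable fun k => ‖starRingEnd ℂ (s k) * starRingEnd ℂ (boxAmp h α l k z)‖ := by
    refine (summable_norm_mul_boxAmp (h := h) (α := α) (l := l) hs z).congr fun k => ?_
    rw [norm_mul, norm_mul, RCLike.norm_conj, RCLike.norm_conj]
  rw [h2, ampSeries, mul_comm (∑' k, _) (∑' k, _),
    tsum_mul_tsum_of_summable_norm (summable_norm_mul_boxAmp hb z) h3, ← tsum_mul_right]
  refine tsum_congr fun x => ?_
  ring

end AmpSeries

theorem continuous_stripCoeff {l : ℝ} (hl : 0 < l) (σ : BoxTest l) (j : ℤ) :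
    Continuous (stripCoeff l σ j) := by
  obtain ⟨C, hC0, hC⟩ := σ.exists_mixedDeriv_bound 0 1
  have : LipschitzWith C.toNNReal (stripCoeff l σ j) :=
    LipschitzWith.of_dist_le_mul fun p p' => by
      rw [dist_eq_norm, Real.dist_eq, Real.coe_toNNReal C hC0]
      exact stripCoeff_lipschitz hl σ.contDiff hC j p p'
  exact this.continuous

/-- The matrix element of a test function between two plane waves. -/
theorem integral_conj_boxAmp_mul_boxAmp {h α l : ℝ} (hl : 0 < l) (σ : BoxTest l) (k k' : ℤ) :
    ∫ z in Icc (-(3 * l)) l ×ˢ (univ : Set ℝ),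
        starRingEnd ℂ (boxAmp h α l k' z) * boxAmp h α l k z * σ z =
      4 * l * ∫ p : ℝ, (Real.exp (-(α ^ 2 * ((boxWave l k - p / h) ^ 2 +
        (boxWave l k' - p / h) ^ 2))) : ℂ) * stripCoeff l σ (k - k') p := by
  have hI : Integrable (fun z => starRingEnd ℂ (boxAmp h α l k' z) * boxAmp h α l k z * σ z)
      ((volume.restrict (Icc (-(3 * l)) l)).prod (volume.restrict univ)) := by
    rw [Measure.prod_restrict, ← Measure.volume_eq_prod]
    refine (σ.integrableOn_strip _ _).ofReal.bdd_mul (c := 1) ?_ (Eventually.of_forall fun z => ?_)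
    · exact ((Complex.continuous_conj.comp (continuous_boxAmp h α l k')).mul
        (continuous_boxAmp h α l k)).aestronglyMeasurable
    · rw [norm_mul, RCLike.norm_conj]
      exact mul_le_one₀ (norm_boxAmp_le_one _ _ _ _ _) (norm_nonneg _)
        (norm_boxAmp_le_one _ _ _ _ _)
  rw [Measure.volume_eq_prod, ← Measure.prod_restrict, integral_prod_symm _ hI,
    Measure.restrict_univ, ← integral_const_mul]
  congr 1
  funext p
  rw [integral_Icc_eq_integral_Ioc, ← intervalIntegral.integral_of_le (by linarith), stripCoeff]
  have hl' : (l : ℂ) ≠ 0 := by exact_mod_cast hl.ne'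
  have h1 : ∀ I : ℂ, (4 * l : ℂ) * ((Real.exp (-(α ^ 2 * ((boxWave l k - p / h) ^ 2 +
        (boxWave l k' - p / h) ^ 2))) : ℂ) * (1 / (4 * l) * I)) =
      (Real.exp (-(α ^ 2 * ((boxWave l k - p / h) ^ 2 +
        (boxWave l k' - p / h) ^ 2))) : ℂ) * I := fun I => by field_simp
  rw [h1, ← intervalIntegral.integral_const_mul]
  congr 1
  funext x
  simp only [boxAmp]
  rw [map_mul, Complex.conj_ofReal, ← Complex.exp_conj, map_mul, Complex.conj_I, map_neg,
    Complex.conj_ofReal]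
  have h2 : -(boxWave l (k - k') * (x + l) : ℝ) * Complex.I =
      -(boxWave l k' * (x + l) : ℝ) * -Complex.I + -(boxWave l k * (x + l) : ℝ) * Complex.I := by
    rw [boxWave_sub]; push_cast; ring
  have h3 : -(α ^ 2 * ((boxWave l k - p / h) ^ 2 + (boxWave l k' - p / h) ^ 2)) =
      -(α ^ 2 * (boxWave l k' - p / h) ^ 2) + -(α ^ 2 * (boxWave l k - p / h) ^ 2) := by ring
  rw [h2, h3, Complex.exp_add, Real.exp_add]
  push_cast
  ring

/-- The average of `f` over a Gaussian window of width `1 / β` about `y`. -/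
noncomputable def gaussAvg (β : ℝ) (f : ℝ → ℂ) (y : ℝ) : ℂ :=
  (Real.sqrt (2 / Real.pi) * β : ℝ) * ∫ p : ℝ, (Real.exp (-(2 * (β * (y - p)) ^ 2)) : ℂ) * f p

/-- The coefficient of the test functional that couples the plane waves `k` and `k - j`. -/
noncomputable def pairTerm (h α m l t : ℝ) (z : ℝ × ℝ) (σ : BoxTest l) (j k : ℤ) : ℂ :=
  starRingEnd ℂ (boxPhase h m l t (k - j)) * boxPhase h m l t k *
    (starRingEnd ℂ (boxAmp h α l k z) * (boxAmp h α l (k - j) z - boxAmp h α l (j - k) z)) *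
    (Real.exp (-(α ^ 2 * boxWave l j ^ 2 / 2)) : ℂ) *
    gaussAvg (α / h) (stripCoeff l σ j) (h * ((boxWave l k + boxWave l (k - j)) / 2))

theorem summable_boxPhase_mul {h m l : ℝ} (t : ℝ) {a : ℤ → ℂ}
    (ha : Summable fun k => ‖a k‖) :
    Summable fun k => ‖boxPhase h m l t k * starRingEnd ℂ (a k)‖ :=
  ha.congr fun k => by rw [norm_mul, norm_boxPhase, one_mul, RCLike.norm_conj]

theorem summable_norm_boxAmp_sub {h α l : ℝ} (hα : 0 < α) (hl : 0 < l) (z : ℝ × ℝ) :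
    Summable fun k : ℤ => ‖boxAmp h α l k z - boxAmp h α l (-k) z‖ := by
  refine Summable.of_nonneg_of_le (fun _ => norm_nonneg _) (fun k => norm_sub_le _ _)
    ((summable_norm_boxAmp hα hl z).add ?_)
  exact (Equiv.neg ℤ).summable_iff.2 (summable_norm_boxAmp hα hl z)

theorem boxOverlap_eq_ampSeries (h α m l t : ℝ) (z : ℝ × ℝ) :
    boxOverlap h α m l t z = ampSeries h α l fun k => boxPhase h m l t k *
      starRingEnd ℂ (boxAmp h α l k z - boxAmp h α l (-k) z) := by
  funext z'
  simp only [boxOverlap, ampSeries, mul_assoc]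

theorem continuous_boxOverlap {h α m l : ℝ} (hα : 0 < α) (hl : 0 < l) (t : ℝ) (z : ℝ × ℝ) :
    Continuous (boxOverlap h α m l t z) := by
  rw [boxOverlap_eq_ampSeries]
  exact continuous_ampSeries (summable_boxPhase_mul t (summable_norm_boxAmp_sub hα hl z))

/-- The overlap is the difference of a superposition of plane waves and its reflection. In
particular it is odd under the reflection. -/
theorem boxOverlap_eq_sub {h α m l : ℝ} (hα : 0 < α) (hl : 0 < l) (t : ℝ) (z z' : ℝ × ℝ) :
    boxOverlap h α m l t z z' =
      ampSeries h α l (fun k => boxPhase h m l t k * starRingEnd ℂ (boxAmp h α l k z)) z' -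
      ampSeries h α l (fun k => boxPhase h m l t k * starRingEnd ℂ (boxAmp h α l k z))
        (boxReflect l z') := by
  have h1 := summable_boxPhase_mul (h := h) (m := m) (l := l) t
    (summable_norm_boxAmp (h := h) hα hl z)
  have h2 := (summable_norm_mul_boxAmp (h := h) (α := α) (l := l) h1 z').of_norm
  have h3 := (summable_norm_mul_boxAmp (h := h) (α := α) (l := l) h1 (boxReflect l z')).of_norm
  have h4 : ampSeries h α l (fun k => boxPhase h m l t k * starRingEnd ℂ (boxAmp h α l k z))
      (boxReflect l z') = ∑' k : ℤ, boxPhase h m l t k * starRingEnd ℂ (boxAmp h α l (-k) z) *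
        boxAmp h α l k z' := by
    rw [ampSeries, ← (Equiv.neg ℤ).tsum_eq]
    refine tsum_congr fun k => ?_
    rw [Equiv.neg_apply, boxAmp_boxReflect, neg_neg, boxPhase_neg]
  have h5 : Summable fun k : ℤ => boxPhase h m l t k * starRingEnd ℂ (boxAmp h α l (-k) z) *
        boxAmp h α l k z' := by
    refine ((Equiv.neg ℤ).summable_iff.2 h3).congr fun k => ?_
    simp only [Function.comp, Equiv.neg_apply, boxAmp_boxReflect, neg_neg, boxPhase_neg]
  rw [h4, ampSeries, ← h2.tsum_sub h5, boxOverlap]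
  refine tsum_congr fun k => ?_
  rw [map_sub]; ring

theorem boxReflect_boxReflect (l : ℝ) (z : ℝ × ℝ) : boxReflect l (boxReflect l z) = z := by
  simp [boxReflect]

theorem boxOverlap_boxReflect {h α m l : ℝ} (hα : 0 < α) (hl : 0 < l) (t : ℝ) (z z' : ℝ × ℝ) :
    boxOverlap h α m l t z (boxReflect l z') = -boxOverlap h α m l t z z' := by
  rw [boxOverlap_eq_sub hα hl, boxOverlap_eq_sub hα hl, boxReflect_boxReflect]
  ring

/-- The reflection maps the strip over `[-l, l]` onto the strip over `[-3l, -l]`. -/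
theorem integral_strip_reflect {l : ℝ} (F : ℝ × ℝ → ℂ) :
    ∫ z in Icc (-l) l ×ˢ (univ : Set ℝ), F (boxReflect l z) =
      ∫ z in Icc (-(3 * l)) (-l) ×ˢ (univ : Set ℝ), F z := by
  have hmp : MeasurePreserving (boxReflect l) volume volume :=
    Measure.measurePreserving_sub_left volume ((-2 * l, 0) : ℝ × ℝ)
  have hemb : MeasurableEmbedding (boxReflect l) :=
    (MeasurableEquiv.subLeft ((-2 * l, 0) : ℝ × ℝ)).measurableEmbedding
  rw [← hmp.setIntegral_preimage_emb hemb F]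
  congr 2
  ext z
  simp only [boxReflect, mem_prod, mem_Icc, mem_univ, and_true, mem_preimage, Prod.fst_sub]
  constructor
  · rintro ⟨h1, h2⟩; constructor <;> linarith
  · rintro ⟨h1, h2⟩; constructor <;> linarith

theorem integral_strip_add {l : ℝ} (hl : 0 < l) {F : ℝ × ℝ → ℂ}
    (hF : IntegrableOn F (Icc (-(3 * l)) l ×ˢ (univ : Set ℝ))) :
    (∫ z in Icc (-(3 * l)) (-l) ×ˢ (univ : Set ℝ), F z) +
      ∫ z in Icc (-l) l ×ˢ (univ : Set ℝ), F z =
      ∫ z in Icc (-(3 * l)) l ×ˢ (univ : Set ℝ), F z := by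
  have hae : (Ioc (-l) l ×ˢ (univ : Set ℝ)) =ᵐ[volume] (Icc (-l) l ×ˢ (univ : Set ℝ)) :=
    Measure.set_prod_ae_eq Ioc_ae_eq_Icc (ae_eq_refl _)
  rw [← setIntegral_congr_set hae, ← setIntegral_union]
  · rw [← union_prod, Icc_union_Ioc_eq_Icc (by linarith) (by linarith)]
  · exact Disjoint.set_prod_left (by
      rw [disjoint_left]; rintro x ⟨_, h1⟩ ⟨h2, _⟩; linarith) _ _
  · exact measurableSet_Ioc.prod MeasurableSet.univ
  · exact hF.mono_set (prod_mono (Icc_subset_Icc le_rfl (by linarith)) le_rfl)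
  · exact hF.mono_set (prod_mono (Ioc_subset_Icc_self.trans
      (Icc_subset_Icc (by linarith) le_rfl)) le_rfl)

/-- The overlap is odd and the test function even under the reflection, so that the integral of
`|S|² σ`, `S` the overlap, over `Ω` becomes an integral of `conj(S) B σ` over a full period of length
`4l`, where `B` is one half of the plane waves in `S`. Over a full period plane waves are orthogonal, and
the pairing with `σ` reduces to the Fourier coefficients of `σ`. -/
theorem integral_norm_sq_boxOverlap {h α m l : ℝ} (hα : 0 < α) (hl : 0 < l) (t : ℝ) (z : ℝ × ℝ)
    (σ : BoxTest l) :
    ∫ z' in phaseStrip l, ((‖boxOverlap h α m l t z z'‖ ^ 2 * σ z' : ℝ) : ℂ) =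
      ∫ z' in Icc (-(3 * l)) l ×ˢ (univ : Set ℝ), starRingEnd ℂ (boxOverlap h α m l t z z') *
        ampSeries h α l (fun k => boxPhase h m l t k * starRingEnd ℂ (boxAmp h α l k z)) z' *
        σ z' := by
  set b : ℤ → ℂ := fun k => boxPhase h m l t k * starRingEnd ℂ (boxAmp h α l k z) with hb
  have hbs := summable_boxPhase_mul (h := h) (m := m) (l := l) t
    (summable_norm_boxAmp (h := h) hα hl z)
  set F : ℝ × ℝ → ℂ := fun z' => starRingEnd ℂ (boxOverlap h α m l t z z') *
    ampSeries h α l b z' * σ z' with hF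
  have hcS := continuous_boxOverlap (h := h) (m := m) hα hl t z
  have hss := summable_boxPhase_mul (h := h) (m := m) (l := l) t
    (summable_norm_boxAmp_sub (h := h) hα hl z)
  have hFi : IntegrableOn F (Icc (-(3 * l)) l ×ˢ (univ : Set ℝ)) := by
    refine (σ.integrableOn_strip _ _).ofReal.bdd_mul
      (c := (∑' k, ‖boxPhase h m l t k *
        starRingEnd ℂ (boxAmp h α l k z - boxAmp h α l (-k) z)‖) * ∑' k, ‖b k‖)
      ((Complex.continuous_conj.comp hcS).mul
        (continuous_ampSeries hbs)).aestronglyMeasurable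
      (Eventually.of_forall fun z' => ?_)
    rw [norm_mul, RCLike.norm_conj]
    refine mul_le_mul ?_ (norm_ampSeries_le hbs z') (norm_nonneg _)
      (tsum_nonneg fun _ => norm_nonneg _)
    rw [boxOverlap_eq_ampSeries]
    exact norm_ampSeries_le hss z'
  have hFR : IntegrableOn (fun z' => F (boxReflect l z')) (Icc (-l) l ×ˢ (univ : Set ℝ)) := by
    have hmp : MeasurePreserving (boxReflect l) volume volume :=
      Measure.measurePreserving_sub_left volume ((-2 * l, 0) : ℝ × ℝ)
    have hemb : MeasurableEmbedding (boxReflect l) :=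
      (MeasurableEquiv.subLeft ((-2 * l, 0) : ℝ × ℝ)).measurableEmbedding
    have := (hmp.integrableOn_comp_preimage hemb).2
      (hFi.mono_set (prod_mono (Icc_subset_Icc le_rfl (by linarith : -l ≤ l)) le_rfl))
    refine this.mono_set ?_
    intro z' hz'
    simp only [boxReflect, mem_prod, mem_Icc, mem_univ, and_true, mem_preimage,
      Prod.fst_sub] at hz' ⊢
    constructor <;> linarith [hz'.1, hz'.2]
  rw [phaseStrip, ← integral_strip_add hl hFi, ← integral_strip_reflect, ← integral_add hFR
    (hFi.mono_set (prod_mono (Icc_subset_Icc (by linarith) le_rfl) le_rfl))]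
  refine integral_congr_ae (Eventually.of_forall fun z' => ?_)
  beta_reduce
  have h1 := boxOverlap_eq_sub (h := h) (m := m) hα hl t z z'
  rw [← hb] at h1
  simp only [hF]
  rw [boxOverlap_boxReflect hα hl, σ.apply_boxReflect, map_neg]
  have h2 : ((‖boxOverlap h α m l t z z'‖ ^ 2 : ℝ) : ℂ) =
      starRingEnd ℂ (boxOverlap h α m l t z z') * boxOverlap h α m l t z z' := by
    rw [mul_comm, Complex.mul_conj, Complex.normSq_eq_norm_sq]
  rw [Complex.ofReal_mul, h2]
  nth_rewrite 2 [h1]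
  ring

theorem transitionDensity_eq {h α m l : ℝ} (hh : 0 < h) (hα : 0 < α) (hm : 0 < m) (hl : 0 < l)
    (t : ℝ) (z z' : ℝ × ℝ) :
    transitionDensity h α m l t z z' =
      1 / (2 * Real.pi * h) * (coherentConst α ^ 2 / (4 * l)) ^ 2 *
        ‖boxOverlap h α m l t z z'‖ ^ 2 := by
  rw [transitionDensity, inner_boxState_boxEvolution hh hα hm hl, norm_mul, mul_pow,
    Complex.norm_real, Real.norm_eq_abs, sq_abs]
  ring

theorem continuous_transitionDensity {h α m l : ℝ} (hh : 0 < h) (hα : 0 < α) (hm : 0 < m)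
    (hl : 0 < l) (t : ℝ) (z : ℝ × ℝ) : Continuous (transitionDensity h α m l t z) := by
  have h1 : transitionDensity h α m l t z = fun z' =>
      1 / (2 * Real.pi * h) * (coherentConst α ^ 2 / (4 * l)) ^ 2 *
        ‖boxOverlap h α m l t z z'‖ ^ 2 := funext (transitionDensity_eq hh hα hm hl t z)
  rw [h1]
  exact continuous_const.mul ((continuous_boxOverlap hα hl t z).norm.pow 2)

theorem transitionDensity_nonneg {h : ℝ} (hh : 0 < h) (α m l t : ℝ) (z z' : ℝ × ℝ) :
    0 ≤ transitionDensity h α m l t z z' := by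
  rw [transitionDensity]
  have := Real.pi_pos
  positivity

theorem exists_transitionDensity_le {h α m l : ℝ} (hh : 0 < h) (hα : 0 < α) (hm : 0 < m)
    (hl : 0 < l) (t : ℝ) (z : ℝ × ℝ) : ∃ C, ∀ z', transitionDensity h α m l t z z' ≤ C := by
  refine ⟨1 / (2 * Real.pi * h) * (coherentConst α ^ 2 / (4 * l)) ^ 2 *
    (∑' k, ‖boxPhase h m l t k *
        starRingEnd ℂ (boxAmp h α l k z - boxAmp h α l (-k) z)‖) ^ 2, fun z' => ?_⟩
  rw [transitionDensity_eq hh hα hm hl]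
  have := Real.pi_pos
  gcongr
  rw [boxOverlap_eq_ampSeries]
  exact norm_ampSeries_le (summable_boxPhase_mul t (summable_norm_boxAmp_sub hα hl z)) z'

/-- The matrix element of a test function in terms of Gaussian averages. -/
theorem integral_gauss_mul_stripCoeff {h α l : ℝ} (hh : 0 < h) (hα : 0 < α) (σ : BoxTest l)
    (j k : ℤ) :
    ∫ p : ℝ, (Real.exp (-(α ^ 2 * ((boxWave l k - p / h) ^ 2 +
        (boxWave l (k - j) - p / h) ^ 2))) : ℂ) * stripCoeff l σ j p =
      (Real.sqrt (2 / Real.pi) * (α / h) : ℝ)⁻¹ *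
        ((Real.exp (-(α ^ 2 * boxWave l j ^ 2 / 2)) : ℂ) *
    gaussAvg (α / h) (stripCoeff l σ j) (h * ((boxWave l k + boxWave l (k - j)) / 2))) := by
  have hc : (Real.sqrt (2 / Real.pi) * (α / h) : ℝ) ≠ 0 := by
    have := Real.pi_pos; positivity
  have hc' : ((Real.sqrt (2 / Real.pi) * (α / h) : ℝ) : ℂ) ≠ 0 := by exact_mod_cast hc
  rw [gaussAvg, mul_left_comm (Real.exp _ : ℂ), Complex.ofReal_inv, inv_mul_cancel_left₀ hc',
    ← integral_const_mul]
  congr 1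
  funext p
  rw [← mul_assoc, ← Complex.ofReal_mul, ← Real.exp_add]
  congr 3
  rw [boxWave_sub]
  field_simp
  ring

/-- The transition density tested against `σ`, as a double series over plane waves. -/
theorem integral_transitionDensity_mul {h α m l : ℝ} (hh : 0 < h) (hα : 0 < α) (hm : 0 < m)
    (hl : 0 < l) (t : ℝ) (z : ℝ × ℝ) (σ : BoxTest l) :
    ((∫ z' in phaseStrip l, transitionDensity h α m l t z z' * σ z' : ℝ) : ℂ) =
      ∑' j : ℤ, (Real.sqrt (2 / Real.pi) * (α * (Real.pi / (2 * l))) : ℝ) *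
        ∑' k : ℤ, pairTerm h α m l t z σ j k := by
  have hp := Real.pi_pos
  set K : ℝ := 1 / (2 * Real.pi * h) * (coherentConst α ^ 2 / (4 * l)) ^ 2 with hK
  set b : ℤ → ℂ := fun k => boxPhase h m l t k * starRingEnd ℂ (boxAmp h α l k z) with hb
  set s : ℤ → ℂ := fun k => boxPhase h m l t k *
    starRingEnd ℂ (boxAmp h α l k z - boxAmp h α l (-k) z) with hs
  have hbs : Summable fun k => ‖b k‖ := summable_boxPhase_mul (h := h) (m := m) (l := l) t
    (summable_norm_boxAmp (h := h) hα hl z)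
  have hss : Summable fun k => ‖s k‖ := summable_boxPhase_mul (h := h) (m := m) (l := l) t
    (summable_norm_boxAmp_sub (h := h) hα hl z)
  have h1 : ((∫ z' in phaseStrip l, transitionDensity h α m l t z z' * σ z' : ℝ) : ℂ) =
      K * ∫ z' in Icc (-(3 * l)) l ×ˢ (univ : Set ℝ),
        starRingEnd ℂ (ampSeries h α l s z') * ampSeries h α l b z' * σ z' := by
    have h0 : ∫ z' in phaseStrip l, ((‖boxOverlap h α m l t z z'‖ ^ 2 * σ z' : ℝ) : ℂ) =
        ((∫ z' in phaseStrip l, ‖boxOverlap h α m l t z z'‖ ^ 2 * σ z' : ℝ) : ℂ) := integral_ofReal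
    rw [hs, ← boxOverlap_eq_ampSeries, ← integral_norm_sq_boxOverlap hα hl, h0,
      ← Complex.ofReal_mul, ← integral_const_mul]
    congr 2
    funext z'
    rw [transitionDensity_eq hh hα hm hl, mul_assoc]
  have h2 := hasSum_integral_ampSeries (h := h) (α := α) hss hbs σ (-(3 * l)) l
  set e : ℤ × ℤ ≃ ℤ × ℤ :=
    { toFun := fun x => (x.2, x.2 - x.1)
      invFun := fun x => (x.1 - x.2, x.1)
      left_inv := fun x => by ext <;> simp
      right_inv := fun x => by ext <;> simp } with he
  have h3 := (e.hasSum_iff.2 h2).mul_left (K : ℂ)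
  have h4 : ∀ x : ℤ × ℤ, (K : ℂ) * ((fun x : ℤ × ℤ => ∫ z in Icc (-(3 * l)) l ×ˢ (univ : Set ℝ),
      starRingEnd ℂ (s x.2) * b x.1 *
        (starRingEnd ℂ (boxAmp h α l x.2 z) * boxAmp h α l x.1 z * σ z)) ∘ e) x =
      (Real.sqrt (2 / Real.pi) * (α * (Real.pi / (2 * l))) : ℝ) *
        pairTerm h α m l t z σ x.1 x.2 := by
    rintro ⟨j, k⟩
    simp only [Function.comp, he, Equiv.coe_fn_mk]
    rw [integral_const_mul, integral_conj_boxAmp_mul_boxAmp hl, sub_sub_cancel,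
      integral_gauss_mul_stripCoeff hh hα, pairTerm]
    have hKc : (Real.sqrt (2 / Real.pi) * (α * (Real.pi / (2 * l))) : ℝ) =
        K * (4 * l) * (Real.sqrt (2 / Real.pi) * (α / h))⁻¹ := by
      have hq : Real.sqrt (2 / Real.pi) ^ 2 = 2 / Real.pi := Real.sq_sqrt (by positivity)
      have hq0 : Real.sqrt (2 / Real.pi) ≠ 0 := by positivity
      rw [← mul_inv_eq_iff_eq_mul₀ (by positivity), inv_inv, hK, coherentConst_sq hα]
      have hr : Real.sqrt (2 * Real.pi) ^ 2 = 2 * Real.pi := Real.sq_sqrt (by positivity)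
      have : Real.sqrt (2 / Real.pi) * (α * (Real.pi / (2 * l))) *
          (Real.sqrt (2 / Real.pi) * (α / h)) =
          Real.sqrt (2 / Real.pi) ^ 2 * (α * (Real.pi / (2 * l))) * (α / h) := by ring
      rw [this, hq, div_pow, mul_pow, mul_pow, hr]
      field_simp
      ring
    rw [hKc]
    simp only [hs, hb, map_mul, Complex.conj_conj, neg_sub]
    push_cast
    ring
  rw [h1, ← h3.tsum_eq, tsum_congr h4]
  have h5 : Summable fun x : ℤ × ℤ => ((Real.sqrt (2 / Real.pi) * (α * (Real.pi / (2 * l))) : ℝ) : ℂ) *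
        pairTerm h α m l t z σ x.1 x.2 := h3.summable.congr h4
  rw [h5.tsum_prod]
  exact tsum_congr fun j => tsum_mul_left

/-! ### Gaussian sums over the integers -/

/-- The normalized sum of a wide Gaussian with the phase `exp (i θ (k - x₀))`. -/
noncomputable def thetaSum (ε x₀ θ : ℝ) : ℂ :=
  (Real.sqrt (2 / Real.pi) * ε : ℝ) * ∑' k : ℤ,
    (Real.exp (-(2 * (ε * (k - x₀)) ^ 2)) : ℂ) * Complex.exp ((θ * (k - x₀) : ℝ) * Complex.I)

/-- Poisson summation for `thetaSum`. -/
theorem thetaSum_eq {ε : ℝ} (hε : 0 < ε) (x₀ θ : ℝ) :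
    thetaSum ε x₀ θ = ∑' n : ℤ, (Real.exp (-(θ - 2 * Real.pi * n) ^ 2 / (8 * ε ^ 2)) : ℂ) *
      Complex.exp (-(2 * Real.pi * n * x₀ : ℝ) * Complex.I) := by
  have hp := Real.pi_pos
  have hp' : (Real.pi : ℂ) ≠ 0 := by exact_mod_cast hp.ne'
  have hε' : (ε : ℂ) ≠ 0 := by exact_mod_cast hε.ne'
  set a : ℂ := ((2 * ε ^ 2 / Real.pi : ℝ) : ℂ) with ha
  have ha0 : 0 < a.re := by rw [ha, Complex.ofReal_re]; positivity
  set b : ℂ := ((2 * ε ^ 2 * x₀ / Real.pi : ℝ) : ℂ) + ((θ / (2 * Real.pi) : ℝ) : ℂ) * Complex.I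
    with hb
  set K : ℂ := Complex.exp (-(2 * (ε * x₀) ^ 2 : ℝ) - (θ * x₀ : ℝ) * Complex.I) with hK
  have h1 := Complex.tsum_exp_neg_quadratic ha0 b
  have h2 : ∀ k : ℤ, (Real.exp (-(2 * (ε * (k - x₀)) ^ 2)) : ℂ) *
      Complex.exp ((θ * (k - x₀) : ℝ) * Complex.I) =
      K * Complex.exp (-Real.pi * a * k ^ 2 + 2 * Real.pi * b * k) := fun k => by
    rw [hK, Complex.ofReal_exp, ← Complex.exp_add, ← Complex.exp_add, ha, hb]
    congr 1
    push_cast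
    field_simp
    ring
  have h3 : (1 : ℂ) / a ^ (1 / 2 : ℂ) = ((Real.sqrt (2 / Real.pi) * ε : ℝ) : ℂ)⁻¹ := by
    have : a ^ (1 / 2 : ℂ) = ((Real.sqrt (2 / Real.pi) * ε : ℝ) : ℂ) := by
      have e1 : Real.sqrt (2 / Real.pi) * ε = (2 * ε ^ 2 / Real.pi) ^ (1 / 2 : ℝ) := by
        rw [← Real.sqrt_eq_rpow, show 2 * ε ^ 2 / Real.pi = 2 / Real.pi * ε ^ 2 by ring,
          Real.sqrt_mul (by positivity), Real.sqrt_sq hε.le]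
      rw [e1, Complex.ofReal_cpow (by positivity), ha]
      norm_num
    rw [this, one_div]
  have hc : ((Real.sqrt (2 / Real.pi) * ε : ℝ) : ℂ) ≠ 0 := by
    have : Real.sqrt (2 / Real.pi) * ε ≠ 0 := by positivity
    exact_mod_cast this
  rw [thetaSum, tsum_congr h2, tsum_mul_left, h1, h3, mul_left_comm, mul_inv_cancel_left₀ hc,
    ← tsum_mul_left]
  refine tsum_congr fun n => ?_
  rw [hK, Complex.ofReal_exp, ← Complex.exp_add, ← Complex.exp_add, ha, hb]
  congr 1
  push_cast
  field_simp
  ring_nf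
  simp only [Complex.I_pow_four, Complex.I_pow_three, Complex.I_sq]
  ring

/-- Gaussian sums are bounded uniformly in the width and in the centre: by Poisson summation, applied
to the width `ε / √2` and the phase zero, they are dominated by a convergent theta series. -/
theorem exists_gauss_sum_bound : ∃ C : ℝ, 0 < C ∧ ∀ ε x₀ : ℝ, 0 < ε → ε ≤ 1 →
    Real.sqrt (2 / Real.pi) * ε * ∑' k : ℤ, Real.exp (-(ε * (k - x₀)) ^ 2) ≤ C := by
  have hp := Real.pi_pos
  have hs : Summable fun n : ℤ => Real.exp (-(Real.pi ^ 2) * (n : ℝ) ^ 2) :=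
    summable_gauss_int (by positivity)
  refine ⟨Real.sqrt 2 * ∑' n : ℤ, Real.exp (-(Real.pi ^ 2) * (n : ℝ) ^ 2), ?_, ?_⟩
  · have := hs.tsum_pos (fun n => (Real.exp_pos _).le) 0 (Real.exp_pos _)
    positivity
  intro ε x₀ hε hε1
  have h2 : 0 < Real.sqrt 2 := by positivity
  have hsq : Real.sqrt 2 ^ 2 = 2 := Real.sq_sqrt (by norm_num)
  have h1 := thetaSum_eq (ε := ε / Real.sqrt 2) (by positivity) x₀ 0
  have e1 : thetaSum (ε / Real.sqrt 2) x₀ 0 = ((Real.sqrt (2 / Real.pi) * (ε / Real.sqrt 2) *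
      ∑' k : ℤ, Real.exp (-(ε * (k - x₀)) ^ 2) : ℝ) : ℂ) := by
    rw [thetaSum]
    push_cast
    congr 1
    refine tsum_congr fun k => ?_
    simp only [zero_mul, Complex.exp_zero, mul_one]
    congr 1
    have : (Real.sqrt 2 : ℂ) ^ 2 = 2 := by exact_mod_cast hsq
    rw [mul_pow, mul_pow, div_pow, this]
    ring
  have e2 : ‖thetaSum (ε / Real.sqrt 2) x₀ 0‖ ≤
      ∑' n : ℤ, Real.exp (-(Real.pi ^ 2) * (n : ℝ) ^ 2) := by
    rw [h1]
    refine tsum_of_norm_bounded hs.hasSum fun n => ?_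
    rw [norm_mul, ← Complex.ofReal_neg, Complex.norm_exp_ofReal_mul_I, mul_one, Complex.norm_real,
      Real.norm_eq_abs, Real.abs_exp]
    apply Real.exp_le_exp.2
    rw [zero_sub, neg_sq, neg_div, neg_mul, neg_le_neg_iff, le_div_iff₀ (by positivity), div_pow,
      hsq, mul_pow, mul_pow]
    have : ε ^ 2 ≤ 1 := by nlinarith
    nlinarith [mul_nonneg (sq_nonneg Real.pi) (sq_nonneg (n : ℝ))]
  rw [e1, Complex.norm_real, Real.norm_eq_abs] at e2
  have e3 := (le_abs_self _).trans e2
  calc Real.sqrt (2 / Real.pi) * ε * ∑' k : ℤ, Real.exp (-(ε * (k - x₀)) ^ 2)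
      = Real.sqrt 2 * (Real.sqrt (2 / Real.pi) * (ε / Real.sqrt 2) *
        ∑' k : ℤ, Real.exp (-(ε * (k - x₀)) ^ 2)) := by field_simp
    _ ≤ _ := by gcongr

/-- Those terms of the Poisson sum whose frequency stays away from the phase vanish in the limit, by
dominated convergence. -/
theorem tendsto_poisson_zero {X : Type*} {G : Filter X} {ε x₀ θ : X → ℝ}
    (hε : Tendsto ε G (𝓝[>] 0)) {R : ℝ} (hθ : ∀ᶠ x in G, |θ x| ≤ R) (P : ℤ → Prop)
    [DecidablePred P] (hP : ∀ n, P n → ∃ δ > 0, ∀ᶠ x in G, δ ≤ |θ x - 2 * Real.pi * n|) :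
    Tendsto (fun x => ∑' n : ℤ, if P n then
      (Real.exp (-(θ x - 2 * Real.pi * n) ^ 2 / (8 * ε x ^ 2)) : ℂ) *
      Complex.exp (-(2 * Real.pi * n * x₀ x : ℝ) * Complex.I) else 0) G (𝓝 0) := by
  have hp := Real.pi_pos
  have hε0 : ∀ᶠ x in G, 0 < ε x := hε.eventually self_mem_nhdsWithin
  have hεt : Tendsto ε G (𝓝 0) := hε.mono_right nhdsWithin_le_nhds
  have hε1 : ∀ᶠ x in G, ε x ≤ 1 := hεt.eventually_le_const one_pos
  have hnorm : ∀ (n : ℤ) (x : X),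
      ‖(Real.exp (-(θ x - 2 * Real.pi * n) ^ 2 / (8 * ε x ^ 2)) : ℂ) *
      Complex.exp (-(2 * Real.pi * n * x₀ x : ℝ) * Complex.I)‖ =
      Real.exp (-(θ x - 2 * Real.pi * n) ^ 2 / (8 * ε x ^ 2)) := fun n x => by
    rw [norm_mul, ← Complex.ofReal_neg, Complex.norm_exp_ofReal_mul_I, mul_one, Complex.norm_real,
      Real.norm_eq_abs, Real.abs_exp]
  have hb : Summable fun n : ℤ => Real.exp (R ^ 2 / 8) *
      Real.exp (-(Real.pi ^ 2 / 4) * (n : ℝ) ^ 2) := (summable_gauss_int (by positivity)).mul_left _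
  rw [show 𝓝 (0 : ℂ) = 𝓝 (∑' _ : ℤ, (0 : ℂ)) by rw [tsum_zero]]
  refine tendsto_tsum_of_dominated_convergence hb (fun n => ?_) ?_
  · by_cases hn : P n
    · simp only [hn, if_true]
      obtain ⟨δ, hδ, hδe⟩ := hP n hn
      rw [tendsto_zero_iff_norm_tendsto_zero]
      simp only [hnorm]
      have h1 : Tendsto (fun x => δ ^ 2 / 8 * (ε x ^ 2)⁻¹) G atTop := by
        refine Tendsto.const_mul_atTop (by positivity) (Tendsto.inv_tendsto_nhdsGT_zero ?_)
        refine tendsto_nhdsWithin_iff.2 ⟨?_, hε0.mono fun x hx => by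
          simp only [mem_Ioi]; positivity⟩
        simpa using hεt.pow 2
      have h2 := Real.tendsto_exp_neg_atTop_nhds_zero.comp h1
      refine squeeze_zero' (Eventually.of_forall fun x => (Real.exp_pos _).le) ?_ h2
      filter_upwards [hδe, hε0] with x hx hx0
      apply Real.exp_le_exp.2
      rw [neg_div, neg_le_neg_iff]
      beta_reduce
      rw [← div_eq_mul_inv, div_div]
      have hsq : δ ^ 2 ≤ (θ x - 2 * Real.pi * n) ^ 2 := by
        rw [← sq_abs (θ x - _)]; gcongr
      gcongr
    · simp only [hn, if_false]
      exact tendsto_const_nhds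
  · filter_upwards [hε0, hε1, hθ] with x hx hx1 hxθ n
    by_cases hn : P n
    · simp only [hn, if_true]
      rw [hnorm, ← Real.exp_add]
      apply Real.exp_le_exp.2
      have h1 : (θ x - 2 * Real.pi * n) ^ 2 / 8 ≤
          (θ x - 2 * Real.pi * n) ^ 2 / (8 * ε x ^ 2) := by
        apply div_le_div_of_nonneg_left (sq_nonneg _) (by positivity)
        nlinarith
      have h2 : θ x ^ 2 ≤ R ^ 2 := by
        rw [← sq_abs]; gcongr
      rw [neg_div]
      nlinarith [sq_nonneg (2 * θ x - 2 * Real.pi * n), sq_nonneg (θ x - Real.pi * n)]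
    · simp only [hn, if_false, norm_zero]
      positivity

/-- The Gaussian sum vanishes in the limit if the phase stays away from `2πℤ`. -/
theorem tendsto_thetaSum_zero {X : Type*} {G : Filter X} {ε x₀ θ : X → ℝ}
    (hε : Tendsto ε G (𝓝[>] 0)) {R : ℝ} (hθ : ∀ᶠ x in G, |θ x| ≤ R)
    (hP : ∀ n : ℤ, ∃ δ > 0, ∀ᶠ x in G, δ ≤ |θ x - 2 * Real.pi * n|) :
    Tendsto (fun x => thetaSum (ε x) (x₀ x) (θ x)) G (𝓝 0) := by
  have h := tendsto_poisson_zero (x₀ := x₀) hε hθ (fun _ => True) fun n _ => hP n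
  simp only [if_true] at h
  refine h.congr' ?_
  filter_upwards [hε.eventually self_mem_nhdsWithin] with x hx
  exact (thetaSum_eq hx _ _).symm

/-- For small phases only the central Gaussian of the Poisson sum survives. -/
theorem tendsto_thetaSum_sub {X : Type*} {G : Filter X} {ε x₀ θ : X → ℝ}
    (hε : Tendsto ε G (𝓝[>] 0)) (hθ : Tendsto θ G (𝓝 0)) :
    Tendsto (fun x => thetaSum (ε x) (x₀ x) (θ x) -
      (Real.exp (-(θ x) ^ 2 / (8 * ε x ^ 2)) : ℂ)) G (𝓝 0) := by
  have hp := Real.pi_pos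
  have hθ1 : ∀ᶠ x in G, |θ x| ≤ 1 := by
    have := hθ.abs; rw [abs_zero] at this
    exact this.eventually_le_const one_pos
  have hε0 : ∀ᶠ x in G, 0 < ε x := hε.eventually self_mem_nhdsWithin
  have h := tendsto_poisson_zero (x₀ := x₀) hε hθ1 (fun n => n ≠ 0) (fun n hn => by
    refine ⟨1, one_pos, hθ1.mono fun x hx => ?_⟩
    have h1 : (1 : ℝ) ≤ |(n : ℝ)| := by exact_mod_cast Int.one_le_abs hn
    have h2 : |2 * Real.pi * n| = 2 * Real.pi * |(n : ℝ)| := by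
      rw [abs_mul, abs_of_pos (by positivity)]
    have h3 := abs_sub_abs_le_abs_sub (2 * Real.pi * n) (θ x)
    rw [abs_sub_comm, h2] at h3
    nlinarith [Real.pi_gt_three])
  refine h.congr' ?_
  filter_upwards [hε0] with x hx
  rw [thetaSum_eq hx]
  have hsum : Summable fun n : ℤ =>
      (Real.exp (-(θ x - 2 * Real.pi * n) ^ 2 / (8 * ε x ^ 2)) : ℂ) *
      Complex.exp (-(2 * Real.pi * n * x₀ x : ℝ) * Complex.I) := by
    apply Summable.of_norm
    refine (summable_shifted_gauss (b := (2 * Real.pi) ^ 2 / (8 * ε x ^ 2)) (by positivity)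
      (θ x / (2 * Real.pi))).congr fun n => ?_
    rw [norm_mul, ← Complex.ofReal_neg, Complex.norm_exp_ofReal_mul_I, mul_one, Complex.norm_real,
      Real.norm_eq_abs, Real.abs_exp]
    congr 1
    field_simp
    ring
  rw [hsum.tsum_eq_add_tsum_ite 0]
  simp only [ite_not]
  simp

/-! ### Gaussian averages -/

/-- The weight in `gaussAvg` is a probability density. -/
theorem integral_gauss_window {β : ℝ} (hβ : 0 < β) (y : ℝ) :
    Integrable (fun p : ℝ => Real.exp (-(2 * (β * (y - p)) ^ 2))) ∧
      Real.sqrt (2 / Real.pi) * β * ∫ p : ℝ, Real.exp (-(2 * (β * (y - p)) ^ 2)) = 1 := by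
  have hp := Real.pi_pos
  have hb : 0 < 2 * β ^ 2 := by positivity
  have e : ∀ p : ℝ, Real.exp (-(2 * (β * (y - p)) ^ 2)) =
      (fun u => Real.exp (-(2 * β ^ 2) * u ^ 2)) (y - p) := fun p => by
    simp only; congr 1; ring
  constructor
  · simp only [e]
    exact (integrable_exp_neg_mul_sq hb).comp_sub_left y
  · simp only [e]
    rw [integral_sub_left_eq_self (fun u => Real.exp (-(2 * β ^ 2) * u ^ 2)), integral_gaussian,
      mul_right_comm, ← Real.sqrt_mul (by positivity),
      show 2 / Real.pi * (Real.pi / (2 * β ^ 2)) = (β⁻¹) ^ 2 by field_simp,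
      Real.sqrt_sq (by positivity), inv_mul_cancel₀ hβ.ne']

theorem norm_gaussAvg_le {β : ℝ} (hβ : 0 < β) {f : ℝ → ℂ} {C : ℝ} (hf : ∀ p, ‖f p‖ ≤ C) (y : ℝ) :
    ‖gaussAvg β f y‖ ≤ C := by
  obtain ⟨h1, h2⟩ := integral_gauss_window hβ y
  have hp := Real.pi_pos
  have h3 : ‖∫ p : ℝ, (Real.exp (-(2 * (β * (y - p)) ^ 2)) : ℂ) * f p‖ ≤
      ∫ p : ℝ, Real.exp (-(2 * (β * (y - p)) ^ 2)) * C := by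
    refine norm_integral_le_of_norm_le (h1.mul_const C) (Eventually.of_forall fun p => ?_)
    rw [norm_mul, Complex.norm_real, Real.norm_eq_abs, Real.abs_exp]
    exact mul_le_mul_of_nonneg_left (hf p) (Real.exp_pos _).le
  rw [gaussAvg, norm_mul, Complex.norm_real, Real.norm_of_nonneg (by positivity)]
  calc _ ≤ Real.sqrt (2 / Real.pi) * β * ∫ p : ℝ, Real.exp (-(2 * (β * (y - p)) ^ 2)) * C := by
        gcongr
    _ = C := by rw [integral_mul_const, ← mul_assoc, h2, one_mul]

theorem abs_le_exp_sq (u : ℝ) : |u| ≤ Real.exp (u ^ 2) := by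
  have h1 := Real.add_one_le_exp (u ^ 2)
  have h2 : |u| ^ 2 = u ^ 2 := sq_abs u
  nlinarith [sq_nonneg (|u| - 1), abs_nonneg u]

/-- The Gaussian average of a Lipschitz function is close to its value at a nearby point. -/
theorem norm_gaussAvg_sub_le {β : ℝ} (hβ : 0 < β) {f : ℝ → ℂ} (hc : Continuous f) {C L : ℝ}
    (hf : ∀ p, ‖f p‖ ≤ C) (hL0 : 0 ≤ L) (hL : ∀ p p', ‖f p - f p'‖ ≤ L * |p - p'|) (y p₀ : ℝ) :
    ‖gaussAvg β f y - f p₀‖ ≤ L * (|y - p₀| + Real.sqrt 2 / β) := by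
  obtain ⟨h1, h2⟩ := integral_gauss_window hβ y
  have hp := Real.pi_pos
  have hb : 0 < β ^ 2 := by positivity
  have i1 : Integrable fun p : ℝ => (Real.exp (-(2 * (β * (y - p)) ^ 2)) : ℂ) * f p := by
    refine (h1.ofReal.bdd_mul (c := C) hc.aestronglyMeasurable
      (Eventually.of_forall hf)).congr (Eventually.of_forall fun p => ?_)
    simp only [mul_comm]; rfl
  have i2 : Integrable fun p : ℝ => (Real.exp (-(2 * (β * (y - p)) ^ 2)) : ℂ) * f p₀ :=
    h1.ofReal.mul_const _
  have h2' : ((Real.sqrt (2 / Real.pi) * β : ℝ) : ℂ) *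
      ∫ p : ℝ, (Real.exp (-(2 * (β * (y - p)) ^ 2)) : ℂ) = 1 := by
    have : ∫ p : ℝ, (Real.exp (-(2 * (β * (y - p)) ^ 2)) : ℂ) =
        ((∫ p : ℝ, Real.exp (-(2 * (β * (y - p)) ^ 2)) : ℝ) : ℂ) := integral_ofReal
    rw [this, ← Complex.ofReal_mul, h2, Complex.ofReal_one]
  have e1 : gaussAvg β f y - f p₀ = (Real.sqrt (2 / Real.pi) * β : ℝ) *
      ∫ p : ℝ, (Real.exp (-(2 * (β * (y - p)) ^ 2)) : ℂ) * (f p - f p₀) := by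
    simp only [mul_sub (Complex.ofReal _)]
    rw [integral_sub i1 i2, integral_mul_const, mul_sub, ← mul_assoc, h2', one_mul,
      gaussAvg]
  have e : ∀ p : ℝ, Real.exp (-(β * (y - p)) ^ 2) =
      (fun u => Real.exp (-(β ^ 2) * u ^ 2)) (y - p) := fun p => by
    simp only; congr 1; ring
  have i3 : Integrable fun p : ℝ => Real.exp (-(β * (y - p)) ^ 2) := by
    simp only [e]
    exact (integrable_exp_neg_mul_sq hb).comp_sub_left y
  have h3 : ∫ p : ℝ, Real.exp (-(β * (y - p)) ^ 2) = Real.sqrt Real.pi / β := by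
    simp only [e]
    rw [integral_sub_left_eq_self (fun u => Real.exp (-(β ^ 2) * u ^ 2)), integral_gaussian,
      Real.sqrt_div' _ hb.le, Real.sqrt_sq hβ.le]
  have h4 : ‖∫ p : ℝ, (Real.exp (-(2 * (β * (y - p)) ^ 2)) : ℂ) * (f p - f p₀)‖ ≤
      ∫ p : ℝ, (Real.exp (-(2 * (β * (y - p)) ^ 2)) * (L * |y - p₀|) +
        Real.exp (-(β * (y - p)) ^ 2) * (L / β)) := by
    refine norm_integral_le_of_norm_le ((h1.mul_const _).add (i3.mul_const _))
      (Eventually.of_forall fun p => ?_)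
    rw [norm_mul, Complex.norm_real, Real.norm_eq_abs, Real.abs_exp]
    have a1 : |p - p₀| ≤ |y - p₀| + |y - p| := by
      have := abs_sub_le p y p₀; rw [abs_sub_comm p y] at this; linarith
    -- half of the Gaussian exponent absorbs the linear factor
    have a2 : Real.exp (-(2 * (β * (y - p)) ^ 2)) * |y - p| ≤
        Real.exp (-(β * (y - p)) ^ 2) * (1 / β) := by
      have a3 := abs_le_exp_sq (β * (y - p))
      rw [abs_mul, abs_of_pos hβ] at a3
      have a4 : Real.exp (-(2 * (β * (y - p)) ^ 2)) * Real.exp ((β * (y - p)) ^ 2) =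
          Real.exp (-(β * (y - p)) ^ 2) := by
        rw [← Real.exp_add]; congr 1; ring
      rw [← a4, mul_assoc]
      refine mul_le_mul_of_nonneg_left ?_ (Real.exp_pos _).le
      rw [mul_one_div, le_div_iff₀ hβ]
      linarith
    calc Real.exp (-(2 * (β * (y - p)) ^ 2)) * ‖f p - f p₀‖
        ≤ Real.exp (-(2 * (β * (y - p)) ^ 2)) * (L * (|y - p₀| + |y - p|)) :=
          mul_le_mul_of_nonneg_left ((hL p p₀).trans (mul_le_mul_of_nonneg_left a1 hL0))
            (Real.exp_pos _).le
      _ = Real.exp (-(2 * (β * (y - p)) ^ 2)) * (L * |y - p₀|) +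
          L * (Real.exp (-(2 * (β * (y - p)) ^ 2)) * |y - p|) := by ring
      _ ≤ Real.exp (-(2 * (β * (y - p)) ^ 2)) * (L * |y - p₀|) +
          L * (Real.exp (-(β * (y - p)) ^ 2) * (1 / β)) := by gcongr
      _ = _ := by ring
  rw [e1, norm_mul, Complex.norm_real, Real.norm_of_nonneg (by positivity)]
  refine (mul_le_mul_of_nonneg_left h4 (by positivity)).trans_eq ?_
  rw [integral_add (h1.mul_const _) (i3.mul_const _), integral_mul_const, integral_mul_const, h3,
    mul_add, ← mul_assoc, h2]
  have h5 : Real.sqrt (2 / Real.pi) * Real.sqrt Real.pi = Real.sqrt 2 := by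
    rw [← Real.sqrt_mul (by positivity)]; congr 1; field_simp
  rw [← h5]
  field_simp

/-! ### Gaussian sums with slowly varying coefficients -/

theorem summable_gauss_weight {ε : ℝ} (hε : 0 < ε) (x₀ : ℝ) :
    Summable fun k : ℤ => Real.exp (-(ε * (k - x₀)) ^ 2) := by
  refine (summable_shifted_gauss (b := ε ^ 2) (by positivity) x₀).congr fun k => ?_
  congr 1; ring

theorem exp_two_sq_le {u : ℝ} : Real.exp (-(2 * u ^ 2)) ≤ Real.exp (-u ^ 2) :=
  Real.exp_le_exp.2 (by nlinarith [sq_nonneg u])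

/-- A bound for Gaussian sums with bounded coefficients, uniform in the width of the Gaussian. -/
theorem exists_weighted_sum_bound : ∃ C : ℝ, 0 < C ∧ ∀ (ε x₀ B : ℝ) (w : ℤ → ℂ), 0 < ε → ε ≤ 1 →
    0 ≤ B → (∀ k : ℤ, ‖w k‖ ≤ B * Real.exp (-(ε * (k - x₀)) ^ 2)) →
    ‖((Real.sqrt (2 / Real.pi) * ε : ℝ) : ℂ) * ∑' k : ℤ, w k‖ ≤ B * C := by
  have hp := Real.pi_pos
  obtain ⟨C, hC, hb⟩ := exists_gauss_sum_bound
  refine ⟨C, hC, fun ε x₀ B w hε hε1 hB hw => ?_⟩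
  have h1 : ‖∑' k : ℤ, w k‖ ≤ B * ∑' k : ℤ, Real.exp (-(ε * (k - x₀)) ^ 2) := by
    rw [← tsum_mul_left]
    exact tsum_of_norm_bounded ((summable_gauss_weight hε x₀).mul_left B).hasSum hw
  rw [norm_mul, Complex.norm_real, Real.norm_of_nonneg (by positivity)]
  calc _ ≤ Real.sqrt (2 / Real.pi) * ε * (B * ∑' k : ℤ, Real.exp (-(ε * (k - x₀)) ^ 2)) := by
        gcongr
    _ = B * (Real.sqrt (2 / Real.pi) * ε * ∑' k : ℤ, Real.exp (-(ε * (k - x₀)) ^ 2)) := by ring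
    _ ≤ B * C := mul_le_mul_of_nonneg_left (hb ε x₀ hε hε1) hB

/-- Coefficients that vary slowly on the scale of the Gaussian may be frozen at its centre. -/
theorem exists_freeze_bound : ∃ C : ℝ, 0 < C ∧ ∀ (ε x₀ θ A : ℝ) (g : ℤ → ℂ) (v : ℂ), 0 < ε →
    ε ≤ 1 → 0 ≤ A → (∀ k : ℤ, ‖g k - v‖ ≤ A * (|ε * (k - x₀)| + Real.sqrt 2)) →
    ‖((Real.sqrt (2 / Real.pi) * ε : ℝ) : ℂ) * ∑' k : ℤ,
      (Real.exp (-(2 * (ε * (k - x₀)) ^ 2)) : ℂ) * Complex.exp ((θ * (k - x₀) : ℝ) * Complex.I) *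
        g k - thetaSum ε x₀ θ * v‖ ≤ A * C := by
  obtain ⟨C, hC, hb⟩ := exists_weighted_sum_bound
  refine ⟨(1 + Real.sqrt 2) * C, by positivity, fun ε x₀ θ A g v hε hε1 hA hg => ?_⟩
  set w : ℤ → ℂ := fun k => (Real.exp (-(2 * (ε * (k - x₀)) ^ 2)) : ℂ) *
    Complex.exp ((θ * (k - x₀) : ℝ) * Complex.I) with hw
  have hwn : ∀ k, ‖w k‖ = Real.exp (-(2 * (ε * (k - x₀)) ^ 2)) := fun k => by
    rw [hw, norm_mul, Complex.norm_exp_ofReal_mul_I, mul_one, Complex.norm_real, Real.norm_eq_abs,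
      Real.abs_exp]
  have hws : Summable w := by
    apply Summable.of_norm
    refine Summable.of_nonneg_of_le (fun _ => norm_nonneg _) (fun k => ?_)
      (summable_gauss_weight hε x₀)
    rw [hwn]; exact exp_two_sq_le
  have hd : ∀ k, ‖w k * (g k - v)‖ ≤
      A * (1 + Real.sqrt 2) * Real.exp (-(ε * (k - x₀)) ^ 2) := fun k => by
    rw [norm_mul, hwn]
    have a1 := abs_le_exp_sq (ε * (k - x₀))
    have a2 : (1 : ℝ) ≤ Real.exp ((ε * (k - x₀)) ^ 2) := Real.one_le_exp (sq_nonneg _)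
    have a3 : Real.exp (-(2 * (ε * (k - x₀)) ^ 2)) * Real.exp ((ε * (k - x₀)) ^ 2) =
        Real.exp (-(ε * (k - x₀)) ^ 2) := by
      rw [← Real.exp_add]; congr 1; ring
    have a4 : ‖g k - v‖ ≤ A * ((1 + Real.sqrt 2) * Real.exp ((ε * (k - x₀)) ^ 2)) := by
      refine (hg k).trans (mul_le_mul_of_nonneg_left ?_ hA)
      nlinarith [Real.sqrt_nonneg 2]
    calc _ ≤ Real.exp (-(2 * (ε * (k - x₀)) ^ 2)) *
          (A * ((1 + Real.sqrt 2) * Real.exp ((ε * (k - x₀)) ^ 2))) := by gcongr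
      _ = A * (1 + Real.sqrt 2) * (Real.exp (-(2 * (ε * (k - x₀)) ^ 2)) *
          Real.exp ((ε * (k - x₀)) ^ 2)) := by ring
      _ = _ := by rw [a3]
  have hds : Summable fun k => w k * (g k - v) :=
    Summable.of_norm (Summable.of_nonneg_of_le (fun _ => norm_nonneg _) hd
      ((summable_gauss_weight hε x₀).mul_left _))
  have hgs : Summable fun k => w k * g k :=
    (hds.add (hws.mul_right v)).congr fun k => by ring
  have e1 : ((Real.sqrt (2 / Real.pi) * ε : ℝ) : ℂ) * ∑' k : ℤ, w k * g k - thetaSum ε x₀ θ * v =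
      ((Real.sqrt (2 / Real.pi) * ε : ℝ) : ℂ) * ∑' k : ℤ, w k * (g k - v) := by
    simp only [mul_sub]
    rw [hgs.tsum_sub (hws.mul_right v), tsum_mul_right, thetaSum]
    ring
  rw [e1, ← mul_assoc]
  exact hb ε x₀ _ _ hε hε1 (by positivity) hd

/-! ### Separation into direct and interference terms -/

theorem boxWave_eq (l : ℝ) (k : ℤ) : boxWave l k = Real.pi / (2 * l) * k := by
  rw [boxWave]; ring

/-- The relative phase of two eigenfunctions. At time `c T_rev + s` it splits into the quadratic
phase of a fractional revival and the classical motion during the time `s`. -/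
theorem conj_boxPhase_mul_boxPhase {h m l : ℝ} (hh : 0 < h) (hm : 0 < m) (hl : 0 < l) (c s : ℝ)
    (j k : ℤ) :
    starRingEnd ℂ (boxPhase h m l (c * boxRevivalTime h m l + s) (k - j)) *
      boxPhase h m l (c * boxRevivalTime h m l + s) k =
    Complex.exp (-(2 * Real.pi * c * (2 * k * j - j ^ 2) +
      h * s / m * boxWave l j * ((boxWave l k + boxWave l (k - j)) / 2) : ℝ) * Complex.I) := by
  have hp : (Real.pi : ℂ) ≠ 0 := by exact_mod_cast Real.pi_ne_zero
  have hh' : (h : ℂ) ≠ 0 := by exact_mod_cast hh.ne'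
  have hm' : (m : ℂ) ≠ 0 := by exact_mod_cast hm.ne'
  have hl' : (l : ℂ) ≠ 0 := by exact_mod_cast hl.ne'
  have e : ∀ k : ℤ, -Complex.I * ((c * boxRevivalTime h m l + s : ℝ) : ℂ) *
      (boxEnergy h m l k : ℂ) / h =
      ((-((c * boxRevivalTime h m l + s) * boxEnergy h m l k / h) : ℝ) : ℂ) * Complex.I :=
    fun k => by push_cast; ring
  rw [boxPhase, boxPhase, e, e, ← Complex.exp_conj, map_mul, Complex.conj_ofReal, Complex.conj_I,
    ← Complex.exp_add]
  congr 1
  simp only [boxEnergy, boxRevivalTime, boxWave]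
  push_cast
  field_simp
  ring

/-- The constant factor of the direct term. The parameter `ν` is any number for which
`exp (i ν k) = exp (4 π i c j k)` for all integers `k`. -/
noncomputable def directCoef (h α m l c ν s : ℝ) (z : ℝ × ℝ) (j : ℤ) : ℂ :=
  (Real.exp (-(α ^ 2 * boxWave l j ^ 2)) : ℂ) *
    Complex.exp ((boxWave l j * (z.1 + l - z.2 / m * s) + 2 * Real.pi * c * j ^ 2 -
      ν * (j / 2 + z.2 / h * (2 * l / Real.pi)) : ℝ) * Complex.I)

/-- The constant factor of the interference term between a wave packet and its mirror image. -/
noncomputable def crossCoef (h α l c ν : ℝ) (z : ℝ × ℝ) (j : ℤ) : ℂ :=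
  (Real.exp (-(α ^ 2 * ((boxWave l j - z.2 / h) ^ 2 + (z.2 / h) ^ 2))) : ℂ) *
    Complex.exp ((2 * Real.pi * c * j ^ 2 - ν * (j / 2) : ℝ) * Complex.I)

/-- The plane wave coefficients of the test functional are the difference of a direct term, a
Gaussian in `k` centred at the momentum of the packet, and an interference term, a Gaussian
centred at zero momentum. -/
theorem pairTerm_eq {h α m l : ℝ} (hh : 0 < h) (hm : 0 < m) (hl : 0 < l) (c s ν : ℝ)
    (z : ℝ × ℝ) (σ : BoxTest l) (j : ℤ)
    (hν : ∀ k : ℤ, Complex.exp (-(4 * Real.pi * c * j * k : ℝ) * Complex.I) =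
      Complex.exp (-(ν * k : ℝ) * Complex.I)) (k : ℤ) :
    pairTerm h α m l (c * boxRevivalTime h m l + s) z σ j k =
      directCoef h α m l c ν s z j *
        ((Real.exp (-(2 * (α * (Real.pi / (2 * l)) *
          (k - (j / 2 + z.2 / h * (2 * l / Real.pi)))) ^ 2)) : ℂ) *
        Complex.exp ((-(ν + h * s / m * boxWave l j * (Real.pi / (2 * l))) *
          (k - (j / 2 + z.2 / h * (2 * l / Real.pi))) : ℝ) * Complex.I) *
        gaussAvg (α / h) (stripCoeff l σ j) (h * ((boxWave l k + boxWave l (k - j)) / 2))) -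
      crossCoef h α l c ν z j *
        ((Real.exp (-(2 * (α * (Real.pi / (2 * l)) * (k - ((j : ℝ) / 2))) ^ 2)) : ℂ) *
        Complex.exp (((Real.pi / l * (z.1 + l) - (ν + h * s / m * boxWave l j *
          (Real.pi / (2 * l)))) * (k - ((j : ℝ) / 2)) : ℝ) * Complex.I) *
        gaussAvg (α / h) (stripCoeff l σ j) (h * ((boxWave l k + boxWave l (k - j)) / 2))) := by
  have hp : (Real.pi : ℂ) ≠ 0 := by exact_mod_cast Real.pi_ne_zero
  have hp' := Real.pi_ne_zero
  have hh' : (h : ℂ) ≠ 0 := by exact_mod_cast hh.ne'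
  have hm' : (m : ℂ) ≠ 0 := by exact_mod_cast hm.ne'
  have hl' : (l : ℂ) ≠ 0 := by exact_mod_cast hl.ne'
  set g := gaussAvg (α / h) (stripCoeff l σ j) (h * ((boxWave l k + boxWave l (k - j)) / 2))
  set κ := (boxWave l k + boxWave l (k - j)) / 2 with hκ
  have hphase : Complex.exp (-(2 * Real.pi * c * (2 * k * j - j ^ 2) +
      h * s / m * boxWave l j * κ : ℝ) * Complex.I) =
      Complex.exp (-(ν * k : ℝ) * Complex.I) *
        Complex.exp ((2 * Real.pi * c * j ^ 2 - h * s / m * boxWave l j * κ : ℝ) * Complex.I) := by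
    rw [← hν, ← Complex.exp_add]
    congr 1; push_cast; ring
  have hcos : starRingEnd ℂ (boxAmp h α l k z) =
      Complex.exp ((boxWave l k * (z.1 + l) : ℝ) * Complex.I) *
      (Real.exp (-(α ^ 2 * (boxWave l k - z.2 / h) ^ 2)) : ℝ) := by
    rw [boxAmp, map_mul, Complex.conj_ofReal, ← Complex.exp_conj, map_mul, Complex.conj_I, map_neg,
      Complex.conj_ofReal, neg_mul_neg]
  rw [pairTerm, conj_boxPhase_mul_boxPhase hh hm hl, hphase, hcos, directCoef, crossCoef,
    boxAmp, boxAmp, ← neg_sub k j, boxWave_neg]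
  simp only [mul_sub, sub_mul]
  have e : ∀ a b c' d e' f g' g : ℂ, Complex.exp a * Complex.exp b * (Complex.exp c' *
      Complex.exp d * (Complex.exp e' * Complex.exp f)) * Complex.exp g' * g =
      Complex.exp (a + b + c' + d + e' + f + g') * g := fun a b c' d e' f g' g => by
    simp only [Complex.exp_add]; ring
  have e2 : ∀ a b c' d g : ℂ, Complex.exp a * Complex.exp b * (Complex.exp c' * Complex.exp d * g)
      = Complex.exp (a + b + c' + d) * g := fun a b c' d g => by
    simp only [Complex.exp_add]; ring
  congr 1
  · simp only [Complex.ofReal_exp]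
    rw [e, e2]
    congr 2
    simp only [hκ, boxWave_eq]
    push_cast
    field_simp
    ring
  · simp only [Complex.ofReal_exp]
    rw [e, e2]
    congr 2
    simp only [hκ, boxWave_eq]
    push_cast
    field_simp
    ring

/-! ### The semiclassical limit -/

/-- The factor `exp (-κ_j² D² / 2)` by which a packet of width `D` damps the `j`-th Fourier
coefficient, for `D ∈ [0, ∞]`. -/
noncomputable def spreadDamping (l : ℝ) (D : ℝ≥0∞) (j : ℤ) : ℝ :=
  if j = 0 then 1 else if D = ⊤ then 0 else Real.exp (-(boxWave l j * D.toReal) ^ 2 / 2)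

open Classical in
/-- The contribution of the `j`-th Fourier coefficient to the limiting distribution. Only those
`j` contribute for which the phases `exp (-4πi c j k)` are trivial for all integers `k`. -/
noncomputable def limitTerm (l m c : ℝ) (D : ℝ≥0∞) (s : ℝ) (z : ℝ × ℝ) (σ : BoxTest l) (j : ℤ) :
    ℂ :=
  if ∃ n : ℤ, 2 * c * j = n then
    Complex.exp ((boxWave l j * (z.1 + l - z.2 / m * s) + 2 * Real.pi * c * j ^ 2 : ℝ) *
      Complex.I) * spreadDamping l D j * stripCoeff l σ j z.2
  else 0

theorem spreadDamping_nonneg (l : ℝ) (D : ℝ≥0∞) (j : ℤ) : 0 ≤ spreadDamping l D j := by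
  unfold spreadDamping
  split_ifs
  · exact zero_le_one
  · exact le_rfl
  · exact (Real.exp_pos _).le

theorem spreadDamping_le_one (l : ℝ) (D : ℝ≥0∞) (j : ℤ) : spreadDamping l D j ≤ 1 := by
  unfold spreadDamping
  split_ifs
  · exact le_rfl
  · exact zero_le_one
  · rw [Real.exp_le_one_iff, neg_div]
    have : 0 ≤ (boxWave l j * D.toReal) ^ 2 / 2 := by positivity
    linarith

theorem norm_limitTerm_le (l m c : ℝ) (D : ℝ≥0∞) (s : ℝ) (z : ℝ × ℝ) (σ : BoxTest l) (j : ℤ) :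
    ‖limitTerm l m c D s z σ j‖ ≤ ‖stripCoeff l σ j z.2‖ := by
  unfold limitTerm
  split_ifs
  · rw [norm_mul, norm_mul, Complex.norm_exp_ofReal_mul_I, one_mul, Complex.norm_real,
      Real.norm_of_nonneg (spreadDamping_nonneg l D j)]
    exact mul_le_of_le_one_left (norm_nonneg _) (spreadDamping_le_one l D j)
  · simp

theorem norm_directCoef (h α m l c ν s : ℝ) (z : ℝ × ℝ) (j : ℤ) :
    ‖directCoef h α m l c ν s z j‖ = Real.exp (-(α ^ 2 * boxWave l j ^ 2)) := by
  rw [directCoef, norm_mul, Complex.norm_exp_ofReal_mul_I, mul_one, Complex.norm_real,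
    Real.norm_eq_abs, Real.abs_exp]

theorem norm_directCoef_le_one (h α m l c ν s : ℝ) (z : ℝ × ℝ) (j : ℤ) :
    ‖directCoef h α m l c ν s z j‖ ≤ 1 := by
  rw [norm_directCoef, Real.exp_le_one_iff]
  have : 0 ≤ α ^ 2 * boxWave l j ^ 2 := by positivity
  linarith

theorem norm_crossCoef_le (h α l c ν : ℝ) (z : ℝ × ℝ) (j : ℤ) :
    ‖crossCoef h α l c ν z j‖ ≤ Real.exp (-(α * (z.2 / h)) ^ 2) := by
  rw [crossCoef, norm_mul, Complex.norm_exp_ofReal_mul_I, mul_one, Complex.norm_real,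
    Real.norm_eq_abs, Real.abs_exp, Real.exp_le_exp, mul_pow]
  nlinarith [mul_nonneg (sq_nonneg α) (sq_nonneg (boxWave l j - z.2 / h))]

theorem norm_crossCoef_le_one (h α l c ν : ℝ) (z : ℝ × ℝ) (j : ℤ) :
    ‖crossCoef h α l c ν z j‖ ≤ 1 :=
  (norm_crossCoef_le h α l c ν z j).trans (Real.exp_le_one_iff.2 (by
    have : 0 ≤ (α * (z.2 / h)) ^ 2 := by positivity
    linarith))

/-- The sum over `k` of a Gaussian wave against the averaged Fourier coefficients. -/
noncomputable def waveSum (h α l : ℝ) (σ : BoxTest l) (j : ℤ) (x₀ θ : ℝ) : ℂ :=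
  (Real.sqrt (2 / Real.pi) * (α * (Real.pi / (2 * l))) : ℝ) * ∑' k : ℤ,
    (Real.exp (-(2 * (α * (Real.pi / (2 * l)) * (k - x₀)) ^ 2)) : ℂ) *
      Complex.exp ((θ * (k - x₀) : ℝ) * Complex.I) *
      gaussAvg (α / h) (stripCoeff l σ j) (h * ((boxWave l k + boxWave l (k - j)) / 2))

theorem norm_gaussWave_mul_le {ε x₀ θ B : ℝ} {g : ℂ} (hg : ‖g‖ ≤ B) (k : ℤ) :
    ‖(Real.exp (-(2 * (ε * (k - x₀)) ^ 2)) : ℂ) * Complex.exp ((θ * (k - x₀) : ℝ) * Complex.I) *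
      g‖ ≤ B * Real.exp (-(ε * (k - x₀)) ^ 2) := by
  rw [norm_mul, norm_mul, Complex.norm_exp_ofReal_mul_I, mul_one, Complex.norm_real,
    Real.norm_eq_abs, Real.abs_exp, mul_comm]
  exact mul_le_mul hg exp_two_sq_le (Real.exp_pos _).le ((norm_nonneg _).trans hg)

/-- The sum over `k` of the `j`-th contribution to the pairing, split into direct and interference
term. -/
theorem tsum_pairTerm_eq {h α m l : ℝ} (hh : 0 < h) (hα : 0 < α) (hm : 0 < m) (hl : 0 < l)
    (c s ν : ℝ) (z : ℝ × ℝ) (σ : BoxTest l) (j : ℤ)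
    (hν : ∀ k : ℤ, Complex.exp (-(4 * Real.pi * c * j * k : ℝ) * Complex.I) =
      Complex.exp (-(ν * k : ℝ) * Complex.I)) :
    (Real.sqrt (2 / Real.pi) * (α * (Real.pi / (2 * l))) : ℝ) *
        ∑' k : ℤ, pairTerm h α m l (c * boxRevivalTime h m l + s) z σ j k =
      directCoef h α m l c ν s z j * waveSum h α l σ j (j / 2 + z.2 / h * (2 * l / Real.pi))
        (-(ν + h * s / m * boxWave l j * (Real.pi / (2 * l)))) -
      crossCoef h α l c ν z j * waveSum h α l σ j (j / 2)
        (Real.pi / l * (z.1 + l) - (ν + h * s / m * boxWave l j * (Real.pi / (2 * l)))) := by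
  have hp := Real.pi_pos
  obtain ⟨b, -, hb⟩ := σ.exists_stripCoeff_bound hl
  have hg : ∀ y, ‖gaussAvg (α / h) (stripCoeff l σ j) y‖ ≤ b j :=
    norm_gaussAvg_le (div_pos hα hh) (hb j)
  have hs : ∀ x₀ θ : ℝ, Summable fun k : ℤ =>
      (Real.exp (-(2 * (α * (Real.pi / (2 * l)) * (k - x₀)) ^ 2)) : ℂ) *
      Complex.exp ((θ * (k - x₀) : ℝ) * Complex.I) *
      gaussAvg (α / h) (stripCoeff l σ j) (h * ((boxWave l k + boxWave l (k - j)) / 2)) :=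
    fun x₀ θ => Summable.of_norm (Summable.of_nonneg_of_le (fun _ => norm_nonneg _)
      (fun k => norm_gaussWave_mul_le (hg _) k)
      ((summable_gauss_weight (by positivity) x₀).mul_left _))
  rw [tsum_congr (pairTerm_eq hh hm hl c s ν z σ j hν), ((hs _ _).mul_left _).tsum_sub
    ((hs _ _).mul_left _), tsum_mul_left, tsum_mul_left, waveSum, waveSum]
  ring

/-- Wave sums are bounded by the Fourier coefficients, uniformly in all parameters. -/
theorem exists_waveSum_bound {l : ℝ} (hl : 0 < l) : ∃ C : ℝ, 0 < C ∧
    ∀ (h α x₀ θ B : ℝ) (σ : BoxTest l) (j : ℤ), 0 < h → 0 < α → α * (Real.pi / (2 * l)) ≤ 1 →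
    (∀ p, ‖stripCoeff l σ j p‖ ≤ B) → ‖waveSum h α l σ j x₀ θ‖ ≤ B * C := by
  obtain ⟨C, hC, hb⟩ := exists_weighted_sum_bound
  refine ⟨C, hC, fun h α x₀ θ B σ j hh hα hα1 hB => ?_⟩
  have hp := Real.pi_pos
  exact hb (α * (Real.pi / (2 * l))) x₀ B _ (by positivity) hα1 ((norm_nonneg _).trans (hB 0))
    fun k => norm_gaussWave_mul_le (norm_gaussAvg_le (div_pos hα hh) hB _) k

/-- In a wave sum centred at `x₀ = j / 2 + P (2l / π)` the Fourier coefficient may be evaluated at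
the momentum `h P`, up to an error of order `h / α`. -/
theorem exists_waveSum_freeze {l : ℝ} (hl : 0 < l) (σ : BoxTest l) : ∃ C : ℝ, 0 < C ∧
    ∀ (h α P θ : ℝ) (j : ℤ), 0 < h → 0 < α → α * (Real.pi / (2 * l)) ≤ 1 →
    ‖waveSum h α l σ j (j / 2 + P * (2 * l / Real.pi)) θ -
      thetaSum (α * (Real.pi / (2 * l))) (j / 2 + P * (2 * l / Real.pi)) θ *
        stripCoeff l σ j (h * P)‖ ≤ h / α * C := by
  obtain ⟨C, hC, hf⟩ := exists_freeze_bound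
  obtain ⟨L, hL0, hL⟩ := σ.exists_mixedDeriv_bound 0 1
  obtain ⟨b, -, hb⟩ := σ.exists_stripCoeff_bound hl
  refine ⟨(L + 1) * C, by positivity, fun h α P θ j hh hα hα1 => ?_⟩
  have hp := Real.pi_pos
  have key := hf (α * (Real.pi / (2 * l))) (j / 2 + P * (2 * l / Real.pi)) θ (L * (h / α))
    (fun k => gaussAvg (α / h) (stripCoeff l σ j) (h * ((boxWave l k + boxWave l (k - j)) / 2)))
    (stripCoeff l σ j (h * P)) (by positivity) hα1 (by positivity) fun k => by
      have h1 := norm_gaussAvg_sub_le (div_pos hα hh) (continuous_stripCoeff hl σ j) (hb j) hL0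
        (stripCoeff_lipschitz hl σ.contDiff hL j) (h * ((boxWave l k + boxWave l (k - j)) / 2))
        (h * P)
      refine h1.trans_eq ?_
      have e1 : h * ((boxWave l k + boxWave l (k - j)) / 2) - h * P =
          h / α * (α * (Real.pi / (2 * l)) * (k - (j / 2 + P * (2 * l / Real.pi)))) := by
        rw [boxWave_eq, boxWave_eq]; push_cast; field_simp; ring
      rw [e1, abs_mul, abs_of_pos (div_pos hh hα)]
      field_simp
  refine key.trans ?_
  have : 0 ≤ h / α * C := by positivity
  nlinarith

section Limits

variable {X : Type*} {G : Filter X} {h α s : X → ℝ} {z : X → ℝ × ℝ} {l m c : ℝ} {D : ℝ≥0∞}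

theorem tendsto_width (hl : 0 < l) (hα : Tendsto α G (𝓝[>] 0)) :
    Tendsto (fun x => α x * (Real.pi / (2 * l))) G (𝓝[>] 0) := by
  have hp := Real.pi_pos
  refine tendsto_nhdsWithin_iff.2 ⟨?_, ?_⟩
  · simpa using (hα.mono_right nhdsWithin_le_nhds).mul_const (Real.pi / (2 * l))
  · filter_upwards [hα.eventually self_mem_nhdsWithin] with x hx
    simp only [mem_Ioi] at hx ⊢
    positivity

theorem eventually_width_le (hl : 0 < l) (hα : Tendsto α G (𝓝[>] 0)) :
    ∀ᶠ x in G, α x * (Real.pi / (2 * l)) ≤ 1 :=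
  ((tendsto_width hl hα).mono_right nhdsWithin_le_nhds).eventually_le_const one_pos

/-- The spreading of the packet during the time `s` gives the factor `spreadDamping`. -/
theorem tendsto_damping (hl : 0 < l) (hm : 0 < m) (hα : Tendsto α G (𝓝[>] 0))
    (hD : Tendsto (fun x => ((h x / α x * s x : ℝ) : EReal)) G
      (𝓝 (((2 * m : ℝ) : EReal) * (D : EReal)))) (j : ℤ) :
    Tendsto (fun x => Real.exp (-(-(h x * s x / m * boxWave l j * (Real.pi / (2 * l)))) ^ 2 /
      (8 * (α x * (Real.pi / (2 * l))) ^ 2))) G (𝓝 (spreadDamping l D j)) := by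
  have hp := Real.pi_pos
  have e : ∀ᶠ x in G, Real.exp (-(h x / α x * s x * (boxWave l j / m)) ^ 2 / 8) =
      Real.exp (-(-(h x * s x / m * boxWave l j * (Real.pi / (2 * l)))) ^ 2 /
      (8 * (α x * (Real.pi / (2 * l))) ^ 2)) := by
    filter_upwards [hα.eventually self_mem_nhdsWithin] with x hx
    have hx' : (0 : ℝ) < α x := hx
    congr 1
    field_simp
  refine Tendsto.congr' e ?_
  unfold spreadDamping
  by_cases hj : j = 0
  · simpa [hj, boxWave] using tendsto_const_nhds
  have hw : boxWave l j ≠ 0 := by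
    have : (j : ℝ) ≠ 0 := by exact_mod_cast hj
    rw [boxWave]; positivity
  rw [if_neg hj]
  by_cases hDt : D = ⊤
  · rw [if_pos hDt]
    rw [hDt, EReal.coe_ennreal_top, EReal.coe_mul_top_of_pos (by positivity),
      EReal.tendsto_coe_nhds_top_iff] at hD
    have h1 : Tendsto (fun x => (h x / α x * s x) ^ 2 * ((boxWave l j / m) ^ 2 / 8)) G atTop :=
      (tendsto_pow_atTop two_ne_zero |>.comp hD).atTop_mul_const (by positivity)
    refine (Real.tendsto_exp_neg_atTop_nhds_zero.comp h1).congr fun x => ?_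
    simp only [Function.comp]
    congr 1; ring
  · rw [if_neg hDt]
    have hDr : ((2 * m : ℝ) : EReal) * (D : EReal) = ((2 * m * D.toReal : ℝ) : EReal) := by
      rw [EReal.coe_mul (2 * m) D.toReal, EReal.coe_ennreal_toReal hDt]
    rw [hDr, EReal.tendsto_coe] at hD
    have h1 : Tendsto (fun x => Real.exp (-(h x / α x * s x * (boxWave l j / m)) ^ 2 / 8)) G
        (𝓝 (Real.exp (-(2 * m * D.toReal * (boxWave l j / m)) ^ 2 / 8))) :=
      (Real.continuous_exp.tendsto _).comp ((((hD.mul_const _).pow 2).neg).div_const 8)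
    convert h1 using 3
    field_simp
    ring

theorem tendsto_phase (hs : Tendsto (fun x => h x * s x) G (𝓝 0)) (j : ℤ) :
    Tendsto (fun x => h x * s x / m * boxWave l j * (Real.pi / (2 * l))) G (𝓝 0) := by
  have := ((hs.div_const m).mul_const (boxWave l j)).mul_const (Real.pi / (2 * l))
  simpa using this

/-- For integral `2cj` the phases `exp (-4πi c j k)` are trivial, so that `ν = 0` may be used. -/
theorem exp_phase_of_int {j : ℤ} (hj : ∃ n : ℤ, 2 * c * j = n) (k : ℤ) :
    Complex.exp (-(4 * Real.pi * c * j * k : ℝ) * Complex.I) =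
      Complex.exp (-((0 : ℝ) * k : ℝ) * Complex.I) := by
  obtain ⟨n, hn⟩ := hj
  have : (-(4 * Real.pi * c * j * k : ℝ) : ℂ) * Complex.I =
      ((-(n * k) : ℤ) : ℂ) * (2 * Real.pi * Complex.I) := by
    have h1 : (2 : ℂ) * c * j = n := by exact_mod_cast hn
    push_cast
    linear_combination (-2 * Real.pi * k * Complex.I : ℂ) * h1
  rw [this, Complex.exp_int_mul_two_pi_mul_I]
  simp

/-- The limit of the direct terms. If `2cj` is an integer, then the phases `exp (-4πi c j k)` are
trivial and the central Gaussian of the Poisson sum survives; otherwise they oscillate in `k` and the sum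
vanishes in the limit. Here `ν` records which of the two equivalent phases is used. -/
theorem tendsto_direct (hl : 0 < l) (hm : 0 < m) (hh : Tendsto h G (𝓝[>] 0))
    (hα : Tendsto α G (𝓝[>] 0)) (hhα : Tendsto (fun x => h x / α x) G (𝓝 0))
    (hD : Tendsto (fun x => ((h x / α x * s x : ℝ) : EReal)) G
      (𝓝 (((2 * m : ℝ) : EReal) * (D : EReal))))
    (hs : Tendsto (fun x => h x * s x) G (𝓝 0)) (σ : BoxTest l) (j : ℤ) :
    ∃ ν : ℝ, (∀ k : ℤ, Complex.exp (-(4 * Real.pi * c * j * k : ℝ) * Complex.I) =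
      Complex.exp (-(ν * k : ℝ) * Complex.I)) ∧ ((∃ n : ℤ, 2 * c * j = n) → ν = 0) ∧
    Tendsto (fun x => directCoef (h x) (α x) m l c ν (s x) (z x) j *
      waveSum (h x) (α x) l σ j (j / 2 + (z x).2 / h x * (2 * l / Real.pi))
        (-(ν + h x * s x / m * boxWave l j * (Real.pi / (2 * l)))) -
      limitTerm l m c D (s x) (z x) σ j) G (𝓝 0) := by
  have hp := Real.pi_pos
  obtain ⟨C, hC, hfr⟩ := exists_waveSum_freeze hl σ
  obtain ⟨b, -, hb⟩ := σ.exists_stripCoeff_bound hl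
  have hh0 : ∀ᶠ x in G, 0 < h x := hh.eventually self_mem_nhdsWithin
  have hα0 : ∀ᶠ x in G, 0 < α x := hα.eventually self_mem_nhdsWithin
  have hε := tendsto_width hl hα
  have hε1 := eventually_width_le hl hα
  have hph := tendsto_phase (m := m) (l := l) hs j
  -- freezing the Fourier coefficient at the momentum of the packet
  have hfreeze : ∀ ν : ℝ, Tendsto (fun x => directCoef (h x) (α x) m l c ν (s x) (z x) j *
      (waveSum (h x) (α x) l σ j (j / 2 + (z x).2 / h x * (2 * l / Real.pi))
        (-(ν + h x * s x / m * boxWave l j * (Real.pi / (2 * l)))) -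
      thetaSum (α x * (Real.pi / (2 * l))) (j / 2 + (z x).2 / h x * (2 * l / Real.pi))
        (-(ν + h x * s x / m * boxWave l j * (Real.pi / (2 * l)))) *
        stripCoeff l σ j (z x).2)) G (𝓝 0) := by
    intro ν
    have h1 : Tendsto (fun x => h x / α x * C) G (𝓝 0) := by simpa using hhα.mul_const C
    refine squeeze_zero_norm' ?_ h1
    filter_upwards [hh0, hα0, hε1] with x hx hx' hx1
    have h2 := hfr (h x) (α x) ((z x).2 / h x)
      (-(ν + h x * s x / m * boxWave l j * (Real.pi / (2 * l)))) j hx hx' hx1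
    rw [mul_div_cancel₀ _ hx.ne'] at h2
    rw [norm_mul]
    exact (mul_le_of_le_one_left (norm_nonneg _) (norm_directCoef_le_one _ _ _ _ _ _ _ _ _)).trans
      h2
  by_cases hj : ∃ n : ℤ, 2 * c * j = n
  · refine ⟨0, exp_phase_of_int hj, fun _ => rfl, ?_⟩
    have ht := tendsto_thetaSum_sub
      (x₀ := fun x => j / 2 + (z x).2 / h x * (2 * l / Real.pi)) hε
      (θ := fun x => -(0 + h x * s x / m * boxWave l j * (Real.pi / (2 * l)))) (by
        simpa using hph.neg)
    have hdamp := tendsto_damping hl hm hα hD j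
    -- the total factor of `stripCoeff`
    have hfac : Tendsto (fun x => (Real.exp (-(α x ^ 2 * boxWave l j ^ 2)) : ℂ) *
        thetaSum (α x * (Real.pi / (2 * l))) (j / 2 + (z x).2 / h x * (2 * l / Real.pi))
        (-(0 + h x * s x / m * boxWave l j * (Real.pi / (2 * l)))) - spreadDamping l D j)
        G (𝓝 0) := by
      have h1 : Tendsto (fun x => (Real.exp (-(α x ^ 2 * boxWave l j ^ 2)) : ℂ)) G (𝓝 1) := by
        have h2 : Tendsto (fun x => -(α x ^ 2 * boxWave l j ^ 2)) G (𝓝 0) := by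
          have := (((hα.mono_right nhdsWithin_le_nhds).pow 2).mul_const (boxWave l j ^ 2)).neg
          simpa using this
        have h3 := (Real.continuous_exp.tendsto 0).comp h2
        rw [Real.exp_zero] at h3
        have := (Complex.continuous_ofReal.tendsto 1).comp h3
        rwa [Complex.ofReal_one] at this
      have h4 := (Complex.continuous_ofReal.tendsto _).comp hdamp
      have h5 := h1.mul (ht.add h4)
      have h6 := h5.sub_const (spreadDamping l D j : ℂ)
      simp only [zero_add, one_mul, sub_self] at h6
      refine h6.congr fun x => ?_
      simp only [Function.comp, zero_add, sub_add_cancel]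
    have hfin : Tendsto (fun x => ‖(Real.exp (-(α x ^ 2 * boxWave l j ^ 2)) : ℂ) *
        thetaSum (α x * (Real.pi / (2 * l))) (j / 2 + (z x).2 / h x * (2 * l / Real.pi))
        (-(0 + h x * s x / m * boxWave l j * (Real.pi / (2 * l)))) - spreadDamping l D j‖ * b j)
        G (𝓝 0) := by
      simpa using hfac.norm.mul_const (b j)
    have hsecond : Tendsto (fun x => directCoef (h x) (α x) m l c 0 (s x) (z x) j *
        (thetaSum (α x * (Real.pi / (2 * l))) (j / 2 + (z x).2 / h x * (2 * l / Real.pi))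
        (-(0 + h x * s x / m * boxWave l j * (Real.pi / (2 * l)))) * stripCoeff l σ j (z x).2) -
        limitTerm l m c D (s x) (z x) σ j) G (𝓝 0) := by
      refine squeeze_zero_norm (fun x => ?_) hfin
      rw [limitTerm, if_pos hj, directCoef, zero_mul, sub_zero]
      set E := Complex.exp ((boxWave l j * ((z x).1 + l - (z x).2 / m * s x) +
        2 * Real.pi * c * j ^ 2 : ℝ) * Complex.I) with hE
      have hEn : ‖E‖ = 1 := Complex.norm_exp_ofReal_mul_I _
      set Θ := thetaSum (α x * (Real.pi / (2 * l))) (j / 2 + (z x).2 / h x * (2 * l / Real.pi))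
        (-(0 + h x * s x / m * boxWave l j * (Real.pi / (2 * l))))
      have e1 : (Real.exp (-(α x ^ 2 * boxWave l j ^ 2)) : ℂ) * E *
          (Θ * stripCoeff l σ j (z x).2) - E * spreadDamping l D j * stripCoeff l σ j (z x).2 =
          E * (((Real.exp (-(α x ^ 2 * boxWave l j ^ 2)) : ℂ) * Θ - spreadDamping l D j) *
            stripCoeff l σ j (z x).2) := by ring
      rw [e1, norm_mul, hEn, one_mul, norm_mul]
      exact mul_le_mul_of_nonneg_left (hb j _) (norm_nonneg _)
    have := (hfreeze 0).add hsecond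
    rw [add_zero] at this
    refine this.congr fun x => ?_
    ring
  · refine ⟨4 * Real.pi * c * j, fun k => rfl, fun hj' => absurd hj' hj, ?_⟩
    have ht : Tendsto (fun x => thetaSum (α x * (Real.pi / (2 * l)))
        (j / 2 + (z x).2 / h x * (2 * l / Real.pi))
        (-(4 * Real.pi * c * j + h x * s x / m * boxWave l j * (Real.pi / (2 * l))))) G (𝓝 0) := by
      have hlim : Tendsto (fun x => -(4 * Real.pi * c * j +
          h x * s x / m * boxWave l j * (Real.pi / (2 * l)))) G (𝓝 (-(4 * Real.pi * c * j))) := by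
        have := (hph.const_add (4 * Real.pi * c * j)).neg
        rwa [add_zero] at this
      refine tendsto_thetaSum_zero hε (R := |-(4 * Real.pi * c * j)| + 1)
        (hlim.abs.eventually_le_const (by linarith)) fun n => ?_
      have hne : -(4 * Real.pi * c * j) - 2 * Real.pi * n ≠ 0 := fun h0 => hj ⟨-n, by
        have h1 : (2 * Real.pi) * (2 * c * j + n) = 0 := by linarith
        have h2 := (mul_eq_zero.1 h1).resolve_left (by positivity)
        push_cast; linarith⟩
      refine ⟨|-(4 * Real.pi * c * j) - 2 * Real.pi * n| / 2, by positivity, ?_⟩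
      have := (hlim.sub_const (2 * Real.pi * n)).abs
      exact this.eventually_const_le (half_lt_self (abs_pos.2 hne))
    have hsecond : Tendsto (fun x => directCoef (h x) (α x) m l c (4 * Real.pi * c * j) (s x) (z x) j *
        (thetaSum (α x * (Real.pi / (2 * l))) (j / 2 + (z x).2 / h x * (2 * l / Real.pi))
        (-(4 * Real.pi * c * j + h x * s x / m * boxWave l j * (Real.pi / (2 * l)))) *
          stripCoeff l σ j (z x).2)) G (𝓝 0) := by
      have hfin := ht.norm.mul_const (b j)
      rw [norm_zero, zero_mul] at hfin
      refine squeeze_zero_norm (fun x => ?_) hfin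
      rw [norm_mul, norm_mul]
      refine (mul_le_of_le_one_left (by positivity)
        (norm_directCoef_le_one _ _ _ _ _ _ _ _ _)).trans ?_
      exact mul_le_mul_of_nonneg_left (hb j _) (norm_nonneg _)
    have := (hfreeze (4 * Real.pi * c * j)).add hsecond
    rw [add_zero] at this
    refine this.congr fun x => ?_
    rw [limitTerm, if_neg hj]
    ring

/-- Away from zero momentum the packet and its mirror image do not interfere. -/
theorem tendsto_cross_of_momentum (hl : 0 < l) (hh : Tendsto h G (𝓝[>] 0))
    (hα : Tendsto α G (𝓝[>] 0)) (hhα : Tendsto (fun x => h x / α x) G (𝓝 0))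
    {δ : ℝ} (hδ : 0 < δ) (hz : ∀ᶠ x in G, δ ≤ |(z x).2|) (σ : BoxTest l) (j : ℤ) (ν : ℝ)
    (x₀ θ : X → ℝ) :
    Tendsto (fun x => crossCoef (h x) (α x) l c ν (z x) j *
      waveSum (h x) (α x) l σ j (x₀ x) (θ x)) G (𝓝 0) := by
  obtain ⟨C, hC, hw⟩ := exists_waveSum_bound hl
  obtain ⟨b, -, hb⟩ := σ.exists_stripCoeff_bound hl
  have hh0 : ∀ᶠ x in G, 0 < h x := hh.eventually self_mem_nhdsWithin
  have hα0 : ∀ᶠ x in G, 0 < α x := hα.eventually self_mem_nhdsWithin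
  have h1 : Tendsto (fun x => δ * (h x / α x)⁻¹) G atTop := by
    refine Tendsto.const_mul_atTop hδ (Tendsto.inv_tendsto_nhdsGT_zero ?_)
    refine tendsto_nhdsWithin_iff.2 ⟨hhα, ?_⟩
    filter_upwards [hh0, hα0] with x hx hx'
    exact div_pos hx hx'
  have h2 : Tendsto (fun x => Real.exp (-(δ * (h x / α x)⁻¹) ^ 2) * (b j * C)) G (𝓝 0) := by
    have := Real.tendsto_exp_neg_atTop_nhds_zero.comp ((tendsto_pow_atTop two_ne_zero).comp h1)
    simpa using this.mul_const (b j * C)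
  refine squeeze_zero_norm' ?_ h2
  filter_upwards [hh0, hα0, eventually_width_le hl hα, hz] with x hx hx' hx1 hxz
  rw [norm_mul]
  refine mul_le_mul ((norm_crossCoef_le _ _ _ _ _ _ _).trans (Real.exp_le_exp.2 ?_))
    (hw _ _ _ _ _ σ j hx hx' hx1 (hb j)) (norm_nonneg _) (Real.exp_pos _).le
  rw [neg_le_neg_iff, ← sq_abs (α x * _), abs_mul, abs_div, abs_of_pos hx, abs_of_pos hx']
  have h3 : δ * (h x / α x)⁻¹ ≤ α x * (|(z x).2| / h x) := by
    rw [inv_div, mul_div_assoc', mul_div_assoc', mul_comm]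
    gcongr
  gcongr

/-- Away from the walls the interference term oscillates in `k`, so that it vanishes in the limit
if the quadratic phases play no role. -/
theorem tendsto_cross_of_position (hl : 0 < l) (hh : Tendsto h G (𝓝[>] 0))
    (hα : Tendsto α G (𝓝[>] 0)) (hhα : Tendsto (fun x => h x / α x) G (𝓝 0))
    (hs : Tendsto (fun x => h x * s x) G (𝓝 0)) {δ : ℝ} (hδ : 0 < δ)
    (hz : ∀ᶠ x in G, |(z x).1| ≤ l - δ) (σ : BoxTest l) (j : ℤ) :
    Tendsto (fun x => crossCoef (h x) (α x) l c 0 (z x) j *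
      waveSum (h x) (α x) l σ j (j / 2) (Real.pi / l * ((z x).1 + l) -
        (0 + h x * s x / m * boxWave l j * (Real.pi / (2 * l))))) G (𝓝 0) := by
  have hp := Real.pi_pos
  obtain ⟨C, hC, hfr⟩ := exists_waveSum_freeze hl σ
  have hh0 : ∀ᶠ x in G, 0 < h x := hh.eventually self_mem_nhdsWithin
  have hα0 : ∀ᶠ x in G, 0 < α x := hα.eventually self_mem_nhdsWithin
  have hph := (tendsto_phase (m := m) (l := l) hs j).abs
  rw [abs_zero] at hph
  have hη : 0 < Real.pi * δ / (2 * l) := by positivity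
  have hsmall := hph.eventually_le_const hη
  have hrange : ∀ᶠ x in G, Real.pi * δ / (2 * l) ≤ Real.pi / l * ((z x).1 + l) -
        (0 + h x * s x / m * boxWave l j * (Real.pi / (2 * l))) ∧
      Real.pi / l * ((z x).1 + l) - (0 + h x * s x / m * boxWave l j * (Real.pi / (2 * l))) ≤
        2 * Real.pi - Real.pi * δ / (2 * l) := by
    filter_upwards [hsmall, hz] with x hx hxz
    have a1 := abs_le.1 hx
    have a2 := abs_le.1 hxz
    have a3 : Real.pi / l * δ ≤ Real.pi / l * ((z x).1 + l) := by
      gcongr; linarith [a2.1]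
    have a4 : Real.pi / l * ((z x).1 + l) ≤ Real.pi / l * (2 * l - δ) := by
      gcongr; linarith [a2.2]
    have a5 : Real.pi / l * δ = 2 * (Real.pi * δ / (2 * l)) := by field_simp
    have a6 : Real.pi / l * (2 * l - δ) = 2 * Real.pi - 2 * (Real.pi * δ / (2 * l)) := by
      field_simp
    constructor <;> linarith [a1.1, a1.2]
  have ht : Tendsto (fun x => thetaSum (α x * (Real.pi / (2 * l))) (j / 2)
      (Real.pi / l * ((z x).1 + l) -
        (0 + h x * s x / m * boxWave l j * (Real.pi / (2 * l))))) G (𝓝 0) := by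
    refine tendsto_thetaSum_zero (x₀ := fun _ => (j : ℝ) / 2) (tendsto_width hl hα)
      (R := 2 * Real.pi) ?_ fun n => ⟨Real.pi * δ / (2 * l), hη, ?_⟩
    · filter_upwards [hrange] with x hx
      rw [abs_le]; constructor <;> linarith [hx.1, hx.2]
    · filter_upwards [hrange] with x hx
      rcases le_or_gt n 0 with hn | hn
      · have : (n : ℝ) ≤ 0 := by exact_mod_cast hn
        refine le_trans ?_ (le_abs_self _)
        nlinarith [hx.1]
      · have : (1 : ℝ) ≤ n := by exact_mod_cast hn
        refine le_trans ?_ (neg_le_abs _)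
        nlinarith [hx.2]
  have h1 : Tendsto (fun x => h x / α x * C) G (𝓝 0) := by simpa using hhα.mul_const C
  have h2 := ht.norm.mul_const ‖stripCoeff l σ j 0‖
  rw [norm_zero, zero_mul] at h2
  have h3 := h1.add h2
  rw [add_zero] at h3
  refine squeeze_zero_norm' ?_ h3
  filter_upwards [hh0, hα0, eventually_width_le hl hα] with x hx hx' hx1
  have h4 := hfr (h x) (α x) 0 (Real.pi / l * ((z x).1 + l) -
        (0 + h x * s x / m * boxWave l j * (Real.pi / (2 * l)))) j hx hx' hx1
  simp only [zero_mul, add_zero, mul_zero] at h4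
  rw [norm_mul]
  refine (mul_le_of_le_one_left (norm_nonneg _) (norm_crossCoef_le_one _ _ _ _ _ _ _)).trans ?_
  have h5 := norm_sub_norm_le (waveSum (h x) (α x) l σ j (j / 2) (Real.pi / l * ((z x).1 + l) -
        (0 + h x * s x / m * boxWave l j * (Real.pi / (2 * l)))))
    (thetaSum (α x * (Real.pi / (2 * l))) (j / 2) (Real.pi / l * ((z x).1 + l) -
        (0 + h x * s x / m * boxWave l j * (Real.pi / (2 * l)))) * stripCoeff l σ j 0)
  rw [norm_mul] at h5
  linarith

/-- The semiclassical limit of the transition density tested against `σ`, along an arbitrary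
filter on which the phase point `z` may vary. -/
theorem tendsto_integral_sub_limitTerm (hl : 0 < l) (hm : 0 < m) (hh : Tendsto h G (𝓝[>] 0))
    (hα : Tendsto α G (𝓝[>] 0)) (hhα : Tendsto (fun x => h x / α x) G (𝓝 0))
    (hD : Tendsto (fun x => ((h x / α x * s x : ℝ) : EReal)) G
      (𝓝 (((2 * m : ℝ) : EReal) * (D : EReal))))
    (hs : Tendsto (fun x => h x * s x) G (𝓝 0)) (σ : BoxTest l) {δ : ℝ} (hδ : 0 < δ)
    (hz : (∀ᶠ x in G, δ ≤ |(z x).2|) ∨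
      (∃ n : ℤ, 2 * c = n) ∧ ∀ᶠ x in G, |(z x).1| ≤ l - δ) :
    Tendsto (fun x => ((∫ z' in phaseStrip l, transitionDensity (h x) (α x) m l
      (c * boxRevivalTime (h x) m l + s x) (z x) z' * σ z' : ℝ) : ℂ) -
      ∑' j : ℤ, limitTerm l m c D (s x) (z x) σ j) G (𝓝 0) := by
  have hp := Real.pi_pos
  have hh0 : ∀ᶠ x in G, 0 < h x := hh.eventually self_mem_nhdsWithin
  have hα0 : ∀ᶠ x in G, 0 < α x := hα.eventually self_mem_nhdsWithin
  obtain ⟨C, hC, hw⟩ := exists_waveSum_bound hl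
  obtain ⟨b, hbs, hb⟩ := σ.exists_stripCoeff_bound hl
  have hb0 : ∀ j, 0 ≤ b j := fun j => (norm_nonneg _).trans (hb j 0)
  have hdir := fun j => tendsto_direct (z := z) (c := c) hl hm hh hα hhα hD hs σ j
  choose ν hν hν0 hdir using hdir
  have hcross : ∀ j, Tendsto (fun x => crossCoef (h x) (α x) l c (ν j) (z x) j *
      waveSum (h x) (α x) l σ j (j / 2) (Real.pi / l * ((z x).1 + l) -
        (ν j + h x * s x / m * boxWave l j * (Real.pi / (2 * l))))) G (𝓝 0) := by
    intro j
    rcases hz with hz | ⟨⟨n, hn⟩, hz⟩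
    · exact tendsto_cross_of_momentum hl hh hα hhα hδ hz σ j (ν j) _ _
    · rw [hν0 j ⟨n * j, by rw [hn]; push_cast; rfl⟩]
      exact tendsto_cross_of_position hl hh hα hhα hs hδ hz σ j
  set τ : X → ℤ → ℂ := fun x j =>
    (Real.sqrt (2 / Real.pi) * (α x * (Real.pi / (2 * l))) : ℝ) *
        ∑' k : ℤ, pairTerm (h x) (α x) m l (c * boxRevivalTime (h x) m l + s x) (z x) σ j k with hτ
  have hτe : ∀ᶠ x in G, ∀ j, τ x j = directCoef (h x) (α x) m l c (ν j) (s x) (z x) j *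
      waveSum (h x) (α x) l σ j (j / 2 + (z x).2 / h x * (2 * l / Real.pi))
        (-(ν j + h x * s x / m * boxWave l j * (Real.pi / (2 * l)))) -
      crossCoef (h x) (α x) l c (ν j) (z x) j * waveSum (h x) (α x) l σ j (j / 2)
        (Real.pi / l * ((z x).1 + l) - (ν j + h x * s x / m * boxWave l j *
          (Real.pi / (2 * l)))) := by
    filter_upwards [hh0, hα0] with x hx hx' j
    exact tsum_pairTerm_eq hx hx' hm hl c (s x) (ν j) (z x) σ j (hν j)
  have hτb : ∀ᶠ x in G, ∀ j, ‖τ x j‖ ≤ 2 * C * b j := by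
    filter_upwards [hτe, hh0, hα0, eventually_width_le hl hα] with x hx hx1 hx2 hx3 j
    rw [hx j]
    refine (norm_sub_le _ _).trans ?_
    have a1 : ∀ x₀ θ, ‖waveSum (h x) (α x) l σ j x₀ θ‖ ≤ b j * C := fun x₀ θ =>
      hw _ _ x₀ θ _ σ j hx1 hx2 hx3 (hb j)
    rw [norm_mul, norm_mul]
    have a2 := (mul_le_of_le_one_left (norm_nonneg (waveSum (h x) (α x) l σ j
      (j / 2 + (z x).2 / h x * (2 * l / Real.pi))
        (-(ν j + h x * s x / m * boxWave l j * (Real.pi / (2 * l))))))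
      (norm_directCoef_le_one (h x) (α x) m l c (ν j) (s x) (z x) j)).trans (a1 _ _)
    have a3 := (mul_le_of_le_one_left (norm_nonneg (waveSum (h x) (α x) l σ j (j / 2)
        (Real.pi / l * ((z x).1 + l) - (ν j + h x * s x / m * boxWave l j *
          (Real.pi / (2 * l))))))
      (norm_crossCoef_le_one (h x) (α x) l c (ν j) (z x) j)).trans (a1 _ _)
    linarith
  have hlb : ∀ x j, ‖limitTerm l m c D (s x) (z x) σ j‖ ≤ b j := fun x j =>
    (norm_limitTerm_le l m c D (s x) (z x) σ j).trans (hb j _)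
  have hT : Tendsto (fun x => ∑' j : ℤ, (τ x j - limitTerm l m c D (s x) (z x) σ j)) G
      (𝓝 (∑' _ : ℤ, (0 : ℂ))) := by
    refine tendsto_tsum_of_dominated_convergence (hbs.mul_left (2 * C + 1)) (fun j => ?_) ?_
    · have h1 := (hdir j).sub (hcross j)
      rw [sub_zero] at h1
      refine h1.congr' ?_
      filter_upwards [hτe] with x hx
      rw [hx j]; ring
    · filter_upwards [hτb] with x hx j
      refine (norm_sub_le _ _).trans ?_
      linarith [hx j, hlb x j]
  rw [tsum_zero] at hT
  refine hT.congr' ?_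
  filter_upwards [hh0, hα0, hτb] with x hx hx' hxb
  rw [integral_transitionDensity_mul hx hx' hm hl, Summable.tsum_sub]
  · exact Summable.of_norm_bounded (hbs.mul_left (2 * C)) hxb
  · exact Summable.of_norm_bounded hbs (hlb x)

end Limits

/-! ### The limiting distributions as Fourier series -/

/-- A test function is the sum of its Fourier series in the position variable. -/
theorem BoxTest.hasSum_stripCoeff {l : ℝ} (hl : 0 < l) (σ : BoxTest l) (x p : ℝ) :
    HasSum (fun j : ℤ => Complex.exp ((boxWave l j * (x + l) : ℝ) * Complex.I) *
      stripCoeff l σ j p) (σ (x, p)) := by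
  have hT : 0 < 4 * l := by positivity
  have : Fact (0 < 4 * l) := ⟨hT⟩
  have hl' : (l : ℂ) ≠ 0 := by exact_mod_cast hl.ne'
  have hper : Function.Periodic (fun y : ℝ => (σ (y - l, p) : ℂ)) (4 * l) := fun y => by
    simp only
    rw [← σ.map_add_period (y - l) p]
    congr 3; ring
  have hcont : Continuous (hper.lift : AddCircle (4 * l) → ℂ) :=
    continuous_coinduced_dom.2 (by
      have := σ.continuous
      change Continuous fun y : ℝ => (σ (y - l, p) : ℂ)
      fun_prop)
  set f : C(AddCircle (4 * l), ℂ) := ⟨hper.lift, hcont⟩ with hf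
  have hfy : ∀ y : ℝ, f (y : AddCircle (4 * l)) = σ (y - l, p) := fun y => hper.lift_coe y
  have hcoef : ∀ j, fourierCoeff f j = stripCoeff l σ j p := fun j => by
    have h1 := intervalIntegral.integral_comp_add_right (a := -(3 * l)) (b := l)
      (fun y : ℝ => @fourier (4 * l) (-j) (y : AddCircle (4 * l)) • f (y : AddCircle (4 * l))) l
    rw [fourierCoeff_eq_intervalIntegral f j (-(3 * l) + l),
      show -(3 * l) + l + 4 * l = l + l by ring, ← h1, stripCoeff, Complex.real_smul]
    congr 1
    · push_cast; ring
    · congr 1; funext x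
      rw [hfy, fourier_coe_apply, smul_eq_mul, add_sub_cancel_right]
      congr 2
      rw [boxWave]; push_cast; field_simp; ring
  obtain ⟨b, hb, hb'⟩ := σ.exists_stripCoeff_bound hl
  have hs : Summable (fourierCoeff f) :=
    Summable.of_norm_bounded hb fun j => by rw [hcoef]; exact hb' j p
  have h := has_pointwise_sum_fourier_series_of_summable hs ((x + l : ℝ) : AddCircle (4 * l))
  rw [hfy, add_sub_cancel_right] at h
  refine h.congr_fun fun j => ?_
  rw [hcoef, fourier_coe_apply, smul_eq_mul, mul_comm]
  congr 2
  rw [boxWave]; push_cast; field_simp; ring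

open ProbabilityTheory in
/-- A packet of finite width is the expectation of the test function under a normal law. -/
theorem spreadPacket_eq_integral_gaussianReal {l : ℝ} {D : ℝ≥0∞} (hD : D ≠ ⊤) (b p : ℝ)
    (σ : BoxTest l) :
    spreadPacket l D b p σ = ∫ x, σ (x, p) ∂(gaussianReal b (D.toNNReal ^ 2)) := by
  unfold spreadPacket
  split_ifs with h0
  · simp [h0, gaussianReal_zero_var]
  · have hv : D.toNNReal ^ 2 ≠ 0 := pow_ne_zero _ (ENNReal.toNNReal_ne_zero.2 ⟨h0, hD⟩)
    rw [integral_gaussianReal_eq_integral_smul hv]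
    congr 1; funext x
    rw [gaussianPDFReal, spreadGaussian, smul_eq_mul, one_div]
    norm_cast

open ProbabilityTheory in
/-- The Fourier series is integrated term by term; the factor `spreadDamping` is the characteristic
function of the normal law. -/
theorem hasSum_spreadPacket_of_ne_top {l : ℝ} (hl : 0 < l) {D : ℝ≥0∞} (hD : D ≠ ⊤) (b p : ℝ)
    (σ : BoxTest l) :
    HasSum (fun j : ℤ => Complex.exp ((boxWave l j * (b + l) : ℝ) * Complex.I) *
      spreadDamping l D j * stripCoeff l σ j p) (spreadPacket l D b p σ) := by
  set μ := gaussianReal b (D.toNNReal ^ 2) with hμ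
  obtain ⟨B, hB, hB'⟩ := σ.exists_stripCoeff_bound hl
  set F : ℤ → ℝ → ℂ := fun j x =>
    Complex.exp ((boxWave l j * (x + l) : ℝ) * Complex.I) * stripCoeff l σ j p with hF
  have hFn : ∀ j x, ‖F j x‖ = ‖stripCoeff l σ j p‖ := fun j x => by
    rw [hF]; simp only; rw [norm_mul, Complex.norm_exp_ofReal_mul_I, one_mul]
  have hFi : ∀ j, Integrable (F j) μ := fun j =>
    Integrable.of_bound (C := ‖stripCoeff l σ j p‖)
      (Continuous.aestronglyMeasurable (by fun_prop))
      (Eventually.of_forall fun x => (hFn j x).le)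
  have hs : Summable fun j => ∫ x, ‖F j x‖ ∂μ := by
    refine Summable.of_nonneg_of_le (fun j => integral_nonneg fun _ => norm_nonneg _)
      (fun j => ?_) hB
    simp only [hFn, integral_const, probReal_univ, one_smul]
    exact hB' j p
  have h := hasSum_integral_of_summable_integral_norm hFi hs
  have e : ∫ x, ∑' j, F j x ∂μ = (spreadPacket l D b p σ : ℂ) := by
    rw [spreadPacket_eq_integral_gaussianReal hD, ← integral_complex_ofReal]
    congr 1; funext x
    exact (σ.hasSum_stripCoeff hl x p).tsum_eq
  rw [e] at h
  refine h.congr_fun fun j => ?_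
  have hchar := charFun_gaussianReal (μ := b) (v := D.toNNReal ^ 2) (boxWave l j)
  rw [charFun_apply_real] at hchar
  have e1 : ∀ x : ℝ, F j x = Complex.exp ((boxWave l j * l : ℝ) * Complex.I) *
      stripCoeff l σ j p * Complex.exp (boxWave l j * x * Complex.I) := fun x => by
    rw [hF]; simp only
    rw [mul_right_comm, ← Complex.exp_add]
    congr 2; push_cast; ring
  simp only [e1]
  rw [integral_const_mul, hchar, mul_right_comm _ (stripCoeff l σ j p)]
  congr 1
  have hd : (spreadDamping l D j : ℂ) =
      Complex.exp (-(boxWave l j * D.toReal : ℝ) ^ 2 / 2) := by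
    rw [spreadDamping, if_neg hD]
    split_ifs with hj
    · simp [hj, boxWave]
    · push_cast; rfl
  rw [hd, ← Complex.exp_add, ← Complex.exp_add]
  congr 1
  have : ((D.toNNReal ^ 2 : NNReal) : ℂ) = (D.toReal : ℂ) ^ 2 := by
    rw [ENNReal.toReal]; push_cast; rfl
  push_cast
  ring

/-- The zeroth Fourier coefficient is the mean over a period of length `4l`, which by the reflection
symmetry is the pairing with `(1/4l) [δ(p' - p) + δ(p' + p)]`. -/
theorem stripCoeff_zero_eq {l : ℝ} (σ : BoxTest l) (b p : ℝ) :
    stripCoeff l σ 0 p = (spreadPacket l ⊤ b p σ : ℂ) := by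
  have hc := σ.continuous
  have hci : ∀ (q a a' : ℝ), IntervalIntegrable (fun x => σ (x, q)) volume a a' :=
    fun q a a' => Continuous.intervalIntegrable (by fun_prop) _ _
  have h1 : (∫ x in (-(3 * l))..l, σ (x, p)) =
      (∫ x in (-l)..l, σ (x, p)) + ∫ x in (-l)..l, σ (x, -p) := by
    rw [← intervalIntegral.integral_add_adjacent_intervals (hci p _ (-l)) (hci p (-l) _), add_comm]
    congr 1
    have h2 := intervalIntegral.integral_comp_sub_left (a := -l) (b := l)
      (fun x => σ (x, p)) (-(2 * l))
    rw [show -(2 * l) - l = -(3 * l) by ring, show -(2 * l) - -l = -l by ring] at h2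
    rw [← h2]
    congr 1; funext x
    have := σ.map_reflect x (-p)
    rw [neg_neg] at this
    rw [← this]
    congr 2; ring
  rw [stripCoeff, spreadPacket, if_neg ENNReal.top_ne_zero, if_pos rfl, ← mul_add, ← h1,
    Complex.ofReal_mul, ← intervalIntegral.integral_ofReal]
  congr 1
  · push_cast; ring
  · congr 1; funext x
    simp [boxWave]

/-- The Fourier series of a packet. -/
theorem hasSum_spreadPacket {l : ℝ} (hl : 0 < l) (D : ℝ≥0∞) (b p : ℝ) (σ : BoxTest l) :
    HasSum (fun j : ℤ => Complex.exp ((boxWave l j * (b + l) : ℝ) * Complex.I) *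
      spreadDamping l D j * stripCoeff l σ j p) (spreadPacket l D b p σ) := by
  by_cases hD : D = ⊤
  · subst hD
    rw [← stripCoeff_zero_eq σ b p]
    convert hasSum_single (0 : ℤ) (fun j hj => ?_) using 1
    · simp [boxWave, spreadDamping]
    · simp [spreadDamping, hj]
  · exact hasSum_spreadPacket_of_ne_top hl hD b p σ

theorem packetCount_pos {N : ℕ} (hN : 0 < N) : 0 < packetCount N := by
  unfold packetCount
  split_ifs with h
  · obtain ⟨k, rfl⟩ := h
    omega
  · exact hN

/-- `c = M / N` in lowest terms: `2 c j` is an integer exactly for the multiples `j` of `N'`. -/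
theorem exists_two_mul_eq_int_iff (r : ℚ) (j : ℤ) :
    (∃ n : ℤ, 2 * (r : ℝ) * j = n) ↔ (packetCount r.den : ℤ) ∣ j := by
  have hN : (r.den : ℝ) ≠ 0 := by exact_mod_cast r.den_nz
  have hr : (r : ℝ) = r.num / r.den := by exact_mod_cast (Rat.num_div_den r).symm
  have hco : IsCoprime (r.den : ℤ) r.num := by
    rw [Int.isCoprime_iff_gcd_eq_one, Int.gcd_comm]
    exact r.reduced
  have h1 : (∃ n : ℤ, 2 * (r : ℝ) * j = n) ↔ (r.den : ℤ) ∣ 2 * j := by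
    rw [show (r.den : ℤ) ∣ 2 * j ↔ (r.den : ℤ) ∣ r.num * (2 * j) from
      ⟨fun h => h.mul_left _, hco.dvd_of_dvd_mul_left⟩]
    constructor
    · rintro ⟨n, hn⟩
      refine ⟨n, ?_⟩
      rw [hr] at hn
      field_simp at hn
      have : ((r.num * (2 * j) : ℤ) : ℝ) = (r.den * n : ℤ) := by push_cast; linarith
      exact_mod_cast this
    · rintro ⟨n, hn⟩
      refine ⟨n, ?_⟩
      have : ((r.num * (2 * j) : ℤ) : ℝ) = (r.den * n : ℤ) := by rw [hn]
      push_cast at this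
      rw [hr]; field_simp; linarith
  rw [h1, packetCount]
  split_ifs with he
  · obtain ⟨k, hk⟩ := even_iff_two_dvd.1 he
    rw [hk, Nat.mul_div_cancel_left _ two_pos]
    push_cast
    exact mul_dvd_mul_iff_left two_ne_zero
  · have : IsCoprime (r.den : ℤ) 2 := by
      rw [Int.isCoprime_iff_gcd_eq_one]
      exact (Nat.not_even_iff_odd.1 he).coprime_two_right
    exact ⟨this.dvd_of_dvd_mul_left, fun h => h.mul_left _⟩

/-- Averaging over `K` equally spaced translates keeps only the Fourier coefficients whose index
is a multiple of `K`. -/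
theorem sum_exp_boxWave_translates {l : ℝ} (hl : 0 < l) {K : ℕ} (hK : 0 < K) (j : ℤ) :
    ∑ k ∈ Finset.range K, Complex.exp ((boxWave l j * (4 * k * l / K) : ℝ) * Complex.I) =
      if (K : ℤ) ∣ j then (K : ℂ) else 0 := by
  have hl' : (l : ℂ) ≠ 0 := by exact_mod_cast hl.ne'
  have hK' : (K : ℂ) ≠ 0 := by exact_mod_cast hK.ne'
  have hζ := Complex.isPrimitiveRoot_exp K hK.ne'
  set w := Complex.exp (2 * Real.pi * Complex.I / K) ^ j with hw
  have e : ∀ k : ℕ, Complex.exp ((boxWave l j * (4 * k * l / K) : ℝ) * Complex.I) = w ^ k :=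
    fun k => by
      rw [hw, ← zpow_natCast, ← zpow_mul, ← Complex.exp_int_mul]
      congr 1
      rw [boxWave]; push_cast; field_simp; ring
  simp only [e]
  split_ifs with h
  · have : w = 1 := (hζ.zpow_eq_one_iff_dvd j).2 h
    simp [this]
  · have h1 : w ≠ 1 := fun h' => h ((hζ.zpow_eq_one_iff_dvd j).1 h')
    rw [geom_sum_eq h1, hw, ← zpow_natCast, zpow_comm, zpow_natCast, hζ.pow_eq_one]
    simp

/-- On the multiples of `N'` the quadratic phase `2π c j²` is the linear phase of the shift `a`. -/
theorem exp_boxWave_packetShift {l : ℝ} (hl : 0 < l) (r : ℚ) {j : ℤ}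
    (hj : (packetCount r.den : ℤ) ∣ j) :
    Complex.exp ((boxWave l j * packetShift l r.den : ℝ) * Complex.I) =
      Complex.exp ((2 * Real.pi * r * j ^ 2 : ℝ) * Complex.I) := by
  have hN : (r.den : ℝ) ≠ 0 := by exact_mod_cast r.den_nz
  have hr : (r : ℝ) = r.num / r.den := by exact_mod_cast (Rat.num_div_den r).symm
  obtain ⟨i, rfl⟩ := hj
  suffices h : ∃ n : ℤ, 2 * Real.pi * r * ((packetCount r.den * i : ℤ) : ℝ) ^ 2 =
      boxWave l (packetCount r.den * i) * packetShift l r.den + n * (2 * Real.pi) by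
    obtain ⟨n, hn⟩ := h
    rw [hn, Complex.exp_eq_exp_iff_exists_int]
    exact ⟨-n, by push_cast; ring⟩
  rw [hr]
  rcases Nat.even_or_odd r.den with he | ho
  · by_cases h4 : r.den % 4 = 2
    · have hno : ¬ Even r.num := fun h => by
        have h1 : 2 ∣ r.num.natAbs := Int.natCast_dvd.1 (by exact_mod_cast even_iff_two_dvd.1 h)
        have h2 := Nat.dvd_gcd h1 (even_iff_two_dvd.1 he)
        rw [r.reduced.gcd_eq_one] at h2
        omega
      have hKo : ¬ Even ((packetCount r.den : ℕ) : ℤ) := by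
        rw [packetCount, if_pos he, Int.even_coe_nat, Nat.even_iff]
        omega
      have hK2 : r.den = 2 * packetCount r.den := by
        rw [packetCount, if_pos he]; omega
      have hev : Even (r.num * packetCount r.den * i ^ 2 - i) := by
        simp [Int.even_sub, Int.even_mul, Int.even_pow, hno, hKo]
      obtain ⟨n, hn⟩ := even_iff_two_dvd.1 hev
      refine ⟨n, ?_⟩
      have hn' : (r.num : ℝ) * packetCount r.den * i ^ 2 - i = 2 * n := by exact_mod_cast hn
      have hNK : (r.den : ℝ) = 2 * packetCount r.den := by exact_mod_cast hK2
      have hK0 : (packetCount r.den : ℝ) ≠ 0 := fun h0 => hN (by rw [hNK, h0, mul_zero])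
      rw [packetShift, if_pos h4, boxWave, hNK]
      push_cast
      field_simp
      linear_combination 4 * hn'
    · obtain ⟨M, hM⟩ : ∃ M, r.den = 4 * M := by
        obtain ⟨k, hk⟩ := he
        exact ⟨r.den / 4, by omega⟩
      have hK : packetCount r.den = 2 * M := by
        rw [packetCount, if_pos he]; omega
      refine ⟨r.num * M * i ^ 2, ?_⟩
      have hM0 : (M : ℝ) ≠ 0 := fun h0 => hN (by rw [hM]; push_cast; rw [h0, mul_zero])
      rw [packetShift, if_neg h4, hK, hM]
      push_cast
      field_simp
      ring
  · have h4 : r.den % 4 ≠ 2 := by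
      obtain ⟨k, hk⟩ := ho; omega
    refine ⟨r.num * r.den * i ^ 2, ?_⟩
    rw [packetShift, if_neg h4, packetCount, if_neg (Nat.not_even_iff_odd.2 ho)]
    push_cast
    field_simp
    ring

/-- The limiting distribution is given by the resonant Fourier coefficients. -/
theorem hasSum_limitTerm {l : ℝ} (hl : 0 < l) (m c : ℝ) (D : ℝ≥0∞) (s : ℝ) (z : ℝ × ℝ)
    (σ : BoxTest l) :
    HasSum (limitTerm l m c D s z σ) (limitPairing l m c D s z σ) := by
  by_cases hc : ∃ r : ℚ, (r : ℝ) = c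
  · rw [limitPairing, dif_pos hc]
    have hr := hc.choose_spec
    set r := hc.choose
    set K := packetCount r.den with hK
    have hK0 : 0 < K := packetCount_pos r.den_pos
    have hK' : (K : ℂ) ≠ 0 := by exact_mod_cast hK0.ne'
    have h1 := (hasSum_sum (s := Finset.range K) fun k _ => hasSum_spreadPacket hl D
      (z.1 + 4 * k * l / K + packetShift l r.den - z.2 / m * s) z.2 σ).mul_left (1 / (K : ℂ))
    have e0 : ((1 / (K : ℝ) * ∑ k ∈ Finset.range K, spreadPacket l D
        (z.1 + 4 * k * l / K + packetShift l r.den - z.2 / m * s) z.2 σ : ℝ) : ℂ) =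
        1 / (K : ℂ) * ∑ k ∈ Finset.range K, (spreadPacket l D
          (z.1 + 4 * k * l / K + packetShift l r.den - z.2 / m * s) z.2 σ : ℂ) := by
      push_cast; rfl
    rw [e0]
    refine h1.congr_fun fun j => ?_
    have e : ∀ k : ℕ, Complex.exp ((boxWave l j *
        (z.1 + 4 * k * l / K + packetShift l r.den - z.2 / m * s + l) : ℝ) * Complex.I) *
        spreadDamping l D j * stripCoeff l σ j z.2 =
        Complex.exp ((boxWave l j * (4 * k * l / K) : ℝ) * Complex.I) *
        (Complex.exp ((boxWave l j * (z.1 + l - z.2 / m * s) : ℝ) * Complex.I) *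
          Complex.exp ((boxWave l j * packetShift l r.den : ℝ) * Complex.I) *
          spreadDamping l D j * stripCoeff l σ j z.2) := fun k => by
      rw [← mul_assoc, ← mul_assoc, ← mul_assoc, ← Complex.exp_add, ← Complex.exp_add]
      congr 3; push_cast; ring
    simp only [e]
    rw [← Finset.sum_mul, sum_exp_boxWave_translates hl hK0, limitTerm, ← hr]
    simp only [exists_two_mul_eq_int_iff]
    split_ifs with hj
    · rw [exp_boxWave_packetShift hl r hj, ← Complex.exp_add, ← mul_assoc, one_div,
        inv_mul_cancel₀ hK', one_mul]
      congr 3; push_cast; ring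
    · simp
  · rw [limitPairing, dif_neg hc]
    refine (hasSum_spreadPacket hl ⊤ 0 z.2 σ).congr_fun fun j => ?_
    by_cases hj : j = 0
    · subst hj
      rw [limitTerm, if_pos ⟨0, by simp⟩]
      simp [boxWave, spreadDamping]
    · have hj' : (j : ℝ) ≠ 0 := by exact_mod_cast hj
      rw [limitTerm, if_neg]
      · simp [spreadDamping, hj]
      · rintro ⟨n, hn⟩
        refine hc ⟨n / (2 * j), ?_⟩
        push_cast
        field_simp
        linarith

/-! ### Continuous functionals on the test space -/

theorem BoxTest.weight_mul_abs_le {l : ℝ} (σ : BoxTest l) (z : ℝ × ℝ) :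
    (1 + z.2 ^ 2) * |σ z| ≤ boxSeminorm l 2 σ := by
  have h1 : boxSeminormAux l 2 0 0 ≤ boxSeminorm l 2 := by
    refine Finset.le_sup (f := fun s : ℕ × ℕ => boxSeminormAux l 2 s.1 s.2) (b := (0, 0)) ?_
    simp
  have h2 := le_ciSup (bddAbove_boxTest 2 0 0 σ) z
  refine le_trans (le_of_eq ?_) (h2.trans (h1 σ))
  norm_num [mixedDeriv]

/-- Integration against a density that is integrable with the weight `(1 + p²)⁻¹` is a continuous
functional on `𝒮(Ω)`. -/
theorem exists_boxDistribution_of_density {l : ℝ} {μ : Measure (ℝ × ℝ)} {w : ℝ × ℝ → ℝ}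
    (hw : Integrable (fun z => w z * (1 + z.2 ^ 2)⁻¹) μ) :
    ∃ Λ : BoxDistribution l, ∀ σ : BoxTest l,
      Integrable (fun z => w z * σ z) μ ∧ Λ σ = ∫ z, w z * σ z ∂μ := by
  have e : ∀ (σ : BoxTest l) (z : ℝ × ℝ),
      w z * σ z = w z * (1 + z.2 ^ 2)⁻¹ * ((1 + z.2 ^ 2) * σ z) := fun σ z => by
    have : (1 + z.2 ^ 2) ≠ 0 := by positivity
    field_simp
  have hb : ∀ (σ : BoxTest l) (z : ℝ × ℝ), ‖(1 + z.2 ^ 2) * σ z‖ ≤ boxSeminorm l 2 σ :=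
    fun σ z => by
      rw [norm_mul, Real.norm_of_nonneg (by positivity)]
      exact σ.weight_mul_abs_le z
  have hi : ∀ σ : BoxTest l, Integrable (fun z => w z * σ z) μ := fun σ => by
    simp only [e σ]
    have := σ.continuous
    exact hw.mul_bdd (c := boxSeminorm l 2 σ)
      (Continuous.aestronglyMeasurable (by fun_prop)) (Eventually.of_forall (hb σ))
  let f : BoxTest l →ₗ[ℝ] ℝ :=
    { toFun := fun σ => ∫ z, w z * σ z ∂μ
      map_add' := fun σ τ => by
        rw [← integral_add (hi σ) (hi τ)]
        congr 1; funext z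
        rw [BoxTest.coe_add, Pi.add_apply, mul_add]
      map_smul' := fun a σ => by
        rw [RingHom.id_apply, smul_eq_mul, ← integral_const_mul]
        congr 1; funext z
        rw [BoxTest.coe_smul, Pi.smul_apply, smul_eq_mul]; ring }
  have hc : Continuous f := by
    refine WithSeminorms.continuous_real_rng (p := boxSeminorm l) ⟨rfl⟩ f ⟨{2},
      (∫ z, ‖w z * (1 + z.2 ^ 2)⁻¹‖ ∂μ).toNNReal, fun σ => ?_⟩
    rw [Finset.sup_singleton, _root_.smul_apply, NNReal.smul_def,
      Real.coe_toNNReal _ (integral_nonneg fun _ => norm_nonneg _), smul_eq_mul,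
      ← integral_mul_const]
    refine (le_abs_self _).trans
      ((norm_integral_le_integral_norm (fun z => w z * σ z)).trans ?_)
    refine integral_mono (hi σ).norm (hw.norm.mul_const _) fun z => ?_
    simp only
    rw [e σ, norm_mul]
    exact mul_le_mul_of_nonneg_left (hb σ z) (norm_nonneg _)
  exact ⟨⟨f, hc⟩, fun σ => ⟨hi σ, rfl⟩⟩

theorem integrable_weight_of_finite (μ : Measure (ℝ × ℝ)) [IsFiniteMeasure μ] :
    Integrable (fun z : ℝ × ℝ => (1 : ℝ) * (1 + z.2 ^ 2)⁻¹) μ := by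
  refine Integrable.of_bound (C := 1) (Continuous.aestronglyMeasurable ?_)
    (Eventually.of_forall fun z => ?_)
  · exact continuous_const.mul (Continuous.inv₀ (by fun_prop) fun z => by positivity)
  · have h : (1 : ℝ) ≤ 1 + z.2 ^ 2 := by linarith [sq_nonneg z.2]
    rw [one_mul, Real.norm_of_nonneg (by positivity)]
    exact inv_le_one_of_one_le₀ h

theorem exists_boxDistribution_slice {l : ℝ} (μ : Measure ℝ) [IsFiniteMeasure μ] (p : ℝ) :
    ∃ Λ : BoxDistribution l, ∀ σ : BoxTest l, Λ σ = ∫ x, σ (x, p) ∂μ := by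
  have hm : Measurable fun x : ℝ => (x, p) := by fun_prop
  obtain ⟨Λ, hΛ⟩ := exists_boxDistribution_of_density (l := l)
    (integrable_weight_of_finite (μ.map fun x => (x, p)))
  refine ⟨Λ, fun σ => ?_⟩
  simp only [(hΛ σ).2, one_mul]
  exact integral_map hm.aemeasurable σ.continuous.aestronglyMeasurable

theorem exists_boxDistribution_spreadPacket {l : ℝ} (hl : 0 < l) (D : ℝ≥0∞) (b p : ℝ) :
    ∃ Λ : BoxDistribution l, ∀ σ : BoxTest l, Λ σ = spreadPacket l D b p σ := by
  by_cases hD : D = ⊤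
  · obtain ⟨Λ₁, h₁⟩ := exists_boxDistribution_slice (l := l) (volume.restrict (Ioc (-l) l)) p
    obtain ⟨Λ₂, h₂⟩ := exists_boxDistribution_slice (l := l) (volume.restrict (Ioc (-l) l)) (-p)
    refine ⟨(1 / (4 * l)) • Λ₁ + (1 / (4 * l)) • Λ₂, fun σ => ?_⟩
    have h3 : ((1 / (4 * l)) • Λ₁ + (1 / (4 * l)) • Λ₂ : BoxDistribution l) σ =
      (1 / (4 * l)) * Λ₁ σ + (1 / (4 * l)) * Λ₂ σ := rfl
    rw [h3, h₁, h₂, spreadPacket, hD, if_neg ENNReal.top_ne_zero, if_pos rfl,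
      intervalIntegral.integral_of_le (by linarith), intervalIntegral.integral_of_le (by linarith)]
  · obtain ⟨Λ, hΛ⟩ := exists_boxDistribution_slice (l := l)
      (ProbabilityTheory.gaussianReal b (D.toNNReal ^ 2)) p
    exact ⟨Λ, fun σ => by rw [hΛ, spreadPacket_eq_integral_gaussianReal hD]⟩

theorem exists_boxDistribution_limitPairing {l : ℝ} (hl : 0 < l) (m c : ℝ) (D : ℝ≥0∞) (s : ℝ)
    (z : ℝ × ℝ) : ∃ Λ : BoxDistribution l, ∀ σ : BoxTest l, Λ σ = limitPairing l m c D s z σ := by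
  by_cases hc : ∃ r : ℚ, (r : ℝ) = c
  · choose Λ hΛ using fun b => exists_boxDistribution_spreadPacket hl D b z.2
    refine ⟨(1 / (packetCount hc.choose.den : ℝ)) • ∑ k ∈ Finset.range (packetCount hc.choose.den),
      Λ (z.1 + 4 * k * l / packetCount hc.choose.den + packetShift l hc.choose.den - z.2 / m * s),
      fun σ => ?_⟩
    rw [limitPairing, dif_pos hc]
    simp only [← hΛ]
    exact congrArg (1 / (packetCount hc.choose.den : ℝ) * ·)
      (map_sum (AddMonoidHom.mk' (fun Λ : BoxDistribution l => Λ σ) fun _ _ => rfl) _ _)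
  · obtain ⟨Λ, hΛ⟩ := exists_boxDistribution_spreadPacket hl ⊤ 0 z.2
    exact ⟨Λ, fun σ => by rw [limitPairing, dif_neg hc, hΛ]⟩

theorem exists_boxDistribution_transitionDensity {h α m l : ℝ} (hh : 0 < h) (hα : 0 < α)
    (hm : 0 < m) (hl : 0 < l) (t : ℝ) (z : ℝ × ℝ) :
    ∃ Λ : BoxDistribution l, ∀ σ : BoxTest l,
      IntegrableOn (fun z' => transitionDensity h α m l t z z' * σ z') (phaseStrip l) ∧
      Λ σ = ∫ z' in phaseStrip l, transitionDensity h α m l t z z' * σ z' := by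
  obtain ⟨C, hC⟩ := exists_transitionDensity_le hh hα hm hl t z
  refine exists_boxDistribution_of_density ?_
  have h1 : Integrable (fun z : ℝ × ℝ => (1 : ℝ) * (1 + z.2 ^ 2)⁻¹)
      (volume.restrict (phaseStrip l)) := by
    rw [phaseStrip, Measure.volume_eq_prod, ← Measure.prod_restrict, Measure.restrict_univ]
    exact Integrable.mul_prod (f := fun _ : ℝ => (1 : ℝ)) (g := fun p : ℝ => (1 + p ^ 2)⁻¹)
      (integrable_const _) integrable_inv_one_add_sq
  simp only [one_mul] at h1
  refine h1.bdd_mul (c := C) ?_ (Eventually.of_forall fun z' => ?_)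
  · exact (continuous_transitionDensity hh hα hm hl t z).aestronglyMeasurable
  · rw [Real.norm_of_nonneg (transitionDensity_nonneg hh α m l t z z')]
    exact hC z'

/-! ### Uniform convergence -/

/-- A set that avoids a neighbourhood of a compact set avoids a closed sup-norm tube around it. -/
theorem exists_le_dist_of_disjoint_nhdsSet {K V A : Set (ℝ × ℝ)} (hK : IsCompact K)
    (hV : V ∈ 𝓝ˢ K) (hA : Disjoint A V) : ∃ δ, 0 < δ ∧ ∀ z ∈ A, ∀ w ∈ K, δ ≤ dist z w := by
  obtain ⟨δ, hδ, h⟩ := hK.exists_thickening_subset_open isOpen_interior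
    (subset_interior_iff_mem_nhdsSet.2 hV)
  refine ⟨δ, hδ, fun z hz w hw => ?_⟩
  by_contra! hlt
  exact disjoint_left.1 hA hz (interior_subset (h (Metric.mem_thickening_iff.2 ⟨w, hw, hlt⟩)))

theorem exists_le_abs_momentum {l : ℝ} {A V : Set (ℝ × ℝ)} (hA : A ⊆ phaseStrip l)
    (hV : V ∈ 𝓝ˢ (Icc (-l) l ×ˢ ({0} : Set ℝ))) (hAV : Disjoint A V) :
    ∃ δ, 0 < δ ∧ ∀ z ∈ A, δ ≤ |z.2| := by
  obtain ⟨δ, hδ, h⟩ := exists_le_dist_of_disjoint_nhdsSet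
    (isCompact_Icc.prod isCompact_singleton) hV hAV
  refine ⟨δ, hδ, fun z hz => ?_⟩
  have := h z hz (z.1, 0) ⟨(hA hz).1, rfl⟩
  simpa [Prod.dist_eq, Real.dist_eq] using this

/-- Away from the corners `(± l, 0)` either the momentum is bounded away from zero or the position
is bounded away from the walls. -/
theorem exists_le_abs_momentum_or_abs_position_le {l : ℝ} {A V : Set (ℝ × ℝ)}
    (hA : A ⊆ phaseStrip l) (hV : V ∈ 𝓝ˢ ({(l, 0), (-l, 0)} : Set (ℝ × ℝ)))
    (hAV : Disjoint A V) : ∃ δ, 0 < δ ∧ ∀ z ∈ A, δ ≤ |z.2| ∨ |z.1| ≤ l - δ := by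
  obtain ⟨δ, hδ, h⟩ := exists_le_dist_of_disjoint_nhdsSet (Set.toFinite _).isCompact hV hAV
  refine ⟨δ, hδ, fun z hz => ?_⟩
  have h1 := h z hz (l, 0) (by simp)
  have h2 := h z hz (-l, 0) (by simp)
  have h3 := (hA hz).1
  simp only [Prod.dist_eq, Real.dist_eq, sub_zero, le_max_iff] at h1 h2
  rcases h1 with h1 | h1
  · rcases h2 with h2 | h2
    · right
      rw [abs_of_nonpos (by linarith [h3.2])] at h1
      rw [abs_of_nonneg (by linarith [h3.1])] at h2
      rw [abs_le]
      constructor <;> linarith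
    · exact Or.inl h2
  · exact Or.inl h1

theorem tendstoUniformlyOn_union {ι X : Type*} {F : Filter ι} {f : ι → X → ℝ} {g : X → ℝ}
    {A B : Set X} (hA : TendstoUniformlyOn f g F A) (hB : TendstoUniformlyOn f g F B) :
    TendstoUniformlyOn f g F (A ∪ B) := fun u hu => by
  filter_upwards [hA u hu, hB u hu] with i h1 h2 x hx
  exact hx.elim (h1 x) (h2 x)

section Uniform

variable {l m c : ℝ} {D : ℝ≥0∞} {ι : Type*} {F : Filter ι} {h α t : ι → ℝ}

/-- Uniformity on `A` follows from the limit theorem applied along the filter `F ×ˢ 𝓟 A`, where the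
phase point is part of the variable. -/
theorem tendstoUniformlyOn_integral_sub_limitPairing (hl : 0 < l) (hm : 0 < m)
    (hh : Tendsto h F (𝓝[>] 0)) (hα : Tendsto α F (𝓝[>] 0))
    (hhα : Tendsto (fun i => h i / α i) F (𝓝 0))
    (hD : Tendsto (fun i => ((h i / α i * (t i - c * boxRevivalTime (h i) m l) : ℝ) : EReal)) F
      (𝓝 (((2 * m : ℝ) : EReal) * (D : EReal))))
    (hc : Tendsto (fun i => h i * (t i - c * boxRevivalTime (h i) m l)) F (𝓝 0))
    (σ : BoxTest l) {δ : ℝ} (hδ : 0 < δ) {A : Set (ℝ × ℝ)}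
    (hA : (∀ z ∈ A, δ ≤ |z.2|) ∨ (∃ n : ℤ, 2 * c = n) ∧ ∀ z ∈ A, |z.1| ≤ l - δ) :
    TendstoUniformlyOn (fun i z => (∫ z' in phaseStrip l,
      transitionDensity (h i) (α i) m l (t i) z z' * σ z') -
      limitPairing l m c D (t i - c * boxRevivalTime (h i) m l) z σ) 0 F A := by
  have hfst : Tendsto (Prod.fst : ι × (ℝ × ℝ) → ι) (F ×ˢ 𝓟 A) F := tendsto_fst
  have hsnd : ∀ᶠ x in F ×ˢ 𝓟 A, x.2 ∈ A :=
    tendsto_snd.eventually (mem_principal_self A)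
  have hmain := tendsto_integral_sub_limitTerm (z := Prod.snd) (c := c) hl hm (hh.comp hfst)
    (hα.comp hfst) (hhα.comp hfst) (hD.comp hfst) (hc.comp hfst) σ hδ (by
      rcases hA with hA | ⟨hn, hA⟩
      · exact Or.inl (hsnd.mono fun x hx => hA _ hx)
      · exact Or.inr ⟨hn, hsnd.mono fun x hx => hA _ hx⟩)
  rw [Metric.tendstoUniformlyOn_iff]
  intro ε hε
  have h1 := (Metric.tendsto_nhds.1 hmain ε hε)
  rw [eventually_prod_principal_iff] at h1
  filter_upwards [h1] with i hi z hz
  have h2 := hi z hz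
  simp only [Function.comp_apply, add_sub_cancel] at h2
  rw [(hasSum_limitTerm hl m c D _ z σ).tsum_eq, ← Complex.ofReal_sub, dist_zero_right,
    Complex.norm_real] at h2
  rwa [Pi.zero_apply, dist_comm, dist_zero_right]

end Uniform

theorem theorem2 {l m : ℝ} (hl : 0 < l) (hm : 0 < m) (c : ℝ) (D : ℝ≥0∞)
    {ι : Type*} (F : Filter ι) (h α t : ι → ℝ)
    (hh : Tendsto h F (𝓝[>] 0)) (hα : Tendsto α F (𝓝[>] 0))
    (hhα : Tendsto (fun i => h i / α i) F (𝓝 0))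
    (hD : Tendsto (fun i => ((h i / α i * (t i - c * boxRevivalTime (h i) m l) : ℝ) : EReal)) F
      (𝓝 (((2 * m : ℝ) : EReal) * (D : EReal))))
    (hc : Tendsto (fun i => h i * (t i - c * boxRevivalTime (h i) m l)) F (𝓝 0)) :
    ∃ T L : ι → ℝ × ℝ → BoxDistribution l,
      -- `T i z` is the regular distribution with the density `(1 / 2πh) |(ω_z, ω_{z',t})|²`
      (∀ᶠ i in F, ∀ z ∈ phaseStrip l, ∀ σ : BoxTest l,
        IntegrableOn (fun z' => transitionDensity (h i) (α i) m l (t i) z z' * σ z')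
          (phaseStrip l) ∧
        T i z σ = ∫ z' in phaseStrip l, transitionDensity (h i) (α i) m l (t i) z z' * σ z') ∧
      -- `L i z` is the average of the spread packets
      (∀ i, ∀ z ∈ phaseStrip l, ∀ σ : BoxTest l,
        L i z σ = limitPairing l m c D (t i - c * boxRevivalTime (h i) m l) z σ) ∧
      -- the limit formula at a fixed phase point
      (∀ z ∈ phaseStrip l,
        (z.2 ≠ 0 ∨ ((∃ n : ℤ, 2 * c = n) ∧ z ≠ (l, 0) ∧ z ≠ (-l, 0))) →
          Tendsto (fun i => T i z - L i z) F (𝓝 0)) ∧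
      -- uniform convergence away from `p = 0`
      (∀ A ⊆ phaseStrip l, (∃ V ∈ 𝓝ˢ (Icc (-l) l ×ˢ ({0} : Set ℝ)), Disjoint A V) →
        ∀ σ : BoxTest l, TendstoUniformlyOn (fun i z => (T i z - L i z) σ) 0 F A) ∧
      -- uniform convergence away from the corners for integer or half-integer `c`
      ((∃ n : ℤ, 2 * c = n) →
        ∀ A ⊆ phaseStrip l, (∃ V ∈ 𝓝ˢ ({(l, 0), (-l, 0)} : Set (ℝ × ℝ)), Disjoint A V) →
          ∀ σ : BoxTest l, TendstoUniformlyOn (fun i z => (T i z - L i z) σ) 0 F A) := by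
  have hex : ∀ i z, ∃ Λ : BoxDistribution l, 0 < h i → 0 < α i → ∀ σ : BoxTest l,
      IntegrableOn (fun z' => transitionDensity (h i) (α i) m l (t i) z z' * σ z')
        (phaseStrip l) ∧
      Λ σ = ∫ z' in phaseStrip l, transitionDensity (h i) (α i) m l (t i) z z' * σ z' := by
    intro i z
    by_cases hi : 0 < h i ∧ 0 < α i
    · obtain ⟨Λ, hΛ⟩ := exists_boxDistribution_transitionDensity hi.1 hi.2 hm hl (t i) z
      exact ⟨Λ, fun _ _ => hΛ⟩
    · exact ⟨0, fun h1 h2 => absurd ⟨h1, h2⟩ hi⟩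
  choose T hT using hex
  choose L hL using fun i z => exists_boxDistribution_limitPairing hl m c D
    (t i - c * boxRevivalTime (h i) m l) z
  have hpos : ∀ᶠ i in F, 0 < h i ∧ 0 < α i :=
    (hh.eventually self_mem_nhdsWithin).and (hα.eventually self_mem_nhdsWithin)
  have hunif : ∀ (A : Set (ℝ × ℝ)) (δ : ℝ), 0 < δ →
      ((∀ z ∈ A, δ ≤ |z.2|) ∨ (∃ n : ℤ, 2 * c = n) ∧ ∀ z ∈ A, |z.1| ≤ l - δ) →
      ∀ σ : BoxTest l, TendstoUniformlyOn (fun i z => (T i z - L i z) σ) 0 F A := by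
    intro A δ hδ hA σ
    refine (tendstoUniformlyOn_integral_sub_limitPairing hl hm hh hα hhα hD hc σ hδ hA).congr ?_
    filter_upwards [hpos] with i hi z _
    exact (congrArg₂ (· - ·) (hT i z hi.1 hi.2 σ).2 (hL i z σ)).symm
  have hseg : ∀ A ⊆ phaseStrip l,
      (∃ V ∈ 𝓝ˢ (Icc (-l) l ×ˢ ({0} : Set ℝ)), Disjoint A V) →
      ∀ σ : BoxTest l, TendstoUniformlyOn (fun i z => (T i z - L i z) σ) 0 F A := by
    rintro A hA ⟨V, hV, hAV⟩ σ
    obtain ⟨δ, hδ, hAδ⟩ := exists_le_abs_momentum hA hV hAV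
    exact hunif A δ hδ (Or.inl hAδ) σ
  have hcorner : (∃ n : ℤ, 2 * c = n) → ∀ A ⊆ phaseStrip l,
      (∃ V ∈ 𝓝ˢ ({(l, 0), (-l, 0)} : Set (ℝ × ℝ)), Disjoint A V) →
      ∀ σ : BoxTest l, TendstoUniformlyOn (fun i z => (T i z - L i z) σ) 0 F A := by
    rintro hn A hA ⟨V, hV, hAV⟩ σ
    obtain ⟨δ, hδ, hAδ⟩ := exists_le_abs_momentum_or_abs_position_le hA hV hAV
    refine (tendstoUniformlyOn_union
      (hunif {z ∈ A | δ ≤ |z.2|} δ hδ (Or.inl fun z hz => hz.2) σ)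
      (hunif {z ∈ A | |z.1| ≤ l - δ} δ hδ (Or.inr ⟨hn, fun z hz => hz.2⟩) σ)).mono
      fun z hz => (hAδ z hz).imp (fun h => ⟨hz, h⟩) fun h => ⟨hz, h⟩
  refine ⟨T, L, ?_, fun i z _ σ => hL i z σ, fun z hz hz' => ?_, hseg, hcorner⟩
  · filter_upwards [hpos] with i hi z _ σ
    exact hT i z hi.1 hi.2 σ
  · rw [tendsto_iff_forall_eval_tendsto_topDualPairing]
    intro σ
    have hu : TendstoUniformlyOn (fun i z => (T i z - L i z) σ) 0 F {z} := by
      have hsub : {z} ⊆ phaseStrip l := singleton_subset_iff.2 hz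
      rcases hz' with hp | ⟨hn, h1, h2⟩
      · exact hunif {z} |z.2| (abs_pos.2 hp) (Or.inl fun w hw => by rw [hw]) σ
      · refine hcorner hn {z} hsub ⟨{z}ᶜ, ?_, disjoint_compl_right⟩ σ
        refine isOpen_compl_singleton.mem_nhdsSet.2 ?_
        rintro w (rfl | rfl)
        · exact h1.symm
        · exact h2.symm
    exact hu.tendsto_at (mem_singleton z)
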